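/- Let $(X,A_X)$ be a ringed topos ($A_X$ a sheaf of commutative rings), and let $K=\bigoplus_n K^n$ be a coconnective ($K^n=0$ for $n<0$) commutative differential graded $A_X$-algebra, where graded-commutative means $xy=(-1)^{ij}yx$ for $x\in K^i$, $y\in K^j$. Assume that $K$ is an abstract Koszul complex, that is: (C1) the structure map $A_X\to H^0(K)$ is an isomorphism; (C2) for every $q\ge 0$ the multiplication map $H^1(K)^{\otimes q}\to H^q(K)$ factors through an isomorphism $\bigwedge^q H^1(K)\to H^q(K)$ (exterior power over $A_X$). Assume moreover the flatness condition (C3) the $A_X$-modules $K^0$, $dK^0$, $Z^1K=\ker(d\colon K^1\to K^2)$ and $H^1(K)$ are flat. For integers $a, b$ let $\tau_{\le b}$ and $\tau_{\ge a}$ denote the canonical truncations of complexes of $A_X$-modules (which preserve the cohomology in degrees $\le b$, resp. $\ge a$, and kill the rest), and put $\tau_{[a,b]}=\tau_{\ge a}\tau_{\le b}$. A complex $L$ of $A_X$-modules is called decomposable if it is isomorphic, in the derived category of $A_X$-modules, to the complex $\bigoplus_i H^i(L)[-i]$ with zero differential. Let $m\ge 0$ be an integer such that $m!$ is invertible in $A_X$,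 and suppose that $\tau_{\le 1}(K)$ is decomposable. Then $\tau_{[a,b]}(K)$ is decomposable for all integers $a\le b<a+m$. Moreover, $\tau_{\le m}(K)$ is decomposable. -/

import Mathlib

open CategoryTheory

universe w u

namespace AbstractKoszul

noncomputable section

/-! ### Sheaves of modules on a ringed topos

A ringed topos is given by a small site `(C, J)` and a sheaf of commutative rings `A` on it;
the `A`-modules are Mathlib's sheaves of modules. -/

section Modules

variable {C : Type u} [SmallCategory C] {J : GrothendieckTopology C}

/-- The sheaf of rings underlying a sheaf of commutative rings. -/
abbrev ringSheaf (A : Sheaf J CommRingCat.{u}) : Sheaf J RingCat.{u} :=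
  ⟨A.obj ⋙ forget₂ CommRingCat RingCat,
    ((sheafCompose J (forget₂ CommRingCat.{u} RingCat.{u})).obj A).property⟩

/-- The abelian category of sheaves of `A`-modules. -/
abbrev Mod (A : Sheaf J CommRingCat.{u}) := SheafOfModules.{u} (ringSheaf A)

/-- The associated sheaf of a presheaf of `A`-modules. -/
abbrev sheafify (A : Sheaf J CommRingCat.{u}) :
    PresheafOfModules.{u} (A.obj ⋙ forget₂ CommRingCat RingCat) ⥤ Mod A :=
  PresheafOfModules.sheafification (R := ringSheaf A) (𝟙 (ringSheaf A).obj)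

variable {A : Sheaf J CommRingCat.{u}}

/-- The canonical map, on sections over `U`, from a presheaf of modules to its associated sheaf. -/
def toSheafify (P : PresheafOfModules.{u} (A.obj ⋙ forget₂ CommRingCat RingCat)) (U : Cᵒᵖ) :
    P.obj U → ((sheafify A).obj P).val.obj U :=
  fun x => (((PresheafOfModules.sheafificationAdjunction (R := ringSheaf A)
    (𝟙 (ringSheaf A).obj)).unit.app P).app U).hom x

/-- The functor `M ⊗ -` on sheaves of `A`-modules: the tensor product of sheaves of modules is
the sheaf associated with `U ↦ M(U) ⊗ N(U)`, the tensor product being over `A(U)`. -/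
def tensorLeft (M : Mod A) : Mod A ⥤ Mod A :=
  SheafOfModules.forget (ringSheaf A) ⋙
    MonoidalCategory.tensorLeft
      (C := PresheafOfModules.{u} (A.obj ⋙ forget₂ CommRingCat RingCat)) M.val ⋙
    sheafify A

/-- A sheaf of `A`-modules `M` is flat if `M ⊗ -` preserves monomorphisms. -/
def IsFlat (M : Mod A) : Prop := (tensorLeft M).PreservesMonomorphisms

/-- The alternating map underlying the restriction map of the presheaf of exterior powers. -/
def exteriorPowerAlt (M : PresheafOfModules.{u} (A.obj ⋙ forget₂ CommRingCat RingCat)) (q : ℕ)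
    {U V : Cᵒᵖ} (f : U ⟶ V) :
    ModuleCat.AlternatingMap (R := A.obj.obj U) (M.obj U)
      ((ModuleCat.restrictScalars (A.obj.map f).hom).obj
        (ModuleCat.exteriorPower (R := A.obj.obj V) (M.obj V) q)) q where
  toFun z := _root_.exteriorPower.ιMulti (A.obj.obj V) q (M := M.obj V) (fun i => M.restrictₛₗ f (z i))
  map_update_add' z i x y := by
    have h : ∀ t, (fun j => M.restrictₛₗ f (Function.update z i t j)) =
        Function.update (fun j => M.restrictₛₗ f (z j)) i (M.restrictₛₗ f t) := fun t =>
      funext fun j => Function.apply_update (fun _ => M.restrictₛₗ f) z i t j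
    rw [h, h, h, map_add]
    exact (_root_.exteriorPower.ιMulti (A.obj.obj V) q (M := M.obj V)).map_update_add _ _ _ _
  map_update_smul' z i r x := by
    have h : ∀ t, (fun j => M.restrictₛₗ f (Function.update z i t j)) =
        Function.update (fun j => M.restrictₛₗ f (z j)) i (M.restrictₛₗ f t) := fun t =>
      funext fun j => Function.apply_update (fun _ => M.restrictₛₗ f) z i t j
    rw [h, h]
    have hs : M.restrictₛₗ f (r • x) = (A.obj.map f).hom r • M.restrictₛₗ f x :=
      M.map_smul f r x
    rw [hs]
    exact (_root_.exteriorPower.ιMulti (A.obj.obj V) q (M := M.obj V)).map_update_smul _ _ _ _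
  map_eq_zero_of_eq' z i j hij hne :=
    (_root_.exteriorPower.ιMulti (A.obj.obj V) q (M := M.obj V)).map_eq_zero_of_eq _
      (congrArg (M.restrictₛₗ f) hij) hne

/-- The presheaf `U ↦ Λ^q M(U)`, the exterior power being over `A(U)`. -/
def presheafExteriorPower (M : PresheafOfModules.{u} (A.obj ⋙ forget₂ CommRingCat RingCat))
    (q : ℕ) : PresheafOfModules.{u} (A.obj ⋙ forget₂ CommRingCat RingCat) where
  obj U := ModuleCat.exteriorPower (R := A.obj.obj U) (M.obj U) q
  map {U V} f := ModuleCat.exteriorPower.desc (R := A.obj.obj U) (exteriorPowerAlt M q f)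
  map_id U := by
    apply ModuleCat.exteriorPower.hom_ext (R := A.obj.obj U)
    ext z
    refine (ModuleCat.exteriorPower.desc_mk (R := A.obj.obj U) (exteriorPowerAlt M q (𝟙 U)) z).trans ?_
    change _root_.exteriorPower.ιMulti (A.obj.obj U) q (M := M.obj U) (fun i => M.map (𝟙 U) (z i)) =
      _root_.exteriorPower.ιMulti (A.obj.obj U) q (M := M.obj U) z
    congr 1
    funext i
    rw [M.map_id]
    rfl
  map_comp {U V W} f g := by
    apply ModuleCat.exteriorPower.hom_ext (R := A.obj.obj U)
    ext z
    refine (ModuleCat.exteriorPower.desc_mk (R := A.obj.obj U) (exteriorPowerAlt M q (f ≫ g)) z).trans ?_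
    have h1 := ModuleCat.exteriorPower.desc_mk (R := A.obj.obj U) (exteriorPowerAlt M q f) z
    have h2 := ModuleCat.exteriorPower.desc_mk (R := A.obj.obj V) (exteriorPowerAlt M q g)
      (fun i => M.map f (z i))
    have h3 : exteriorPowerAlt M q (f ≫ g) z =
        exteriorPowerAlt M q g (fun i => M.map f (z i)) := by
      change _root_.exteriorPower.ιMulti (A.obj.obj W) q (M := M.obj W) (fun i => M.map (f ≫ g) (z i)) =
        _root_.exteriorPower.ιMulti (A.obj.obj W) q (M := M.obj W) (fun i => M.map g (M.map f (z i)))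
      congr 1
      funext i
      exact M.map_comp_apply f g (z i)
    refine h3.trans (h2.symm.trans ?_)
    exact congrArg (ModuleCat.exteriorPower.desc (R := A.obj.obj V) (exteriorPowerAlt M q g)).hom
      h1.symm

/-- The exterior power `Λ^q M` of a sheaf of `A`-modules. -/
def exteriorPower (M : Mod A) (q : ℕ) : Mod A :=
  (sheafify A).obj (presheafExteriorPower M.val q)

/-- The local section `x₁ ∧ ⋯ ∧ x_q` of `Λ^q M`. -/
def wedge (M : Mod A) {q : ℕ} {U : Cᵒᵖ} (x : Fin q → M.val.obj U) :
    (exteriorPower M q).val.obj U :=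
  toSheafify (presheafExteriorPower M.val q) U
    (_root_.exteriorPower.ιMulti (A.obj.obj U) q (M := M.val.obj U) x)

end Modules

/-! ### Commutative differential graded algebras -/

section CDGA

variable {C : Type u} [SmallCategory C] {J : GrothendieckTopology C}

/-- A commutative differential graded `A`-algebra: a cochain complex of sheaves of `A`-modules
with a unit and an `A`-bilinear multiplication `K^p × K^q → K^{p+q}` of sheaves which is
associative, unital, graded-commutative and satisfies the Leibniz rule. -/
structure CDGA (A : Sheaf J CommRingCat.{u}) where
  /-- the underlying complex -/
  K : CochainComplex (Mod A) ℤ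
  /-- the unit, a global section of `K^0` -/
  one : (K.X 0).sections
  /-- the multiplication on sections over `U` -/
  mul (p q r : ℤ) (h : p + q = r) {U : Cᵒᵖ} :
    (K.X p).val.obj U → (K.X q).val.obj U → (K.X r).val.obj U
  map_mul (p q r : ℤ) (h : p + q = r) {U V : Cᵒᵖ} (f : U ⟶ V)
    (x : (K.X p).val.obj U) (y : (K.X q).val.obj U) :
    (K.X r).val.restrictₛₗ f (mul p q r h x y) =
      mul p q r h ((K.X p).val.restrictₛₗ f x) ((K.X q).val.restrictₛₗ f y)
  add_mul (p q r : ℤ) (h : p + q = r) {U : Cᵒᵖ}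
    (x x' : (K.X p).val.obj U) (y : (K.X q).val.obj U) :
    mul p q r h (x + x') y = mul p q r h x y + mul p q r h x' y
  mul_add (p q r : ℤ) (h : p + q = r) {U : Cᵒᵖ}
    (x : (K.X p).val.obj U) (y y' : (K.X q).val.obj U) :
    mul p q r h x (y + y') = mul p q r h x y + mul p q r h x y'
  smul_mul (p q r : ℤ) (h : p + q = r) {U : Cᵒᵖ} (a : A.obj.obj U)
    (x : (K.X p).val.obj U) (y : (K.X q).val.obj U) :
    mul p q r h (a • x) y = a • mul p q r h x y
  mul_smul (p q r : ℤ) (h : p + q = r) {U : Cᵒᵖ} (a : A.obj.obj U)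
    (x : (K.X p).val.obj U) (y : (K.X q).val.obj U) :
    mul p q r h x (a • y) = a • mul p q r h x y
  one_mul (p : ℤ) {U : Cᵒᵖ} (x : (K.X p).val.obj U) :
    mul 0 p p (zero_add p) (one.eval U) x = x
  mul_one (p : ℤ) {U : Cᵒᵖ} (x : (K.X p).val.obj U) :
    mul p 0 p (add_zero p) x (one.eval U) = x
  mul_assoc (p q r pq qr s : ℤ) (hpq : p + q = pq) (hqr : q + r = qr) (h : pq + r = s)
    (h' : p + qr = s) {U : Cᵒᵖ}
    (x : (K.X p).val.obj U) (y : (K.X q).val.obj U) (z : (K.X r).val.obj U) :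
    mul pq r s h (mul p q pq hpq x y) z = mul p qr s h' x (mul q r qr hqr y z)
  mul_comm (p q r : ℤ) (h : p + q = r) (h' : q + p = r) {U : Cᵒᵖ}
    (x : (K.X p).val.obj U) (y : (K.X q).val.obj U) :
    mul p q r h x y = (p * q).negOnePow • mul q p r h' y x
  leibniz (p q r p' q' r' : ℤ) (h : p + q = r) (hp : p + 1 = p') (hq : q + 1 = q')
    (hr : r + 1 = r') {U : Cᵒᵖ} (x : (K.X p).val.obj U) (y : (K.X q).val.obj U) :
    (K.d r r').val.app U (mul p q r h x y) =
      mul p' q r' (by lia) ((K.d p p').val.app U x) y +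
        p.negOnePow • mul p q' r' (by lia) x ((K.d q q').val.app U y)

namespace CDGA

variable {A : Sheaf J CommRingCat.{u}} (K : CDGA A)

lemma zero_mul (p q r : ℤ) (h : p + q = r) {U : Cᵒᵖ} (y : (K.K.X q).val.obj U) :
    K.mul p q r h 0 y = 0 := by
  have := K.add_mul p q r h 0 0 y
  simpa using this

lemma mul_zero (p q r : ℤ) (h : p + q = r) {U : Cᵒᵖ} (x : (K.K.X p).val.obj U) :
    K.mul p q r h x 0 = 0 := by
  have := K.mul_add p q r h x 0 0
  simpa using this

lemma d_one (U : Cᵒᵖ) : (K.K.d 0 1).val.app U (K.one.eval U) = 0 := by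
  have h := K.leibniz 0 0 0 1 1 1 (by lia) (by lia) (by lia) (by lia) (K.one.eval U) (K.one.eval U)
  rw [K.one_mul, K.one_mul, K.mul_one] at h
  simpa using h

/-- The structure map `A ⟶ K^0`, `a ↦ a • 1`. -/
def unitMap : SheafOfModules.unit (ringSheaf A) ⟶ K.K.X 0 :=
  (K.K.X 0).unitHomEquiv.symm K.one

lemma unitMap_d : K.unitMap ≫ K.K.d 0 1 = 0 := by
  rw [unitMap, SheafOfModules.unitHomEquiv_symm_comp, Equiv.symm_apply_eq]
  apply Subtype.ext
  funext U
  exact K.d_one U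

/-- The map `A ⟶ H^0(K)` induced by the structure map. -/
def unitToH0 : SheafOfModules.unit (ringSheaf A) ⟶ K.K.homology 0 :=
  K.K.liftCycles K.unitMap 1 (by simp) K.unitMap_d ≫ K.K.homologyπ 0

/-- The product `x₁ ⋯ x_q` of `q` local sections of `K^1`. -/
def prod {U : Cᵒᵖ} : (q : ℕ) → (Fin q → (K.K.X 1).val.obj U) → (K.K.X q).val.obj U
  | 0, _ => K.one.eval U
  | q + 1, x => K.mul q 1 ((q + 1 : ℕ) : ℤ) (by simp) (prod q (Fin.init x)) (x (Fin.last q))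

/-- The local section of `K^n` underlying a local section of the sheaf of cocycles `Z^n K`. -/
def ofCycle {U : Cᵒᵖ} {n : ℤ} (z : (K.K.cycles n).val.obj U) : (K.K.X n).val.obj U :=
  (K.K.iCycles n).val.app U z

/-- The local section of `H^n(K)` given by a local section of the sheaf of cocycles `Z^n K`. -/
def cohomologyClass {U : Cᵒᵖ} {n : ℤ} (z : (K.K.cycles n).val.obj U) :
    (K.K.homology n).val.obj U :=
  (K.K.homologyπ n).val.app U z

lemma d_ofCycle {U : Cᵒᵖ} {n m : ℤ} (z : (K.K.cycles n).val.obj U) :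
    (K.K.d n m).val.app U (K.ofCycle z) = 0 := by
  have h := K.K.iCycles_d n m
  have h' := congrArg (fun (φ : K.K.cycles n ⟶ K.K.X m) => φ.val.app U z) h
  exact h'

lemma d_prod {U : Cᵒᵖ} (q : ℕ) (x : Fin q → (K.K.X 1).val.obj U)
    (hx : ∀ i, (K.K.d 1 2).val.app U (x i) = 0) (r : ℤ) (hr : (q : ℤ) + 1 = r) :
    (K.K.d q r).val.app U (K.prod q x) = 0 := by
  induction q generalizing r with
  | zero =>
    obtain rfl : r = 1 := by simpa using hr.symm
    exact K.d_one U
  | succ q ih =>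
    have h := K.leibniz q 1 ((q + 1 : ℕ) : ℤ) ((q : ℤ) + 1) 2 r (by simp) rfl (by lia) hr
      (K.prod q (Fin.init x)) (x (Fin.last q))
    rw [ih (Fin.init x) (fun i => hx i.castSucc) _ rfl, hx, K.zero_mul, K.mul_zero] at h
    simpa [prod] using h

/-- Sections of `Z^n K` over `U` are the sections of `K^n` over `U` killed by `d`. -/
lemma exists_cycle {U : Cᵒᵖ} (n m : ℤ) (h : n + 1 = m) (x : (K.K.X n).val.obj U)
    (hx : (K.K.d n m).val.app U x = 0) :
    ∃ z : (K.K.cycles n).val.obj U, K.ofCycle z = x := by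
  let S := ShortComplex.mk (K.K.iCycles n) (K.K.d n m) (K.K.iCycles_d n m)
  have hS : S.Exact :=
    S.exact_of_f_is_kernel (K.K.cyclesIsKernel n m (by simpa using h))
  have : Mono S.f := inferInstanceAs (Mono (K.K.iCycles n))
  have : (SheafOfModules.evaluation.{u} (ringSheaf A) U).PreservesZeroMorphisms := ⟨fun _ _ => rfl⟩
  have : Limits.PreservesFiniteLimits (SheafOfModules.evaluation.{u} (ringSheaf A) U) :=
    SheafOfModules.Finite.evaluationPreservesFiniteLimits (ringSheaf A) U
  have hS' := hS.map_of_mono_of_preservesKernel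
    (SheafOfModules.evaluation.{u} (ringSheaf A) U) inferInstance inferInstance
  rw [ShortComplex.moduleCat_exact_iff] at hS'
  exact hS' x hx

/-- The cocycle `z₁ ⋯ z_q` given by local sections of `Z^1 K`. -/
def cycleProd {U : Cᵒᵖ} {q : ℕ} (z : Fin q → (K.K.cycles 1).val.obj U) :
    (K.K.cycles q).val.obj U :=
  (K.exists_cycle q (q + 1) rfl (K.prod q fun i => K.ofCycle (z i))
    (K.d_prod q _ (fun i => K.d_ofCycle (z i)) _ rfl)).choose

lemma ofCycle_cycleProd {U : Cᵒᵖ} {q : ℕ} (z : Fin q → (K.K.cycles 1).val.obj U) :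
    K.ofCycle (K.cycleProd z) = K.prod q fun i => K.ofCycle (z i) :=
  (K.exists_cycle q (q + 1) rfl (K.prod q fun i => K.ofCycle (z i))
    (K.d_prod q _ (fun i => K.d_ofCycle (z i)) _ rfl)).choose_spec

/-- `K` is an abstract Koszul complex: it is coconnective, `A ⟶ H^0(K)` is an isomorphism, and
for all `q ≥ 0` the multiplication map `H^1(K)^{⊗q} ⟶ H^q(K)` factors through an isomorphism
`Λ^q H^1(K) ≅ H^q(K)`. As sections of `H^1(K)` are locally classes of cocycles, the last condition
says that there is an isomorphism sending `[z₁] ∧ ⋯ ∧ [z_q]` to `[z₁ ⋯ z_q]` for all local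
sections `z₁, …, z_q` of `Z^1 K`. -/
structure IsAbstractKoszul : Prop where
  coconnective (n : ℤ) (hn : n < 0) : Limits.IsZero (K.K.X n)
  isIso_unitToH0 : IsIso K.unitToH0
  exists_iso (q : ℕ) : ∃ μ : exteriorPower (K.K.homology 1) q ≅ K.K.homology q,
    ∀ (U : Cᵒᵖ) (z : Fin q → (K.K.cycles 1).val.obj U),
      μ.hom.val.app U (wedge (K.K.homology 1) fun i => K.cohomologyClass (z i)) =
        K.cohomologyClass (K.cycleProd z)

/-- The `A`-modules `K^0`, `dK^0`, `Z^1 K` and `H^1(K)` are flat. -/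
structure IsFlatInLowDegrees : Prop where
  flat_zero : IsFlat (K.K.X 0)
  flat_boundaries : IsFlat (Abelian.image (K.K.d 0 1))
  flat_cycles : IsFlat (K.K.cycles 1)
  flat_homology : IsFlat (K.K.homology 1)

end CDGA

end CDGA

/-! ### Decomposable complexes -/

section Decomposable

variable {B : Type*} [Category* B] [Abelian B]

/-- The complex `⨁ H^i(K)[-i]`, with `H^i(K)` in degree `i` and zero differential. -/
def cohomologyComplex (K : CochainComplex B ℤ) : CochainComplex B ℤ where
  X i := K.homology i
  d _ _ := 0

/-- The truncation `τ_{[a,b]} K = τ_{≥ a} τ_{≤ b} K`. -/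
abbrev truncInterval (K : CochainComplex B ℤ) (a b : ℤ) : CochainComplex B ℤ :=
  (K.truncLE b).truncGE a

/-- `K` is decomposable if it is isomorphic to `⨁ H^i(K)[-i]` in the derived category. -/
def IsDecomposable [HasDerivedCategory.{w} B] (K : CochainComplex B ℤ) : Prop :=
  Nonempty (DerivedCategory.Q.obj K ≅ DerivedCategory.Q.obj (cohomologyComplex K))

end Decomposable

end

end AbstractKoszul

/-!
Write `H = H^1(K)`. For every `i` there is a morphism of complexes `T_i ⟶ K` which is an
isomorphism on `H^i`, where `T_i` has, in the relevant range of degrees, no cohomology outside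
degree `i`. A complex whose cohomology objects are each hit in this way is decomposable: the sum of
the truncations of the `T_i` is quasi-isomorphic both to it and to the sum of its shifted
cohomology objects (`isDecomposable_of_forall_exists`).

The decomposability of `τ_{≤ 1} K` provides an epimorphism `E ⟶ H` together with a lift to
cocycles and with primitives in `K^0` for the cocycles attached to the kernel
(`exists_splitting_of_isDecomposable`). Over an object `U` of the site, let `F` be the free module
on the set of sections of `E` and let `R` be the module of relations between their classes in
`H(U)`. The primitives give a map from `R` to `K^0` and the cocycles a map from `F` to `K^1`. As
`K` is graded commutative and `2` is invertible, these extend to the Koszul complex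
`Sym(R) ⊗ Λ(F)`, compatibly with products and differentials (`Splitting.d_toComp`). The sheaf
associated with its part of weight `i`, with `Sym^{i-p}(R) ⊗ Λ^p(F)` in degree `p`, is `T_i`.
Working with the free module on all sections makes everything functorial in `U`, so that no choice
of a flat resolution of `H` is needed.

In degree `i` the cohomology of `T_i` is `Λ^i H`, because the exterior algebra is right exact
(`exists_finset_koszulBoundaries`), and it maps isomorphically to `H^i(K)` because `K` is an
abstract Koszul complex (`Splitting.isIso_homologyMap_koszulHom`).

In degree `p < i` the exactness of `T_i` rests on the flatness of `H`. By the equational criterion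
(`locally_exists_of_isFlat`), finitely many relations between sections of `H` are locally
consequences of relations between coefficients. A cocycle involves only finitely many relations, so
after localization all of these are killed by a composition of endomorphisms of `R` of the form
`x ↦ x - c(x) b`. Such an endomorphism extends to the Koszul complex by Taylor's formula, and it
replaces a cocycle by a cohomologous one, by a homotopy built from Cartan's formula
(`KoszulModule.exists_d_eq_sub_theta`). Taylor's formula in symmetric degree `j = i - p` involves
`1 / j!`, and the homotopy involves `1 / (j + 1)!` unless `p = 0`. This is why the invertibility
of `m!` gives intervals of length less than `m`, and all degrees up to `m` when starting at `0`.
-/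

namespace AbstractKoszul

/-! ### Symmetric tensors with coefficients -/

section SymTensor

variable (R : Type*) [CommRing R] (L : Type*) [AddCommGroup L] [Module R L]
  (N : Type*) [AddCommGroup N] [Module R N]

/-- The relations expressing that `s ⊗ n` is multilinear in the elements of the multiset `s`. -/
def symRel : Set (Multiset L →₀ N) :=
  {x | (∃ l l' s n, x = Finsupp.single ((l + l') ::ₘ s) n - Finsupp.single (l ::ₘ s) n -
      Finsupp.single (l' ::ₘ s) n) ∨
    ∃ (r : R) (l : L) (s : Multiset L) (n : N),
      x = Finsupp.single ((r • l) ::ₘ s) n - Finsupp.single (l ::ₘ s) (r • n)}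

/-- The module `Sym(L) ⊗ N`, presented by the generators `s ⊗ n` for `s` a finite multiset of
elements of `L` (the product of these elements in `Sym(L)`) and `n` in `N`. -/
abbrev SymTensor : Type _ := (Multiset L →₀ N) ⧸ Submodule.span R (symRel R L N)

namespace SymTensor

variable {R L N}

variable (R) in
/-- The element `s ⊗ n` of `Sym(L) ⊗ N`, as a linear function of `n`. -/
noncomputable def mk (s : Multiset L) : N →ₗ[R] SymTensor R L N :=
  (Submodule.span R (symRel R L N)).mkQ.comp (Finsupp.lsingle s)

lemma mk_add (l l' : L) (s : Multiset L) (n : N) :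
    mk R ((l + l') ::ₘ s) n = mk R (l ::ₘ s) n + mk R (l' ::ₘ s) n := by
  rw [← sub_eq_zero, ← sub_sub]
  refine (Submodule.Quotient.mk_eq_zero _).2 (Submodule.subset_span (Or.inl ⟨l, l', s, n, rfl⟩))

lemma mk_smul (r : R) (l : L) (s : Multiset L) (n : N) :
    mk R ((r • l) ::ₘ s) n = r • mk R (l ::ₘ s) n := by
  rw [← map_smul, ← sub_eq_zero]
  refine (Submodule.Quotient.mk_eq_zero _).2 (Submodule.subset_span (Or.inr ⟨r, l, s, n, rfl⟩))

lemma induction_mk {p : SymTensor R L N → Prop} (h0 : p 0) (hadd : ∀ x y, p x → p y → p (x + y))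
    (hmk : ∀ s n, p (mk R s n)) (x : SymTensor R L N) : p x := by
  obtain ⟨x, rfl⟩ := Submodule.Quotient.mk_surjective _ x
  induction x using Finsupp.induction_linear with
  | zero => exact h0
  | add x y hx hy => exact hadd _ _ hx hy
  | single s n => exact hmk s n

section Lift

variable {G : Type*} [AddCommGroup G]

/-- An additive map out of `Sym(L) ⊗ N`. Additive maps are used because restriction maps of
presheaves are only semilinear. -/
noncomputable def liftAdd (f : Multiset L → N →+ G)
    (h1 : ∀ l l' s n, f ((l + l') ::ₘ s) n = f (l ::ₘ s) n + f (l' ::ₘ s) n)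
    (h2 : ∀ (r : R) l s n, f ((r • l) ::ₘ s) n = f (l ::ₘ s) (r • n)) :
    SymTensor R L N →+ G :=
  QuotientAddGroup.lift (Submodule.span R (symRel R L N)).toAddSubgroup (Finsupp.liftAddHom f) (by
    intro x hx
    suffices h : ∀ r : R, Finsupp.liftAddHom f (r • x) = 0 by simpa using h 1
    change x ∈ Submodule.span R (symRel R L N) at hx
    induction hx using Submodule.span_induction with
    | mem x hx =>
      intro r
      rcases hx with ⟨l, l', s, n, rfl⟩ | ⟨r', l, s, n, rfl⟩
      · simp only [smul_sub, map_sub, Finsupp.smul_single, Finsupp.liftAddHom_apply_single, h1]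
        abel
      · simp only [smul_sub, map_sub, Finsupp.smul_single, Finsupp.liftAddHom_apply_single, h2,
          smul_smul, mul_comm r' r, sub_self]
    | zero => simp
    | add x y _ _ hx hy => intro r; rw [smul_add, map_add, hx, hy, add_zero]
    | smul a x _ hx => intro r; rw [smul_smul]; exact hx _)

@[simp] lemma liftAdd_mk (f : Multiset L → N →+ G) (h1 h2) (s : Multiset L) (n : N) :
    liftAdd (R := R) f h1 h2 (mk R s n) = f s n := by
  change Finsupp.liftAddHom f (Finsupp.single s n) = _
  simp

variable [Module R G]

/-- A linear map out of `Sym(L) ⊗ N`. -/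
noncomputable def lift (f : Multiset L → N →ₗ[R] G)
    (h1 : ∀ l l' s n, f ((l + l') ::ₘ s) n = f (l ::ₘ s) n + f (l' ::ₘ s) n)
    (h2 : ∀ (r : R) l s n, f ((r • l) ::ₘ s) n = f (l ::ₘ s) (r • n)) :
    SymTensor R L N →ₗ[R] G :=
  { liftAdd (R := R) (fun s => (f s : N →+ G)) (by simpa using h1) (by simpa using h2) with
    map_smul' := by
      intro r x
      change liftAdd (R := R) (fun s => (f s : N →+ G)) (by simpa using h1) (by simpa using h2)
        (r • x) = r • liftAdd (R := R) (fun s => (f s : N →+ G)) (by simpa using h1)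
          (by simpa using h2) x
      induction x using induction_mk with
      | h0 => simp
      | hadd x y hx hy => rw [smul_add, map_add, hx, hy, map_add, smul_add]
      | hmk s n => rw [← map_smul, liftAdd_mk, liftAdd_mk]; exact (f s).map_smul r n }

@[simp] lemma lift_mk (f : Multiset L → N →ₗ[R] G) (h1 h2) (s : Multiset L) (n : N) :
    lift f h1 h2 (mk R s n) = f s n :=
  liftAdd_mk (fun s => (f s : N →+ G)) (by simpa using h1) (by simpa using h2) s n

end Lift

/-- Multiplication by `l` on `Sym(L) ⊗ N`. -/
noncomputable def mulL (l : L) : SymTensor R L N →ₗ[R] SymTensor R L N :=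
  lift (fun s => mk R (l ::ₘ s))
    (fun a b s n => by simp only [Multiset.cons_swap l, mk_add])
    (fun r a s n => by simp only [Multiset.cons_swap l, mk_smul, map_smul])

@[simp] lemma mulL_mk (l : L) (s : Multiset L) (n : N) :
    mulL (R := R) l (mk R s n) = mk R (l ::ₘ s) n := lift_mk _ _ _ _ _

lemma mulL_add (l l' : L) (x : SymTensor R L N) :
    mulL (R := R) (l + l') x = mulL l x + mulL l' x := by
  induction x using induction_mk with
  | h0 => simp
  | hadd x y hx hy => simp only [map_add, hx, hy]; abel
  | hmk s n => simp [mk_add]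

lemma mulL_smul (r : R) (l : L) (x : SymTensor R L N) :
    mulL (R := R) (r • l) x = r • mulL l x := by
  induction x using induction_mk with
  | h0 => simp
  | hadd x y hx hy => simp only [map_add, hx, hy, smul_add]
  | hmk s n => simp [mk_smul]

lemma mulL_zero (x : SymTensor R L N) : mulL (R := R) (0 : L) x = 0 := by
  simpa using mulL_smul (0 : R) (0 : L) x

lemma mulL_sub (l l' : L) (x : SymTensor R L N) :
    mulL (R := R) (l - l') x = mulL l x - mulL l' x := by
  rw [eq_sub_iff_add_eq, ← mulL_add, sub_add_cancel]

lemma mulL_comm (l l' : L) (x : SymTensor R L N) :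
    mulL (R := R) l (mulL l' x) = mulL l' (mulL l x) := by
  induction x using induction_mk with
  | h0 => simp
  | hadd x y hx hy => simp only [map_add, hx, hy]
  | hmk s n => simp [Multiset.cons_swap l]

/-- `Sym(L) ⊗ N` is generated by `1 ⊗ N` under multiplication by elements of `L`. -/
lemma induction_mulL {p : SymTensor R L N → Prop} (hadd : ∀ x y, p x → p y → p (x + y))
    (hmk : ∀ n, p (mk R 0 n)) (hmul : ∀ l x, p x → p (mulL l x)) (x : SymTensor R L N) : p x := by
  induction x using induction_mk with
  | h0 => simpa using hmk 0
  | hadd x y hx hy => exact hadd _ _ hx hy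
  | hmk s n =>
    induction s using Multiset.induction with
    | empty => exact hmk n
    | cons l s ih => simpa using hmul l _ ih

/-- The map `Sym(L) ⊗ g`. -/
noncomputable def mapN {N' : Type*} [AddCommGroup N'] [Module R N'] (g : N →ₗ[R] N') :
    SymTensor R L N →ₗ[R] SymTensor R L N' :=
  lift (fun s => (mk R s).comp g) (fun a b s n => by simp [mk_add])
    (fun r a s n => by simp [mk_smul])

@[simp] lemma mapN_mk {N' : Type*} [AddCommGroup N'] [Module R N'] (g : N →ₗ[R] N')
    (s : Multiset L) (n : N) : mapN g (mk R s n) = mk R s (g n) := lift_mk _ _ _ _ _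

lemma mapN_mulL {N' : Type*} [AddCommGroup N'] [Module R N'] (g : N →ₗ[R] N') (l : L)
    (x : SymTensor R L N) : mapN g (mulL l x) = mulL l (mapN g x) := by
  induction x using induction_mk with
  | h0 => simp
  | hadd x y hx hy => simp only [map_add, hx, hy]
  | hmk s n => simp

open Classical in
/-- `∑ (s / x) ⊗ t x`, the sum being over the elements `x` of the multiset `s`. -/
noncomputable def derivAux (t : L →ₗ[R] Module.End R N) (s : Multiset L) :
    N →ₗ[R] SymTensor R L N :=
  (s.map fun x => (mk R (s.erase x)).comp (t x)).sum

lemma derivAux_cons (t : L →ₗ[R] Module.End R N) (l : L) (s : Multiset L) (n : N) :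
    derivAux t (l ::ₘ s) n = mk R s (t l n) + mulL l (derivAux t s n) := by
  classical
  have h : (s.map fun x => (mk R ((l ::ₘ s).erase x)).comp (t x)) =
      (s.map fun x => (mulL (R := R) l).comp ((mk R (s.erase x)).comp (t x))) := by
    refine Multiset.map_congr rfl fun x hx => ?_
    ext n
    have : (l ::ₘ s).erase x = l ::ₘ s.erase x := by
      by_cases hxl : x = l
      · subst hxl
        rw [Multiset.erase_cons_head, Multiset.cons_erase hx]
      · rw [Multiset.erase_cons_tail _ (Ne.symm hxl)]
    simp [this]
  unfold derivAux
  rw [Multiset.map_cons, Multiset.sum_cons, Multiset.erase_cons_head, h, LinearMap.add_apply]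
  refine congrArg (mk R s (t l n) + ·) ?_
  clear h
  have key (g : L → N →ₗ[R] SymTensor R L N) (s : Multiset L) :
      (s.map fun x => (mulL (R := R) l).comp (g x)).sum n = mulL l ((s.map g).sum n) := by
    induction s using Multiset.induction with
    | empty => simp
    | cons a s ih => simp [ih]
  exact key _ s

/-- The derivation-like operator `s ⊗ n ↦ ∑ (s / x) ⊗ t x n` on `Sym(L) ⊗ N`, the sum being over
the elements `x` of the multiset `s`. -/
noncomputable def deriv (t : L →ₗ[R] Module.End R N) : SymTensor R L N →ₗ[R] SymTensor R L N :=
  lift (derivAux t)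
    (fun a b s n => by
      simp only [derivAux_cons, mulL_add, map_add, LinearMap.add_apply]; abel)
    (fun r a s n => by
      simp only [derivAux_cons, mulL_smul, map_smul, LinearMap.smul_apply, smul_add])

@[simp] lemma deriv_mk_zero (t : L →ₗ[R] Module.End R N) (n : N) :
    deriv t (mk R 0 n) = 0 := by
  rw [deriv, lift_mk]
  simp [derivAux]

lemma deriv_mulL (t : L →ₗ[R] Module.End R N) (l : L) (x : SymTensor R L N) :
    deriv t (mulL l x) = mulL l (deriv t x) + mapN (t l) x := by
  induction x using induction_mk with
  | h0 => simp
  | hadd x y hx hy => simp only [map_add, hx, hy]; abel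
  | hmk s n => rw [mulL_mk, deriv, lift_mk, lift_mk, derivAux_cons, mapN_mk, add_comm]

end SymTensor

end SymTensor

/-! ### The Koszul complex of a linear map -/

section Koszul

variable {R : Type*} [CommRing R] {L : Type*} [AddCommGroup L] [Module R L]
  {F : Type*} [AddCommGroup F] [Module R F]

open SymTensor

variable (R L F) in
/-- The underlying module `Sym(L) ⊗ Λ(F)` of the Koszul complex of a linear map `L → F`. -/
abbrev KoszulModule : Type _ := SymTensor R L (ExteriorAlgebra R F)

namespace KoszulModule

variable (R L F) in
/-- The submodule `Sym^j(L) ⊗ Λ^k(F)`. It vanishes unless both integers `j` and `k` are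
nonnegative. -/
noncomputable def gr (j k : ℤ) : Submodule R (KoszulModule R L F) :=
  Submodule.span R {x | ∃ (s : Multiset L) (n : ℕ) (v : Fin n → F), (s.card : ℤ) = j ∧ (n : ℤ) = k ∧
    x = mk R s (ExteriorAlgebra.ιMulti R n v)}

lemma mk_mem_gr (s : Multiset L) {n : ℕ} (v : Fin n → F) :
    mk R s (ExteriorAlgebra.ιMulti R n v) ∈ gr R L F s.card n :=
  Submodule.subset_span ⟨s, n, v, rfl, rfl, rfl⟩

lemma gr_neg_left {j k : ℤ} (hj : j < 0) {x : KoszulModule R L F} (hx : x ∈ gr R L F j k) :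
    x = 0 := by
  induction hx using Submodule.span_induction with
  | mem x hx => obtain ⟨s, n, v, h1, h2, rfl⟩ := hx; lia
  | zero => rfl
  | add x y _ _ hx hy => rw [hx, hy, add_zero]
  | smul a x _ hx => rw [hx, smul_zero]

lemma gr_neg_right {j k : ℤ} (hk : k < 0) {x : KoszulModule R L F} (hx : x ∈ gr R L F j k) :
    x = 0 := by
  induction hx using Submodule.span_induction with
  | mem x hx => obtain ⟨s, n, v, h1, h2, rfl⟩ := hx; lia
  | zero => rfl
  | add x y _ _ hx hy => rw [hx, hy, add_zero]
  | smul a x _ hx => rw [hx, smul_zero]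

/-- A linear map sends `gr j k` to a submodule as soon as it does so on generators. -/
lemma map_mem_of_mk {M : Type*} [AddCommGroup M] [Module R M] (f : KoszulModule R L F →ₗ[R] M)
    {j k : ℤ} (p : Submodule R M)
    (h : ∀ (s : Multiset L) (n : ℕ) (v : Fin n → F), (s.card : ℤ) = j → (n : ℤ) = k →
      f (mk R s (ExteriorAlgebra.ιMulti R n v)) ∈ p)
    {x : KoszulModule R L F} (hx : x ∈ gr R L F j k) : f x ∈ p := by
  have : gr R L F j k ≤ p.comap f := Submodule.span_le.2 (by
    rintro x ⟨s, n, v, h1, h2, rfl⟩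
    exact h s n v h1 h2)
  exact this hx

lemma mulL_mem (l : L) {j k : ℤ} {x : KoszulModule R L F} (hx : x ∈ gr R L F j k) :
    mulL l x ∈ gr R L F (j + 1) k := by
  refine map_mem_of_mk _ _ (fun s n v h1 h2 => ?_) hx
  rw [mulL_mk]
  exact Submodule.subset_span ⟨_, n, v, by simp [h1], h2, rfl⟩

/-- Every element of `Sym^{j+1}(L) ⊗ Λ^k(F)` is a sum of products of elements of `L` with elements
of `Sym^j(L) ⊗ Λ^k(F)`. -/
lemma exists_eq_sum_mulL {j k : ℤ} (hj : 0 ≤ j) {x : KoszulModule R L F}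
    (hx : x ∈ gr R L F (j + 1) k) :
    ∃ y : L →₀ KoszulModule R L F, (∀ l, y l ∈ gr R L F j k) ∧
      x = y.sum fun l z => mulL l z := by
  classical
  induction hx using Submodule.span_induction with
  | mem x hx =>
    obtain ⟨s, n, v, h1, h2, rfl⟩ := hx
    obtain ⟨l, s, rfl⟩ : ∃ l t, s = l ::ₘ t := by
      obtain ⟨l, hl⟩ := Multiset.card_pos_iff_exists_mem.1 (show 0 < s.card by lia)
      exact ⟨l, s.erase l, (Multiset.cons_erase hl).symm⟩
    refine ⟨Finsupp.single l (mk R s (ExteriorAlgebra.ιMulti R n v)), fun l' => ?_, ?_⟩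
    · rw [Finsupp.single_apply]
      split_ifs
      · exact Submodule.subset_span ⟨s, n, v, by simpa using h1, h2, rfl⟩
      · exact zero_mem _
    · rw [Finsupp.sum_single_index (h := fun l z => mulL l z) (map_zero (mulL l)), mulL_mk]
  | zero => exact ⟨0, fun _ => zero_mem _, by simp⟩
  | add x y _ _ hx hy =>
    obtain ⟨a, ha, rfl⟩ := hx
    obtain ⟨b, hb, rfl⟩ := hy
    refine ⟨a + b, fun l => add_mem (ha l) (hb l), ?_⟩
    rw [Finsupp.sum_add_index' (fun _ => map_zero _) (fun _ => map_add _)]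
  | smul r x _ hx =>
    obtain ⟨a, ha, rfl⟩ := hx
    refine ⟨r • a, fun l => Submodule.smul_mem _ _ (ha l), ?_⟩
    rw [Finsupp.sum_smul_index' (fun _ => map_zero _), Finsupp.smul_sum]
    simp

/-- Left multiplication by `f` on the exterior algebra. -/
noncomputable def wedgeEnd : F →ₗ[R] Module.End R (ExteriorAlgebra R F) :=
  (LinearMap.mul R (ExteriorAlgebra R F)).comp (ExteriorAlgebra.ι R)

@[simp] lemma wedgeEnd_apply (f : F) (w : ExteriorAlgebra R F) :
    wedgeEnd (R := R) f w = ExteriorAlgebra.ι R f * w := rfl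

/-- Contraction with a linear form on the exterior algebra. -/
noncomputable def contract (c : F →ₗ[R] R) : Module.End R (ExteriorAlgebra R F) :=
  CliffordAlgebra.contractLeft c

lemma contract_ι_mul (c : F →ₗ[R] R) (f : F) (w : ExteriorAlgebra R F) :
    contract c (ExteriorAlgebra.ι R f * w) = c f • w - ExteriorAlgebra.ι R f * contract c w :=
  CliffordAlgebra.contractLeft_ι_mul ..

lemma contract_one (c : F →ₗ[R] R) : contract c (1 : ExteriorAlgebra R F) = 0 :=
  CliffordAlgebra.contractLeft_one ..

lemma ι_mul_ιMulti (f : F) {n : ℕ} (v : Fin n → F) :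
    ExteriorAlgebra.ι R f * ExteriorAlgebra.ιMulti R n v =
      ExteriorAlgebra.ιMulti R (n + 1) (Matrix.vecCons f v) := by
  rw [ExteriorAlgebra.ιMulti_succ_apply]
  rfl

lemma contract_ιMulti_mem (c : F →ₗ[R] R) (s : Multiset L) {n : ℕ} (v : Fin n → F) {k : ℤ}
    (hk : (n : ℤ) = k + 1) :
    mk R s (contract c (ExteriorAlgebra.ιMulti R n v)) ∈ gr R L F s.card k := by
  have key : ∀ (n : ℕ) (v : Fin (n + 1) → F), contract c (ExteriorAlgebra.ιMulti R (n + 1) v) ∈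
      Submodule.span R (Set.range (ExteriorAlgebra.ιMulti R (M := F) n)) := by
    intro n
    induction n with
    | zero =>
      intro v
      rw [ExteriorAlgebra.ιMulti_succ_apply, contract_ι_mul, ExteriorAlgebra.ιMulti_zero_apply,
        contract_one, mul_zero, sub_zero]
      exact Submodule.smul_mem _ _ (Submodule.subset_span ⟨![], by simp⟩)
    | succ n ih =>
      intro v
      rw [ExteriorAlgebra.ιMulti_succ_apply, contract_ι_mul]
      refine sub_mem (Submodule.smul_mem _ _ (Submodule.subset_span ⟨_, rfl⟩)) ?_
      have h := Submodule.mem_map_of_mem (f := wedgeEnd (R := R) (v 0)) (ih (fun i => v i.succ))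
      rw [Submodule.map_span] at h
      refine Submodule.span_mono ?_ h
      rintro _ ⟨_, ⟨y, rfl⟩, rfl⟩
      exact ⟨_, (ι_mul_ιMulti (v 0) y).symm⟩
  rcases n with _ | n
  · rw [ExteriorAlgebra.ιMulti_zero_apply, contract_one, map_zero]
    exact zero_mem _
  · obtain rfl : (n : ℤ) = k := by simpa using hk
    have h := Submodule.mem_map_of_mem (f := mk R s) (key n v)
    rw [Submodule.map_span] at h
    refine Submodule.span_mono ?_ h
    rintro _ ⟨_, ⟨y, rfl⟩, rfl⟩
    exact ⟨s, n, y, rfl, rfl, rfl⟩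

lemma wedge_mem (f : F) {j k : ℤ} {x : KoszulModule R L F} (hx : x ∈ gr R L F j k) :
    mapN (wedgeEnd (R := R) f) x ∈ gr R L F j (k + 1) := by
  refine map_mem_of_mk _ _ (fun s n v h1 h2 => ?_) hx
  rw [mapN_mk, wedgeEnd_apply, ι_mul_ιMulti]
  exact Submodule.subset_span ⟨_, _, _, h1, by simp [h2], rfl⟩

lemma contract_mem (c : F →ₗ[R] R) {j k : ℤ} {x : KoszulModule R L F}
    (hx : x ∈ gr R L F j k) : mapN (contract c) x ∈ gr R L F j (k - 1) := by
  refine map_mem_of_mk _ _ (fun s n v h1 h2 => ?_) hx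
  rw [mapN_mk]
  subst h1
  exact contract_ιMulti_mem c s v (by lia)

/-- The operator attached to `t` by `SymTensor.deriv` has bidegree `(-1, e)` if `t l` has degree
`e` for all `l`. -/
lemma deriv_mem (t : L →ₗ[R] Module.End R (ExteriorAlgebra R F)) (e : ℤ)
    (ht : ∀ l (j k : ℤ) (x : KoszulModule R L F), x ∈ gr R L F j k →
      mapN (t l) x ∈ gr R L F j (k + e)) {j k : ℤ} {x : KoszulModule R L F}
    (hx : x ∈ gr R L F j k) : deriv t x ∈ gr R L F (j - 1) (k + e) := by
  refine map_mem_of_mk _ _ (fun s n v h1 h2 => ?_) hx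
  subst h1 h2
  clear hx x
  induction s using Multiset.induction with
  | empty => rw [deriv_mk_zero]; exact zero_mem _
  | cons l s ih =>
    rw [← mulL_mk, deriv_mulL]
    refine add_mem ?_ ?_
    · convert mulL_mem l ih using 1
      simp
    · convert ht l _ _ _ (mk_mem_gr s v) using 1
      simp

/-- The Koszul differential `s ⊗ w ↦ ∑ (s / x) ⊗ (u x ∧ w)`. -/
noncomputable def d (u : L →ₗ[R] F) : KoszulModule R L F →ₗ[R] KoszulModule R L F :=
  deriv (wedgeEnd.comp u)

lemma d_mulL (u : L →ₗ[R] F) (l : L) (x : KoszulModule R L F) :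
    d u (mulL l x) = mulL l (d u x) + mapN (wedgeEnd (R := R) (u l)) x := deriv_mulL _ _ _

@[simp] lemma d_mk_zero (u : L →ₗ[R] F) (w : ExteriorAlgebra R F) : d u (mk R 0 w) = 0 :=
  deriv_mk_zero _ _

lemma d_mem (u : L →ₗ[R] F) {j k : ℤ} {x : KoszulModule R L F} (hx : x ∈ gr R L F j k) :
    d u x ∈ gr R L F (j - 1) (k + 1) := by
  refine deriv_mem _ 1 (fun l j k x hx => ?_) hx
  rw [LinearMap.comp_apply]
  exact wedge_mem (u l) hx

lemma wedge_wedge (f g : F) (x : KoszulModule R L F) :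
    mapN (wedgeEnd (R := R) f) (mapN (wedgeEnd (R := R) g) x) =
      -mapN (wedgeEnd (R := R) g) (mapN (wedgeEnd (R := R) f) x) := by
  induction x using induction_mk with
  | h0 => simp
  | hadd x y hx hy => simp only [map_add, hx, hy]; abel
  | hmk s n =>
    simp only [mapN_mk, wedgeEnd_apply, ← mul_assoc]
    rw [eq_neg_of_add_eq_zero_left (ExteriorAlgebra.ι_add_mul_swap f g), neg_mul, map_neg]

lemma d_wedge (u : L →ₗ[R] F) (f : F) (x : KoszulModule R L F) :
    d u (mapN (wedgeEnd (R := R) f) x) = -mapN (wedgeEnd (R := R) f) (d u x) := by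
  induction x using induction_mulL with
  | hadd x y hx hy => simp only [map_add, hx, hy]; abel
  | hmk w => simp
  | hmul l x hx =>
    simp only [mapN_mulL, d_mulL, hx, map_add, map_neg, wedge_wedge (u l) f]; abel

lemma d_d (u : L →ₗ[R] F) (x : KoszulModule R L F) : d u (d u x) = 0 := by
  induction x using induction_mulL with
  | hadd x y hx hy => simp only [map_add, hx, hy, add_zero]
  | hmk w => simp
  | hmul l x hx => simp only [d_mulL, map_add, hx, map_zero, d_wedge]; abel

/-- The operator `s ⊗ w ↦ ∑ c (u x) • (s / x) ⊗ w`: the derivative in the direction of the linear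
form `c`. -/
noncomputable def partialD (u : L →ₗ[R] F) (c : F →ₗ[R] R) :
    KoszulModule R L F →ₗ[R] KoszulModule R L F :=
  deriv ((c.comp u).smulRight 1)

lemma mapN_smul_one (r : R) (x : KoszulModule R L F) :
    mapN (r • (1 : Module.End R (ExteriorAlgebra R F))) x = r • x := by
  induction x using induction_mk with
  | h0 => simp
  | hadd x y hx hy => simp only [map_add, hx, hy, smul_add]
  | hmk s n => simp

lemma partialD_mulL (u : L →ₗ[R] F) (c : F →ₗ[R] R) (l : L) (x : KoszulModule R L F) :
    partialD u c (mulL l x) = mulL l (partialD u c x) + c (u l) • x := by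
  rw [partialD, deriv_mulL]
  exact congrArg _ (mapN_smul_one _ _)

@[simp] lemma partialD_mk_zero (u : L →ₗ[R] F) (c : F →ₗ[R] R) (w : ExteriorAlgebra R F) :
    partialD u c (mk R 0 w) = 0 := deriv_mk_zero _ _

lemma partialD_mem (u : L →ₗ[R] F) (c : F →ₗ[R] R) {j k : ℤ} {x : KoszulModule R L F}
    (hx : x ∈ gr R L F j k) : partialD u c x ∈ gr R L F (j - 1) k := by
  rw [← add_zero k]
  refine deriv_mem _ 0 (fun l j k x hx => ?_) hx
  change mapN (c (u l) • (1 : Module.End R (ExteriorAlgebra R F))) x ∈ _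
  rw [mapN_smul_one, add_zero]
  exact Submodule.smul_mem _ _ hx

lemma partialD_mapN (u : L →ₗ[R] F) (c : F →ₗ[R] R) (g : Module.End R (ExteriorAlgebra R F))
    (x : KoszulModule R L F) : partialD u c (mapN g x) = mapN g (partialD u c x) := by
  induction x using induction_mulL with
  | hadd x y hx hy => simp only [map_add, hx, hy]
  | hmk w => simp
  | hmul l x hx => simp only [mapN_mulL, partialD_mulL, hx, map_add, map_smul]

lemma contract_wedge (c : F →ₗ[R] R) (f : F) (x : KoszulModule R L F) :
    mapN (contract c) (mapN (wedgeEnd (R := R) f) x) =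
      c f • x - mapN (wedgeEnd (R := R) f) (mapN (contract c) x) := by
  induction x using induction_mk with
  | h0 => simp
  | hadd x y hx hy => simp only [map_add, hx, hy, smul_add]; abel
  | hmk s n => simp only [mapN_mk, wedgeEnd_apply, contract_ι_mul, map_sub, map_smul]

/-- Cartan's formula. -/
lemma d_contract (u : L →ₗ[R] F) (c : F →ₗ[R] R) (x : KoszulModule R L F) :
    d u (mapN (contract c) x) = partialD u c x - mapN (contract c) (d u x) := by
  induction x using induction_mulL with
  | hadd x y hx hy => simp only [map_add, hx, hy]; abel
  | hmk w => simp
  | hmul l x hx =>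
    simp only [mapN_mulL, d_mulL, partialD_mulL, hx, map_add, contract_wedge, map_sub]; abel

lemma d_partialD (u : L →ₗ[R] F) (c : F →ₗ[R] R) (x : KoszulModule R L F) :
    d u (partialD u c x) = partialD u c (d u x) := by
  have h1 := d_contract u c (d u x)
  have h2 := congrArg (d u) (d_contract u c x)
  rw [d_d, map_zero, sub_zero] at h1
  rw [d_d, map_sub, h1] at h2
  exact (sub_eq_zero.1 h2.symm)

lemma d_partialD_pow (u : L →ₗ[R] F) (c : F →ₗ[R] R) (a : ℕ) (x : KoszulModule R L F) :
    d u ((partialD u c ^ a) x) = (partialD u c ^ a) (d u x) := by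
  induction a generalizing x with
  | zero => rfl
  | succ a ih => rw [pow_succ, Module.End.mul_apply, ih, d_partialD, Module.End.mul_apply]

lemma partialD_pow_mapN (u : L →ₗ[R] F) (c : F →ₗ[R] R)
    (g : Module.End R (ExteriorAlgebra R F)) (a : ℕ) (x : KoszulModule R L F) :
    (partialD u c ^ a) (mapN g x) = mapN g ((partialD u c ^ a) x) := by
  induction a generalizing x with
  | zero => rfl
  | succ a ih => rw [pow_succ, Module.End.mul_apply, partialD_mapN, ih, Module.End.mul_apply]

lemma partialD_pow_mem (u : L →ₗ[R] F) (c : F →ₗ[R] R) (a : ℕ) {j k : ℤ}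
    {x : KoszulModule R L F} (hx : x ∈ gr R L F j k) :
    (partialD u c ^ a) x ∈ gr R L F (j - a) k := by
  induction a generalizing j x with
  | zero => simpa using hx
  | succ a ih =>
    rw [pow_succ, Module.End.mul_apply]
    convert ih (partialD_mem u c hx) using 1
    push_cast
    ring_nf

lemma mulL_pow_mem (b : L) (a : ℕ) {j k : ℤ} {x : KoszulModule R L F}
    (hx : x ∈ gr R L F j k) : (mulL (R := R) b ^ a) x ∈ gr R L F (j + a) k := by
  induction a generalizing j x with
  | zero => simpa using hx
  | succ a ih =>
    rw [pow_succ, Module.End.mul_apply]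
    convert ih (mulL_mem b hx) using 1
    push_cast
    ring_nf

/-- The Leibniz rule for iterated derivatives. -/
lemma partialD_pow_mulL (u : L →ₗ[R] F) (c : F →ₗ[R] R) (l : L) (a : ℕ)
    (x : KoszulModule R L F) :
    (partialD u c ^ (a + 1)) (mulL l x) = mulL l ((partialD u c ^ (a + 1)) x) +
      ((a + 1 : ℕ) * c (u l)) • (partialD u c ^ a) x := by
  induction a generalizing x with
  | zero => simp [partialD_mulL]
  | succ a ih =>
    rw [pow_succ, Module.End.mul_apply, partialD_mulL, map_add, ih, map_smul]
    simp only [← Module.End.mul_apply, ← pow_succ, add_assoc, ← add_smul]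
    congr 2
    push_cast
    ring

lemma d_mulL_pow (u : L →ₗ[R] F) (b : L) (a : ℕ) (x : KoszulModule R L F) :
    d u ((mulL (R := R) b ^ (a + 1)) x) = (mulL (R := R) b ^ (a + 1)) (d u x) +
      ((a + 1 : ℕ) : R) • (mulL (R := R) b ^ a) (mapN (wedgeEnd (R := R) (u b)) x) := by
  induction a generalizing x with
  | zero => simp [d_mulL]
  | succ a ih =>
    have hp : ∀ (a : ℕ) (y : KoszulModule R L F),
        (mulL (R := R) b ^ a) (mulL b y) = (mulL (R := R) b ^ (a + 1)) y := fun a y => by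
      rw [pow_succ, Module.End.mul_apply]
    rw [← hp, ih, d_mulL, map_add, mapN_mulL, hp, hp]
    push_cast
    simp only [add_smul, one_smul]
    abel

end KoszulModule

end Koszul

/-! ### Deformation of cocycles of the Koszul complex -/

section KoszulExact

variable {R : Type*} [CommRing R] {L : Type*} [AddCommGroup L] [Module R L]
  {F : Type*} [AddCommGroup F] [Module R F]

open SymTensor

namespace KoszulModule

/-- The endomorphism of the Koszul complex induced by the endomorphisms `x ↦ x - c (u x) b` of `L`
and `x ↦ x - c x • u b` of `F`, in symmetric degrees `≤ n` and with `q a` in place of `1 / a!`: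
on `Sym(L)` it is given by Taylor's formula. -/
noncomputable def theta (u : L →ₗ[R] F) (q : ℕ → R) (c : F →ₗ[R] R) (b : L) (n : ℕ)
    (y : KoszulModule R L F) : KoszulModule R L F :=
  ∑ a ∈ Finset.range (n + 1), ((-1) ^ a * q a) • (mulL (R := R) b ^ a)
    ((partialD u c ^ a) (y - mapN (wedgeEnd (R := R) (u b)) (mapN (contract c) y)))

lemma sub_wedge_contract_mem (c : F →ₗ[R] R) (f : F) {j k : ℤ} {y : KoszulModule R L F}
    (hy : y ∈ gr R L F j k) :
    y - mapN (wedgeEnd (R := R) f) (mapN (contract c) y) ∈ gr R L F j k := by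
  refine sub_mem hy ?_
  have h := wedge_mem f (contract_mem c hy)
  rwa [sub_add_cancel] at h

lemma theta_mem (u : L →ₗ[R] F) (q : ℕ → R) (c : F →ₗ[R] R) (b : L) (n : ℕ) {j k : ℤ}
    {y : KoszulModule R L F} (hy : y ∈ gr R L F j k) : theta u q c b n y ∈ gr R L F j k := by
  refine sum_mem fun a _ => Submodule.smul_mem _ _ ?_
  have h := mulL_pow_mem b a (partialD_pow_mem u c a (sub_wedge_contract_mem c (u b) hy))
  rwa [sub_add_cancel] at h

lemma theta_mulL (u : L →ₗ[R] F) (q : ℕ → R) (c : F →ₗ[R] R) (b : L) (n : ℕ)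
    (hq : ∀ a ≤ n, (a + 1 : ℕ) * q (a + 1) = q a) {k : ℤ} {y : KoszulModule R L F}
    (hy : y ∈ gr R L F n k) (l : L) :
    theta u q c b (n + 1) (mulL l y) = mulL (l - c (u l) • b) (theta u q c b n y) := by
  have hy' := sub_wedge_contract_mem c (u b) hy
  have h0 : mulL l y - mapN (wedgeEnd (R := R) (u b)) (mapN (contract c) (mulL l y)) =
      mulL l (y - mapN (wedgeEnd (R := R) (u b)) (mapN (contract c) y)) := by
    rw [mapN_mulL, mapN_mulL, map_sub]
  unfold theta
  rw [h0]
  generalize y - mapN (wedgeEnd (R := R) (u b)) (mapN (contract c) y) = y' at hy'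
  have hz : (partialD u c ^ (n + 1)) y' = 0 :=
    gr_neg_left (by push_cast; lia) (partialD_pow_mem u c (n + 1) hy')
  have hcomm : ∀ (a : ℕ) (x : KoszulModule R L F),
      (mulL (R := R) b ^ a) (mulL l x) = mulL l ((mulL (R := R) b ^ a) x) := by
    intro a x
    induction a generalizing x with
    | zero => rfl
    | succ a ih => rw [pow_succ, Module.End.mul_apply, mulL_comm, ih, Module.End.mul_apply]
  have hp : ∀ (a : ℕ) (x : KoszulModule R L F),
      (mulL (R := R) b ^ (a + 1)) x = mulL b ((mulL (R := R) b ^ a) x) := fun a x => by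
    rw [pow_succ', Module.End.mul_apply]
  rw [mulL_sub, mulL_smul]
  simp only [map_sum, map_smul]
  have e1 : ∑ a ∈ Finset.range (n + 1), ((-1) ^ a * q a) • mulL (R := R) l
        ((mulL (R := R) b ^ a) ((partialD u c ^ a) y')) =
      ∑ a ∈ Finset.range (n + 1), ((-1) ^ (a + 1) * q (a + 1)) • mulL (R := R) l
        ((mulL (R := R) b ^ (a + 1)) ((partialD u c ^ (a + 1)) y')) + q 0 • mulL l y' := by
    have h := Finset.sum_range_succ (fun a => ((-1) ^ a * q a) • mulL (R := R) l
        ((mulL (R := R) b ^ a) ((partialD u c ^ a) y'))) (n + 1)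
    rw [hz, map_zero, map_zero, smul_zero, add_zero] at h
    rw [← h, Finset.sum_range_succ']
    simp
  rw [e1, Finset.sum_range_succ', Finset.smul_sum, add_sub_right_comm,
    ← Finset.sum_sub_distrib]
  refine congrArg₂ (· + ·) (Finset.sum_congr rfl fun a ha => ?_) (by simp)
  rw [partialD_pow_mulL, map_add, hcomm, map_smul, smul_add, sub_eq_add_neg]
  refine congrArg _ ?_
  rw [smul_smul, smul_smul, ← hp, ← neg_smul, ← hq a (by simpa [Nat.lt_succ_iff] using ha)]
  congr 1
  ring

/-- A cocycle is cohomologous to its image under `theta`. In symmetric degree `n` this involves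
`1 / (n + 1)!`, except in exterior degree `0`. -/
lemma exists_d_eq_sub_theta (u : L →ₗ[R] F) (q : ℕ → R) (hq0 : q 0 = 1) (c : F →ₗ[R] R) (b : L)
    (n : ℕ) {k : ℤ} (hq : k = 0 ∨ ∀ a ≤ n, (a + 1 : ℕ) * q (a + 1) = q a)
    {z : KoszulModule R L F} (hz : z ∈ gr R L F n k) (hd : d u z = 0) :
    ∃ w ∈ gr R L F (n + 1) (k - 1), d u w = z - theta u q c b n z := by
  have hDI : d u (mapN (contract c) z) = partialD u c z := by
    rw [d_contract, hd, map_zero, sub_zero]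
  rcases hq with rfl | hq
  · have hI : mapN (contract c) z = 0 := gr_neg_right (by lia) (contract_mem c hz)
    refine ⟨0, zero_mem _, ?_⟩
    have hp : ∀ a, (partialD u c ^ (a + 1)) z = 0 := fun a => by
      rw [pow_succ, Module.End.mul_apply, ← hDI, hI, map_zero, map_zero]
    rw [theta, Finset.sum_range_succ', hI]
    simp [hp, hq0]
  · refine ⟨∑ a ∈ Finset.range (n + 1), ((-1) ^ a * q (a + 1)) • (mulL (R := R) b ^ (a + 1))
      ((partialD u c ^ a) (mapN (contract c) z)), sum_mem fun a _ => Submodule.smul_mem _ _ ?_, ?_⟩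
    · convert mulL_pow_mem b (a + 1) (partialD_pow_mem u c a (contract_mem c hz)) using 1
      push_cast
      ring_nf
    · have hz' : (partialD u c ^ (n + 1)) z = 0 :=
        gr_neg_left (by push_cast; lia) (partialD_pow_mem u c (n + 1) hz)
      simp only [map_sum, map_smul, d_mulL_pow, d_partialD_pow, hDI, smul_add, theta, map_sub,
        smul_sub, Finset.sum_add_distrib, Finset.sum_sub_distrib]
      have h := Finset.sum_range_succ (fun a => ((-1) ^ a * q a) •
        ((mulL (R := R) b ^ a) ((partialD u c ^ a) z))) (n + 1)
      rw [hz', map_zero, smul_zero, add_zero, Finset.sum_range_succ'] at h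
      rw [← h]
      simp only [pow_zero, hq0, mul_one, one_smul, Module.End.one_apply]
      rw [sub_sub_eq_add_sub, add_comm (∑ a ∈ _, _ • _) z, add_sub_add_left_eq_sub]
      rw [sub_eq_add_neg, add_comm, ← Finset.sum_neg_distrib]
      refine congrArg₂ (· + ·) (Finset.sum_congr rfl fun a ha => ?_)
        (Finset.sum_congr rfl fun a ha => ?_)
      · simp only [smul_smul, partialD_pow_mapN]
        rw [← hq a (by simpa [Nat.lt_succ_iff] using ha)]
        congr 1
        ring
      · rw [← Module.End.mul_apply (partialD u c ^ a), ← pow_succ, ← neg_smul]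
        congr 1
        ring

/-- A cocycle `∑ lᵢ yᵢ` of positive symmetric degree is a coboundary if all the `lᵢ` are killed by
a composition of endomorphisms of `L` of the form `x ↦ x - c (u x) b`: each of these replaces the
cocycle by a cohomologous one. -/
theorem exists_d_eq (u : L →ₗ[R] F) (q : ℕ → R) (hq0 : q 0 = 1) (n : ℕ) {k : ℤ}
    (hq : ∀ a ≤ n, (a + 1 : ℕ) * q (a + 1) = q a)
    (hq' : k = 0 ∨ ∀ a ≤ n + 1, (a + 1 : ℕ) * q (a + 1) = q a)
    (D : List ((F →ₗ[R] R) × L)) {ι : Type*} (s : Finset ι) (l : ι → L)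
    (hl : ∀ i ∈ s, D.foldl (fun x p => x - p.1 (u x) • p.2) (l i) = 0)
    (y : ι → KoszulModule R L F) (hy : ∀ i ∈ s, y i ∈ gr R L F n k)
    (hd : d u (∑ i ∈ s, mulL (l i) (y i)) = 0) :
    ∃ w ∈ gr R L F (n + 2) (k - 1), d u w = ∑ i ∈ s, mulL (l i) (y i) := by
  induction D generalizing l y with
  | nil =>
    refine ⟨0, zero_mem _, ?_⟩
    rw [map_zero, eq_comm]
    refine Finset.sum_eq_zero fun i hi => ?_
    rw [show l i = 0 from hl i hi, mulL_zero]
  | cons p D ih =>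
    have hz : ∑ i ∈ s, mulL (l i) (y i) ∈ gr R L F ((n + 1 : ℕ) : ℤ) k :=
      sum_mem fun i hi => by simpa using mulL_mem (l i) (hy i hi)
    obtain ⟨w, hw, hdw⟩ := exists_d_eq_sub_theta u q hq0 p.1 p.2 (n + 1) hq' hz hd
    have hth : theta u q p.1 p.2 (n + 1) (∑ i ∈ s, mulL (l i) (y i)) =
        ∑ i ∈ s, mulL (l i - p.1 (u (l i)) • p.2) (theta u q p.1 p.2 n (y i)) := by
      rw [← Finset.sum_congr rfl fun i hi => theta_mulL u q p.1 p.2 n hq (hy i hi) (l i)]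
      simp only [theta, map_sum, map_sub, ← Finset.sum_sub_distrib]
      rw [Finset.sum_comm]
      simp only [Finset.smul_sum]
    obtain ⟨w', hw', hdw'⟩ := ih (fun i => l i - p.1 (u (l i)) • p.2) hl
      (fun i => theta u q p.1 p.2 n (y i)) (fun i hi => theta_mem _ _ _ _ _ (hy i hi)) (by
        rw [← hth, ← sub_sub_cancel (∑ i ∈ s, mulL (l i) (y i)) (theta _ _ _ _ _ _), ← hdw,
          map_sub, hd, d_d, sub_zero])
    refine ⟨w + w', add_mem ?_ hw', ?_⟩
    · convert hw using 1
      push_cast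
      ring_nf
    · rw [map_add, hdw, hdw', hth, sub_add_cancel]

end KoszulModule

end KoszulExact

/-! ### Change of rings -/

section Semilinear

variable {R : Type*} [CommRing R] {R' : Type*} [CommRing R'] {ρ : R →+* R'}
  {L : Type*} [AddCommGroup L] [Module R L] {F : Type*} [AddCommGroup F] [Module R F]
  {L' : Type*} [AddCommGroup L'] [Module R' L'] {F' : Type*} [AddCommGroup F'] [Module R' F']

/-- The ring homomorphism between exterior algebras induced by a semilinear map. -/
noncomputable def extMap (g : F →ₛₗ[ρ] F') : ExteriorAlgebra R F →+* ExteriorAlgebra R' F' :=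
  letI : Algebra R (ExteriorAlgebra R' F') := Algebra.compHom _ ρ
  (ExteriorAlgebra.lift R (A := ExteriorAlgebra R' F')
    ⟨{ toFun := fun x => ExteriorAlgebra.ι R' (g x)
       map_add' := fun x y => by rw [map_add, map_add]
       map_smul' := fun r x => by
        rw [map_smulₛₗ, map_smul]; rfl }, fun x => ExteriorAlgebra.ι_sq_zero _⟩).toRingHom

@[simp] lemma extMap_ι (g : F →ₛₗ[ρ] F') (x : F) :
    extMap g (ExteriorAlgebra.ι R x) = ExteriorAlgebra.ι R' (g x) := by
  let _ : Algebra R (ExteriorAlgebra R' F') := Algebra.compHom _ ρ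
  exact ExteriorAlgebra.lift_ι_apply R (A := ExteriorAlgebra R' F') _ _ _

@[simp] lemma extMap_algebraMap (g : F →ₛₗ[ρ] F') (r : R) :
    extMap g (algebraMap R _ r) = algebraMap R' _ (ρ r) := by
  let _ : Algebra R (ExteriorAlgebra R' F') := Algebra.compHom _ ρ
  exact AlgHom.commutes (A := ExteriorAlgebra R F) (B := ExteriorAlgebra R' F') _ r

@[simp] lemma extMap_smul (g : F →ₛₗ[ρ] F') (r : R) (x : ExteriorAlgebra R F) :
    extMap g (r • x) = ρ r • extMap g x := by
  rw [Algebra.smul_def, Algebra.smul_def, map_mul, extMap_algebraMap]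

@[simp] lemma extMap_ιMulti (g : F →ₛₗ[ρ] F') {n : ℕ} (v : Fin n → F) :
    extMap g (ExteriorAlgebra.ιMulti R n v) = ExteriorAlgebra.ιMulti R' n (fun i => g (v i)) := by
  rw [ExteriorAlgebra.ιMulti_apply, ExteriorAlgebra.ιMulti_apply, map_list_prod, List.map_ofFn]
  congr 2
  funext i
  exact extMap_ι g _

lemma ringHom_ext_exteriorAlgebra {B : Type*} [Ring B] {φ ψ : ExteriorAlgebra R F →+* B}
    (h1 : ∀ r, φ (algebraMap R _ r) = ψ (algebraMap R _ r))
    (h2 : ∀ x, φ (ExteriorAlgebra.ι R x) = ψ (ExteriorAlgebra.ι R x)) (x : ExteriorAlgebra R F) :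
    φ x = ψ x := by
  induction x using ExteriorAlgebra.induction with
  | algebraMap r => exact h1 r
  | ι x => exact h2 x
  | mul a b ha hb => rw [map_mul, map_mul, ha, hb]
  | add a b ha hb => rw [map_add, map_add, ha, hb]

namespace KoszulModule

open SymTensor

/-- The functoriality of the Koszul complex with respect to semilinear maps, as an additive map. -/
noncomputable def mapAdd (f : L →ₛₗ[ρ] L') (g : F →ₛₗ[ρ] F') :
    KoszulModule R L F →+ KoszulModule R' L' F' :=
  SymTensor.liftAdd (R := R)
    (fun s : Multiset L => AddMonoidHom.mk' (fun n => mk R' (s.map f) (extMap g n)) (by simp))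
    (fun l l' s n => by simp [mk_add]) (fun r l s n => by simp [mk_smul])

@[simp] lemma mapAdd_mk (f : L →ₛₗ[ρ] L') (g : F →ₛₗ[ρ] F') (s : Multiset L)
    (n : ExteriorAlgebra R F) : mapAdd f g (mk R s n) = mk R' (s.map f) (extMap g n) :=
  liftAdd_mk _ _ _ s n

/-- The functoriality of the Koszul complex with respect to semilinear maps. -/
noncomputable def map (f : L →ₛₗ[ρ] L') (g : F →ₛₗ[ρ] F') :
    KoszulModule R L F →ₛₗ[ρ] KoszulModule R' L' F' :=
  { mapAdd f g with
    map_smul' := fun r x => by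
      change mapAdd f g (r • x) = ρ r • mapAdd f g x
      induction x using induction_mk with
      | h0 => simp
      | hadd x y hx hy => rw [smul_add, map_add, hx, hy, map_add, smul_add]
      | hmk s n => rw [← map_smul, mapAdd_mk, mapAdd_mk, extMap_smul, map_smul] }

@[simp] lemma map_mk (f : L →ₛₗ[ρ] L') (g : F →ₛₗ[ρ] F') (s : Multiset L)
    (n : ExteriorAlgebra R F) : map f g (mk R s n) = mk R' (s.map f) (extMap g n) :=
  mapAdd_mk f g s n

lemma map_mulL (f : L →ₛₗ[ρ] L') (g : F →ₛₗ[ρ] F') (l : L) (x : KoszulModule R L F) :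
    map f g (mulL l x) = mulL (f l) (map f g x) := by
  induction x using induction_mk with
  | h0 => simp
  | hadd x y hx hy => simp only [map_add, hx, hy]
  | hmk s n => simp

lemma map_wedge (f : L →ₛₗ[ρ] L') (g : F →ₛₗ[ρ] F') (e : F) (x : KoszulModule R L F) :
    map f g (mapN (wedgeEnd (R := R) e) x) = mapN (wedgeEnd (R := R') (g e)) (map f g x) := by
  induction x using induction_mk with
  | h0 => simp
  | hadd x y hx hy => simp only [map_add, hx, hy]
  | hmk s n => simp

lemma map_d (f : L →ₛₗ[ρ] L') (g : F →ₛₗ[ρ] F') (u : L →ₗ[R] F) (u' : L' →ₗ[R'] F')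
    (h : ∀ l, u' (f l) = g (u l)) (x : KoszulModule R L F) :
    map f g (d u x) = d u' (map f g x) := by
  induction x using induction_mulL with
  | hadd x y hx hy => simp only [map_add, hx, hy]
  | hmk n => simp
  | hmul l x hx => simp only [d_mulL, map_mulL, map_add, map_wedge, hx, h]

lemma map_mem (f : L →ₛₗ[ρ] L') (g : F →ₛₗ[ρ] F') {j k : ℤ} {x : KoszulModule R L F}
    (hx : x ∈ gr R L F j k) : map f g x ∈ gr R' L' F' j k := by
  induction hx using Submodule.span_induction with
  | mem x hx =>
    obtain ⟨s, n, v, h1, h2, rfl⟩ := hx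
    rw [map_mk, extMap_ιMulti]
    exact Submodule.subset_span ⟨_, _, _, by simpa using h1, h2, rfl⟩
  | zero => rw [map_zero]; exact zero_mem _
  | add x y _ _ hx hy => rw [map_add]; exact add_mem hx hy
  | smul r x _ hx => rw [map_smulₛₗ]; exact Submodule.smul_mem _ _ hx

lemma map_map {R'' : Type*} [CommRing R''] {ρ' : R' →+* R''} {ρ'' : R →+* R''}
    {L'' : Type*} [AddCommGroup L''] [Module R'' L''] {F'' : Type*} [AddCommGroup F'']
    [Module R'' F''] (f : L →ₛₗ[ρ] L') (g : F →ₛₗ[ρ] F') (f' : L' →ₛₗ[ρ'] L'')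
    (g' : F' →ₛₗ[ρ'] F'') (f'' : L →ₛₗ[ρ''] L'') (g'' : F →ₛₗ[ρ''] F'')
    (hρ : ∀ r, ρ' (ρ r) = ρ'' r) (hf : ∀ l, f' (f l) = f'' l) (hg : ∀ x, g' (g x) = g'' x)
    (x : KoszulModule R L F) : map f' g' (map f g x) = map f'' g'' x := by
  induction x using induction_mk with
  | h0 => simp
  | hadd x y hx hy => simp only [map_add, hx, hy]
  | hmk s n =>
    simp only [map_mk, Multiset.map_map, Function.comp_def, hf]
    congr 1
    exact ringHom_ext_exteriorAlgebra (φ := (extMap g').comp (extMap g)) (ψ := extMap g'')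
      (by simp [hρ]) (by simp [hg]) n

lemma map_id {ρ : R →+* R} (f : L →ₛₗ[ρ] L) (g : F →ₛₗ[ρ] F)
    (hρ : ∀ r, ρ r = r) (hf : ∀ l, f l = l) (hg : ∀ x, g x = x)
    (x : KoszulModule R L F) : map f g x = x := by
  induction x using induction_mk with
  | h0 => simp
  | hadd x y hx hy => simp only [map_add, hx, hy]
  | hmk s n =>
    simp only [map_mk, hf, Multiset.map_id']
    congr 1
    exact ringHom_ext_exteriorAlgebra (φ := extMap g) (ψ := RingHom.id _)
      (by simp [hρ]) (by simp [hg]) n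

end KoszulModule

end Semilinear

/-! ### The Koszul complex of a presentation -/

section Free

variable {R : Type*} [CommRing R] {R' : Type*} [CommRing R'] (ρ : R →+* R')

/-- The semilinear map between free modules induced by a map of bases. -/
noncomputable def freeMap {X X' : Type*} (t : X → X') : (X →₀ R) →ₛₗ[ρ] (X' →₀ R') where
  toFun x := Finsupp.mapDomain t (Finsupp.mapRange ρ (map_zero ρ) x)
  map_add' x y := by
    rw [Finsupp.mapRange_add (map_add ρ), Finsupp.mapDomain_add]
  map_smul' r x := by
    rw [← Finsupp.mapDomain_smul]
    congr 1
    ext a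
    simp

@[simp] lemma freeMap_single {X X' : Type*} (t : X → X') (a : X) (r : R) :
    freeMap ρ t (Finsupp.single a r) = Finsupp.single (t a) (ρ r) := by
  simp [freeMap]

lemma freeMap_freeMap {R'' : Type*} [CommRing R''] {ρ' : R' →+* R''} {ρ'' : R →+* R''}
    {X X' X'' : Type*} (t : X → X') (t' : X' → X'') (t'' : X → X'')
    (hρ : ∀ r, ρ' (ρ r) = ρ'' r) (ht : ∀ a, t' (t a) = t'' a) (x : X →₀ R) :
    freeMap ρ' t' (freeMap ρ t x) = freeMap ρ'' t'' x := by
  induction x using Finsupp.induction_linear with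
  | zero => simp
  | add x y hx hy => simp only [map_add, hx, hy]
  | single a r => simp [hρ, ht]

lemma freeMap_id {ρ : R →+* R} {X : Type*} (t : X → X)
    (hρ : ∀ r, ρ r = r) (ht : ∀ a, t a = a) (x : X →₀ R) : freeMap ρ t x = x := by
  induction x using Finsupp.induction_linear with
  | zero => simp
  | add x y hx hy => simp only [map_add, hx, hy]
  | single a r => simp [hρ, ht]

variable {H : Type*} [AddCommGroup H] [Module R H] {H' : Type*} [AddCommGroup H'] [Module R' H']
  {ρ}

variable (R) in
/-- The module of relations between the elements `h a` of `H`. -/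
def Rel {X : Type*} (h : X → H) : Type _ := LinearMap.ker (Finsupp.linearCombination R h)

namespace Rel

variable {X : Type*} (h : X → H)

noncomputable instance : AddCommGroup (Rel R h) :=
  inferInstanceAs (AddCommGroup (LinearMap.ker (Finsupp.linearCombination R h)))

noncomputable instance : Module R (Rel R h) :=
  inferInstanceAs (Module R (LinearMap.ker (Finsupp.linearCombination R h)))

variable (R) in
/-- The inclusion of the module of relations into the free module. -/
noncomputable def incl : Rel R h →ₗ[R] (X →₀ R) :=
  (LinearMap.ker (Finsupp.linearCombination R h)).subtype

lemma incl_injective : Function.Injective (incl R h) := Subtype.val_injective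

lemma linearCombination_incl (x : Rel R h) : Finsupp.linearCombination R h (incl R h x) = 0 := x.2

variable {h} in
/-- Constructor for relations. -/
def mk (x : X →₀ R) (hx : Finsupp.linearCombination R h x = 0) : Rel R h := ⟨x, hx⟩

@[simp] lemma incl_mk (x : X →₀ R) (hx : Finsupp.linearCombination R h x = 0) :
    incl R h (mk x hx) = x := rfl

end Rel

lemma linearCombination_freeMap {X X' : Type*} {h : X → H} {h' : X' → H'} (τ : H →ₛₗ[ρ] H')
    (t : X → X') (ht : ∀ a, h' (t a) = τ (h a)) (x : X →₀ R) :
    Finsupp.linearCombination R' h' (freeMap ρ t x) =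
      τ (Finsupp.linearCombination R h x) := by
  induction x using Finsupp.induction_linear with
  | zero => simp
  | add x y hx hy => simp only [map_add, hx, hy]
  | single a r => simp [ht]

/-- The map induced on modules of relations by a map of bases. -/
noncomputable def relMap {X X' : Type*} {h : X → H} {h' : X' → H'} (τ : H →ₛₗ[ρ] H')
    (t : X → X') (ht : ∀ a, h' (t a) = τ (h a)) : Rel R h →ₛₗ[ρ] Rel R' h' where
  toFun x := Rel.mk (freeMap ρ t (Rel.incl R h x)) (by
    rw [linearCombination_freeMap τ t ht, Rel.linearCombination_incl, map_zero])
  map_add' x y := Rel.incl_injective _ (by simp)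
  map_smul' r x := Rel.incl_injective _ (by simp)

@[simp] lemma incl_relMap {X X' : Type*} {h : X → H} {h' : X' → H'} (τ : H →ₛₗ[ρ] H')
    (t : X → X') (ht : ∀ a, h' (t a) = τ (h a)) (x : Rel R h) :
    Rel.incl R' h' (relMap τ t ht x) = freeMap ρ t (Rel.incl R h x) := rfl

open KoszulModule

variable (R) in
/-- The Koszul complex of the inclusion of the module of relations between the `h a` into the free
module on the `a`. -/
abbrev RelKoszul {X : Type*} (h : X → H) : Type _ := KoszulModule R (Rel R h) (X →₀ R)

variable (R) in
/-- The differential of `RelKoszul R h`. -/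
noncomputable def relD {X : Type*} (h : X → H) : RelKoszul R h →ₗ[R] RelKoszul R h :=
  d (L := Rel R h) (Rel.incl R h)

/-- The functoriality of `RelKoszul`. -/
noncomputable def relKoszulMap {X X' : Type*} {h : X → H} {h' : X' → H'} (τ : H →ₛₗ[ρ] H')
    (t : X → X') (ht : ∀ a, h' (t a) = τ (h a)) : RelKoszul R h →ₛₗ[ρ] RelKoszul R' h' :=
  KoszulModule.map (L := Rel R h) (L' := Rel R' h') (relMap τ t ht) (freeMap ρ t)

lemma relKoszulMap_relD {X X' : Type*} {h : X → H} {h' : X' → H'} (τ : H →ₛₗ[ρ] H')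
    (t : X → X') (ht : ∀ a, h' (t a) = τ (h a)) (x : RelKoszul R h) :
    relKoszulMap τ t ht (relD R h x) = relD R' h' (relKoszulMap τ t ht x) :=
  map_d (relMap τ t ht) (freeMap ρ t) (Rel.incl R h) (Rel.incl R' h')
    (fun l => incl_relMap τ t ht l) x

/-- The local exactness criterion for the Koszul complex of the module of relations between the
elements `h a` of `H`: a cocycle `∑ l y_l` of positive symmetric degree becomes a coboundary after
a change of rings such that the relations `l` become consequences of expressions
`τ (h a) = ∑ G a k • h' (y k)` for `a` in a set `D` containing the supports of the `l`. -/
theorem exists_d_eq_map {X X' : Type*} {h : X → H} {h' : X' → H'} (τ : H →ₛₗ[ρ] H')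
    (t : X → X') (ht : ∀ a, h' (t a) = τ (h a))
    (q : ℕ → R') (hq0 : q 0 = 1) (n : ℕ) {k : ℤ}
    (hq : ∀ a ≤ n, (a + 1 : ℕ) * q (a + 1) = q a)
    (hq' : k = 0 ∨ ∀ a ≤ n + 1, (a + 1 : ℕ) * q (a + 1) = q a)
    (y : Rel R h →₀ RelKoszul R h) (hy : ∀ l, y l ∈ gr R (Rel R h) (X →₀ R) n k)
    (hd : relD R h (y.sum fun l z => SymTensor.mulL l z) = 0)
    (D : Finset X) {κ : Type*} [Fintype κ] (e : κ → X') (G : X → κ → R')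
    (hG : ∀ a ∈ D, τ (h a) = ∑ i, G a i • h' (e i))
    (hD : ∀ l ∈ y.support, (Rel.incl R h l).support ⊆ D)
    (hl : ∀ l ∈ y.support, ∀ i, ∑ a ∈ D, ρ (Rel.incl R h l a) * G a i = 0) :
    ∃ w ∈ gr R' (Rel R' h') (X' →₀ R') (n + 2) (k - 1), relD R' h' w =
      relKoszulMap τ t ht (y.sum fun l z => SymTensor.mulL l z) := by
  classical
  -- the restriction of scalars factors through the free module on `X ⊕ κ`
  let h0 : X ⊕ κ → H' := Sum.elim (fun a => τ (h a)) (fun i => h' (e i))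
  have ht1 : ∀ a, h0 (Sum.inl a) = τ (h a) := fun _ => rfl
  let f1 : Rel R h →ₛₗ[ρ] Rel R' h0 := relMap τ Sum.inl ht1
  have ht2 : ∀ a, h' (Sum.elim t e a) = LinearMap.id (R := R') (h0 a) := by
    rintro (a | i)
    · exact ht a
    · rfl
  let bb : X → (X ⊕ κ →₀ R') := fun a =>
    Finsupp.single (Sum.inl a) 1 - ∑ i, Finsupp.single (Sum.inr i) (G a i)
  have hbb : ∀ a ∈ D, Finsupp.linearCombination R' h0 (bb a) = 0 := fun a ha => by
    rw [map_sub, map_sum]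
    simp [Finsupp.linearCombination_single, h0, hG a ha]
  let b : X → Rel R' h0 := fun a => if ha : a ∈ D then Rel.mk (bb a) (hbb a ha) else 0
  have hb : ∀ a ∈ D, Rel.incl R' h0 (b a) = bb a := fun a ha => by simp [b, ha]
  let c : X → ((X ⊕ κ →₀ R') →ₗ[R'] R') := fun a => Finsupp.lapply (Sum.inl a)
  have hcb : ∀ a a', a' ∈ D → a ≠ a' → c a (Rel.incl R' h0 (b a')) = 0 := fun a a' ha' hne => by
    rw [hb a' ha']
    simp [c, bb, hne.symm]
  have hfold : ∀ (D' : List X), D'.Nodup → (∀ a ∈ D', a ∈ D) → ∀ x : Rel R' h0,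
      (D'.map fun a => (c a, b a)).foldl (fun x p => x - p.1 ((Rel.incl R' h0) x) • p.2) x =
        x - (D'.map fun a => c a (Rel.incl R' h0 x) • b a).sum := by
    intro D' hnd hsub
    induction D' with
    | nil => simp
    | cons a D' ih =>
      intro x
      rw [List.map_cons, List.foldl_cons, ih (List.nodup_cons.1 hnd).2
        (fun a' ha' => hsub a' (List.mem_cons_of_mem _ ha')), List.map_cons, List.sum_cons,
        ← sub_sub]
      congr 2
      refine List.map_congr_left fun a' ha' => ?_
      have hne : a' ≠ a := fun h => (List.nodup_cons.1 hnd).1 (h ▸ ha')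
      have h0 := hcb a' a (hsub a List.mem_cons_self) hne
      simp [h0]
  have hcomp : ∀ z, relKoszulMap LinearMap.id (Sum.elim t e) ht2
      (relKoszulMap τ Sum.inl ht1 z) = relKoszulMap τ t ht z := by
    intro z
    refine map_map (L := Rel R h) (L' := Rel R' h0) (L'' := Rel R' h') _ _ _ _ _ _ (fun _ => rfl) (fun l => ?_) (fun x => ?_) z
    · exact Rel.incl_injective _ (freeMap_freeMap _ _ _ _ (fun _ => rfl) (fun _ => rfl) _)
    · exact freeMap_freeMap _ _ _ _ (fun _ => rfl) (fun _ => rfl) _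
  have hsum : relKoszulMap τ Sum.inl ht1 (y.sum fun l z => SymTensor.mulL l z) =
      ∑ l ∈ y.support, SymTensor.mulL (f1 l) (relKoszulMap τ Sum.inl ht1 (y l)) := by
    rw [Finsupp.sum, map_sum]
    exact Finset.sum_congr rfl fun l _ => map_mulL (L := Rel R h) (L' := Rel R' h0) _ _ _ _
  have hkill : ∀ l ∈ y.support, (D.toList.map fun a => (c a, b a)).foldl
      (fun x p => x - p.1 ((Rel.incl R' h0) x) • p.2) (f1 l) = 0 := by
    intro l hl'
    rw [hfold _ D.nodup_toList (fun a ha => by simpa using ha), Finset.sum_map_toList, sub_eq_zero]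
    apply Rel.incl_injective
    have hval : Rel.incl R' h0 (∑ a ∈ D, c a (Rel.incl R' h0 (f1 l)) • b a) =
        ∑ a ∈ D, (ρ (Rel.incl R h l a)) • bb a := by
      rw [map_sum]
      refine Finset.sum_congr rfl fun a ha => ?_
      rw [map_smul, hb a ha]
      congr 1
      rw [incl_relMap]
      simp [c, freeMap, Finsupp.mapDomain_apply Sum.inl_injective]
    rw [hval]
    rw [incl_relMap]
    ext (a | i)
    · rw [Finsupp.finsetSum_apply]
      simp only [bb, freeMap, LinearMap.coe_mk, AddHom.coe_mk,
        Finsupp.mapDomain_apply Sum.inl_injective, Finsupp.mapRange_apply, Finsupp.smul_apply,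
        Finsupp.sub_apply, Finsupp.finsetSum_apply, Finsupp.single_apply, Sum.inl.injEq,
        reduceCtorEq, if_false, Finset.sum_const_zero, sub_zero, smul_eq_mul, mul_ite, mul_one,
        mul_zero, Finset.sum_ite_eq']
      split_ifs with ha
      · rfl
      · rw [Finsupp.notMem_support_iff.1 fun h => ha (hD l hl' h), map_zero]
    · rw [Finsupp.finsetSum_apply]
      simp only [bb, freeMap, LinearMap.coe_mk, AddHom.coe_mk,
        Finsupp.smul_apply,
        Finsupp.sub_apply, Finsupp.finsetSum_apply, Finsupp.single_apply, Sum.inr.injEq,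
        reduceCtorEq, if_false, zero_sub, smul_eq_mul, Finset.sum_ite_eq', Finset.mem_univ,
        if_true, mul_neg, Finset.sum_neg_distrib, hl l hl' i, neg_zero]
      exact Finsupp.mapDomain_of_notMem_range _ _ (by simp)
  obtain ⟨w, hw, hdw⟩ := exists_d_eq (L := Rel R' h0) (Rel.incl R' h0) q hq0 n hq hq'
    (D.toList.map fun a => (c a, b a)) y.support f1 hkill
    (fun l => relKoszulMap τ Sum.inl ht1 (y l))
    (fun l _ => map_mem (L := Rel R h) (L' := Rel R' h0) _ _ (hy l)) (by
      rw [← hsum]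
      change relD R' h0 _ = 0
      rw [← relKoszulMap_relD, hd, map_zero])
  refine ⟨relKoszulMap LinearMap.id (Sum.elim t e) ht2 w,
    map_mem (L := Rel R' h0) (L' := Rel R' h') _ _ hw, ?_⟩
  rw [← relKoszulMap_relD, relD, hdw, ← hsum, hcomp]

end Free

/-! ### Right exactness of the exterior algebra -/

section RightExact

variable {R : Type*} [CommRing R] {M : Type*} [AddCommGroup M] [Module R M]
  {N : Type*} [AddCommGroup N] [Module R N]

/-- The left ideal generated by the elements of the kernel of `f`. -/
noncomputable def kerIdeal (f : M →ₗ[R] N) : Ideal (ExteriorAlgebra R M) :=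
  Ideal.span (ExteriorAlgebra.ι R '' {m | f m = 0})

lemma ι_mem_kerIdeal (f : M →ₗ[R] N) {m : M} (hm : f m = 0) :
    ExteriorAlgebra.ι R m ∈ kerIdeal f := Ideal.subset_span ⟨m, hm, rfl⟩

instance (f : M →ₗ[R] N) : (kerIdeal f).IsTwoSided where
  mul_mem_of_left := by
    intro a b ha
    induction b using ExteriorAlgebra.induction generalizing a with
    | algebraMap r =>
      rw [← Algebra.commutes]
      exact Ideal.mul_mem_left _ _ ha
    | ι m =>
      induction ha using Submodule.span_induction with
      | mem x hx =>
        obtain ⟨k, hk, rfl⟩ := hx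
        rw [eq_neg_of_add_eq_zero_left (ExteriorAlgebra.ι_add_mul_swap k m)]
        exact neg_mem (Ideal.mul_mem_left _ _ (ι_mem_kerIdeal f hk))
      | zero => rw [zero_mul]; exact zero_mem _
      | add x y _ _ hx hy => rw [add_mul]; exact add_mem hx hy
      | smul c x _ hx => rw [smul_eq_mul, mul_assoc]; exact Ideal.mul_mem_left _ _ hx
    | mul b c hb hc => rw [← mul_assoc]; exact hc (hb ha)
    | add b c hb hc => rw [mul_add]; exact add_mem (hb ha) (hc ha)

/-- The kernel of the map of exterior algebras induced by a surjective map is generated by the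
kernel of this map. -/
theorem mem_kerIdeal_of_map_eq_zero (f : M →ₗ[R] N) (hf : Function.Surjective f)
    (x : ExteriorAlgebra R M) (hx : ExteriorAlgebra.map f x = 0) : x ∈ kerIdeal f := by
  have hker : ∀ {a b : M}, f a = f b → Ideal.Quotient.mk (kerIdeal f) (ExteriorAlgebra.ι R a) =
      Ideal.Quotient.mk (kerIdeal f) (ExteriorAlgebra.ι R b) := fun {a b} h => by
    rw [Ideal.Quotient.eq, ← map_sub]
    exact ι_mem_kerIdeal f (by rw [map_sub, h, sub_self])
  let σ := Function.surjInv hf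
  have hσ := Function.surjInv_eq hf
  let g : N →ₗ[R] ExteriorAlgebra R M ⧸ kerIdeal f :=
    { toFun := fun n => Ideal.Quotient.mk (kerIdeal f) (ExteriorAlgebra.ι R (σ n))
      map_add' := fun a b => by
        rw [← map_add, ← map_add]
        exact hker (by simp [σ, hσ])
      map_smul' := fun r a => by
        change _ = Ideal.Quotient.mk (kerIdeal f) (r • ExteriorAlgebra.ι R (σ a))
        rw [← map_smul]
        exact hker (by simp [σ, hσ]) }
  let G : ExteriorAlgebra R N →ₐ[R] ExteriorAlgebra R M ⧸ kerIdeal f :=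
    ExteriorAlgebra.lift R ⟨g, fun n => by
      change Ideal.Quotient.mk (kerIdeal f) _ * Ideal.Quotient.mk (kerIdeal f) _ = 0
      rw [← map_mul, ExteriorAlgebra.ι_sq_zero, map_zero]⟩
  have hG : G.comp (ExteriorAlgebra.map f) = Ideal.Quotient.mkₐ R (kerIdeal f) := by
    apply ExteriorAlgebra.hom_ext
    ext m
    simp only [AlgHom.comp_toLinearMap, LinearMap.comp_apply, AlgHom.toLinearMap_apply,
      ExteriorAlgebra.map_apply_ι, G, ExteriorAlgebra.lift_ι_apply]
    exact hker (by rw [hσ])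
  have := congrArg (fun φ => φ x) hG
  simp only [AlgHom.comp_apply, hx, map_zero] at this
  exact Ideal.Quotient.eq_zero_iff_mem.1 this.symm

open SymTensor KoszulModule

variable {L : Type*} [AddCommGroup L] [Module R L]

/-- The elements of `Λ^q(M)` which are Koszul coboundaries. -/
noncomputable def koszulBoundaries (v : L →ₗ[R] M) (q : ℤ) : Submodule R (ExteriorAlgebra R M) :=
  ((gr R L M 1 (q - 1)).map (d v)).comap (mk R 0)

lemma d_mk_singleton (v : L →ₗ[R] M) (l : L) (x : ExteriorAlgebra R M) :
    d v (mk R {l} x) = mk R 0 (ExteriorAlgebra.ι R (v l) * x) := by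
  rw [← Multiset.cons_zero, ← mulL_mk, d_mulL, d_mk_zero, map_zero, zero_add, mapN_mk,
    wedgeEnd_apply]

lemma ι_mul_mem_koszulBoundaries (v : L →ₗ[R] M) (l : L) {n : ℕ} (a : Fin n → M) {q : ℤ}
    (hq : (n : ℤ) + 1 = q) :
    ExteriorAlgebra.ι R (v l) * ExteriorAlgebra.ιMulti R n a ∈ koszulBoundaries v q :=
  ⟨mk R {l} (ExteriorAlgebra.ιMulti R n a), Submodule.subset_span ⟨_, n, a, by simp, by lia, rfl⟩,
    d_mk_singleton _ _ _⟩

lemma ι_mul_mem_koszulBoundaries' (v : L →ₗ[R] M) (m : M) {q : ℤ} {x : ExteriorAlgebra R M}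
    (hx : x ∈ koszulBoundaries v q) : ExteriorAlgebra.ι R m * x ∈ koszulBoundaries v (q + 1) := by
  obtain ⟨w, hw, hdw⟩ := hx
  refine ⟨-mapN (wedgeEnd (R := R) m) w, neg_mem ?_, ?_⟩
  · convert wedge_mem m hw using 1
    ring_nf
  · rw [map_neg, d_wedge, neg_neg, hdw, mapN_mk, wedgeEnd_apply]

/-- A homogeneous element in the kernel of the map of exterior algebras induced by a surjection
is a sum of products `ι k * y` with `k` in the kernel and `y` homogeneous. -/
theorem exists_of_map_eq_zero (f : M →ₗ[R] N) (hf : Function.Surjective f) {q : ℕ}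
    (x : ExteriorAlgebra R M) (hq : x ∈ ⋀[R]^q M) (hx : ExteriorAlgebra.map f x = 0) :
    x ∈ Submodule.span R {y | ∃ (m : M) (n : ℕ) (a : Fin n → M), f m = 0 ∧ n + 1 = q ∧
      y = ExteriorAlgebra.ι R m * ExteriorAlgebra.ιMulti R n a} := by
  let S : ℕ → Submodule R (ExteriorAlgebra R M) := fun q =>
    Submodule.span R {y | ∃ (m : M) (n : ℕ) (a : Fin n → M), f m = 0 ∧ n + 1 = q ∧
      y = ExteriorAlgebra.ι R m * ExteriorAlgebra.ιMulti R n a}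
  have hι : ∀ m : M, ExteriorAlgebra.ι R m ∈ ⋀[R]^1 M := fun m => by
    change _ ∈ LinearMap.range (ExteriorAlgebra.ι R (M := M)) ^ 1
    rw [pow_one]
    exact ⟨m, rfl⟩
  suffices h : ∀ n, (DirectSum.decompose (fun i : ℕ => ⋀[R]^i M) x n : ExteriorAlgebra R M) ∈
      S n by
    have := h q
    rwa [DirectSum.decompose_of_mem_same (fun i : ℕ => ⋀[R]^i M) hq] at this
  have hmem := mem_kerIdeal_of_map_eq_zero f hf x hx
  clear hx hq
  induction hmem using Submodule.span_induction with
  | mem x hx =>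
    obtain ⟨k, hk, rfl⟩ := hx
    intro n
    by_cases hn : n = 1
    · subst hn
      rw [DirectSum.decompose_of_mem_same (fun i : ℕ => ⋀[R]^i M) (hι k)]
      exact Submodule.subset_span ⟨k, 0, ![], hk, rfl, by simp⟩
    · rw [DirectSum.decompose_of_mem_ne (fun i : ℕ => ⋀[R]^i M) (hι k) (Ne.symm hn)]
      exact zero_mem _
  | zero => intro n; rw [DirectSum.decompose_zero]; exact zero_mem _
  | add x y _ _ hx hy => intro n; rw [DirectSum.decompose_add]; exact add_mem (hx n) (hy n)
  | smul c x hxm hx =>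
    rw [smul_eq_mul]
    clear hxm
    induction c using ExteriorAlgebra.induction generalizing x with
    | algebraMap r =>
      intro n
      rw [← Algebra.smul_def, DirectSum.decompose_smul]
      exact Submodule.smul_mem _ _ (hx n)
    | ι m =>
      intro n
      rcases n with _ | n
      · rw [DirectSum.coe_decompose_mul_of_left_mem_of_not_le (fun i : ℕ => ⋀[R]^i M) (hι m) (by simp)]
        exact zero_mem _
      · rw [add_comm, DirectSum.coe_decompose_mul_add_of_left_mem (fun i : ℕ => ⋀[R]^i M) (hι m)]
        have h := Submodule.mem_map_of_mem (f := wedgeEnd (R := R) m) (hx n)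
        rw [Submodule.map_span] at h
        refine Submodule.span_le.2 ?_ h
        rintro _ ⟨_, ⟨k, n', a, hk, hn, rfl⟩, rfl⟩
        rw [wedgeEnd_apply, ← mul_assoc,
          eq_neg_of_add_eq_zero_left (ExteriorAlgebra.ι_add_mul_swap m k), neg_mul, mul_assoc,
          ι_mul_ιMulti]
        exact neg_mem (Submodule.subset_span ⟨k, n' + 1, _, hk, by lia, rfl⟩)
    | mul b c hb hc => rw [mul_assoc]; exact hb _ (hc _ hx)
    | add b c hb hc =>
      intro n
      rw [add_mul, DirectSum.decompose_add]
      exact add_mem (hb _ hx n) (hc _ hx n)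

end RightExact

/-! ### Exactness of the Koszul complex in symmetric degree zero -/

section Local

variable {R : Type*} [CommRing R]
  {H : Type*} [AddCommGroup H] [Module R H]

open SymTensor KoszulModule

/-- The semilinear map out of a free module given by the images of the basis elements. -/
noncomputable def semilinearLift {R' : Type*} [CommRing R'] (ρ : R →+* R') {X : Type*}
    {F' : Type*} [AddCommGroup F'] [Module R' F'] (e : X → F') : (X →₀ R) →ₛₗ[ρ] F' where
  toFun x := Finsupp.linearCombination R' e (Finsupp.mapRange ρ (map_zero ρ) x)
  map_add' x y := by rw [Finsupp.mapRange_add (map_add ρ), map_add]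
  map_smul' r x := by
    rw [← map_smul]
    congr 1
    ext a
    simp

@[simp] lemma semilinearLift_single {R' : Type*} [CommRing R'] (ρ : R →+* R') {X : Type*}
    {F' : Type*} [AddCommGroup F'] [Module R' F'] (e : X → F') (a : X) (r : R) :
    semilinearLift ρ e (Finsupp.single a r) = ρ r • e a := by
  simp [semilinearLift]

lemma semilinearLift_apply {R' : Type*} [CommRing R'] (ρ : R →+* R') {X : Type*}
    {F' : Type*} [AddCommGroup F'] [Module R' F'] (e : X → F') (x : X →₀ R) :
    semilinearLift ρ e x = ∑ a ∈ x.support, ρ (x a) • e a := by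
  conv_lhs => rw [← x.sum_single]
  rw [Finsupp.sum, map_sum]
  simp

lemma linearCombination_semilinearLift {R' : Type*} [CommRing R'] {ρ : R →+* R'} {H' : Type*}
    [AddCommGroup H'] [Module R' H'] {X' : Type*} (h' : X' → H') (τ : H →ₛₗ[ρ] H') (e : H → X')
    (x : H →₀ R) (hx : ∀ y ∈ x.support, h' (e y) = τ y) :
    Finsupp.linearCombination R' h' (semilinearLift ρ (fun y => Finsupp.single (e y) 1) x) =
      τ (Finsupp.linearCombination R id x) := by
  rw [semilinearLift_apply, map_sum, Finsupp.linearCombination_apply R x, Finsupp.sum, map_sum]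
  refine Finset.sum_congr rfl fun y hy => ?_
  simp [hx y hy]

lemma sub_mem_koszulBoundaries {R' : Type*} [CommRing R'] {ρ : R →+* R'}
    {F : Type*} [AddCommGroup F] [Module R F] {F' : Type*} [AddCommGroup F'] [Module R' F']
    {L' : Type*} [AddCommGroup L'] [Module R' L'] (v : L' →ₗ[R'] F') (α β : F →ₛₗ[ρ] F')
    {n : ℕ} (a : Fin n → F) (h : ∀ i, ∃ l, v l = α (a i) - β (a i)) :
    extMap α (ExteriorAlgebra.ιMulti R n a) - extMap β (ExteriorAlgebra.ιMulti R n a) ∈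
      koszulBoundaries v n := by
  induction n with
  | zero => simp
  | succ n ih =>
    obtain ⟨l, hl⟩ := h 0
    rw [ExteriorAlgebra.ιMulti_succ_apply, map_mul, map_mul, extMap_ι, extMap_ι]
    have h2 := ι_mul_mem_koszulBoundaries' v (β (a 0)) (ih (fun i => a i.succ) fun i => h i.succ)
    have h1 := ι_mul_mem_koszulBoundaries v l (fun i : Fin n => α (a i.succ)) (q := n + 1) rfl
    rw [← extMap_ιMulti, hl] at h1
    push_cast
    convert add_mem h1 h2 using 1
    rw [map_sub, sub_mul, mul_sub, sub_add_sub_cancel]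
    rfl

/-- The local exactness criterion for `RelKoszul R h` in symmetric degree `0`: if an element `x` of
the exterior power of the free module dies in the exterior power of `H`, then it becomes a
coboundary after any change of rings such that suitable elements of `H` are combinations of the
`h' a`. -/
theorem exists_finset_koszulBoundaries {X : Type*} (h : X → H) {q : ℕ}
    (x : ExteriorAlgebra R (X →₀ R)) (hq : x ∈ ⋀[R]^q (X →₀ R))
    (hx : ExteriorAlgebra.map (Finsupp.linearCombination R h) x = 0) :
    ∃ D : Finset H, ∀ {R' : Type*} [CommRing R'] {ρ : R →+* R'} {H' : Type*} [AddCommGroup H']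
      [Module R' H'] {X' : Type*} (h' : X' → H') (τ : H →ₛₗ[ρ] H') (t : X → X')
      (_ : ∀ a, h' (t a) = τ (h a)) (e : H → X') (_ : ∀ y ∈ D, h' (e y) = τ y),
      extMap (freeMap ρ t) x ∈ koszulBoundaries (Rel.incl R' h') q := by
  classical
  -- the map from the free module on `X` to `H` is compared with the surjection from the free
  -- module on `H`, to which the right exactness of the exterior algebra applies
  let f : (H →₀ R) →ₗ[R] H := Finsupp.linearCombination R id
  let s : (X →₀ R) →ₗ[R] (H →₀ R) := Finsupp.lmapDomain R R h
  have hf : Function.Surjective f := fun y => ⟨Finsupp.single y 1, by simp [f]⟩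
  have hfs : f.comp s = Finsupp.linearCombination R h := by
    ext a; simp [f, s]
  have hspan : x ∈ Submodule.span R (Set.range (ExteriorAlgebra.ιMulti R q)) := by
    rwa [ExteriorAlgebra.ιMulti_span_fixedDegree]
  have hsx : ExteriorAlgebra.map s x ∈ ⋀[R]^q (H →₀ R) := by
    rw [← ExteriorAlgebra.ιMulti_span_fixedDegree]
    have h := Submodule.mem_map_of_mem (f := (ExteriorAlgebra.map s).toLinearMap) hspan
    rw [Submodule.map_span] at h
    refine Submodule.span_mono ?_ h
    rintro _ ⟨_, ⟨a, rfl⟩, rfl⟩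
    exact ⟨_, (ExteriorAlgebra.map_apply_ιMulti s a).symm⟩
  have key := exists_of_map_eq_zero f hf (ExteriorAlgebra.map s x) hsx (by
    rw [← AlgHom.comp_apply, ExteriorAlgebra.map_comp_map, hfs, hx])
  obtain ⟨T1, hT1, hxT1⟩ := Submodule.mem_span_finite_of_mem_span key
  obtain ⟨T2, hT2, hxT2⟩ := Submodule.mem_span_finite_of_mem_span hspan
  have hT1' : ∀ y : T1, ∃ (m : H →₀ R) (n : ℕ) (a : Fin n → H →₀ R), f m = 0 ∧ n + 1 = q ∧
      y = ExteriorAlgebra.ι R m * ExteriorAlgebra.ιMulti R n a := fun y => hT1 y.2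
  have hT2' : ∀ y : T2, ∃ a : Fin q → X →₀ R,
      ExteriorAlgebra.ιMulti R q a = (y : ExteriorAlgebra R (X →₀ R)) := fun y => hT2 y.2
  choose m n a hm hn hy using hT1'
  choose b hb using hT2'
  refine ⟨Finset.univ.biUnion (fun y => (m y).support) ∪
    Finset.univ.biUnion (fun y => Finset.univ.biUnion fun i => (s (b y i)).support), ?_⟩
  intro R' _ ρ H' _ _ X' h' τ t ht e he
  let σ : (H →₀ R) →ₛₗ[ρ] (X' →₀ R') := semilinearLift ρ (fun y => Finsupp.single (e y) 1)
  have e1 : ∀ x ∈ Submodule.span R (T1 : Set (ExteriorAlgebra R (H →₀ R))),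
      extMap σ x ∈ koszulBoundaries (Rel.incl R' h') q := by
    intro x hx
    induction hx using Submodule.span_induction with
    | mem y hy' =>
      have h1 := hy ⟨y, hy'⟩
      dsimp only at h1
      rw [h1, map_mul, extMap_ι, extMap_ιMulti]
      refine ι_mul_mem_koszulBoundaries (Rel.incl R' h')
        (Rel.mk (σ (m ⟨y, hy'⟩)) ?_) _ (by exact_mod_cast hn ⟨y, hy'⟩)
      rw [linearCombination_semilinearLift h' τ e _ (fun z hz => he z ?_)]
      · exact (congrArg τ (hm ⟨y, hy'⟩)).trans (map_zero τ)
      · exact Finset.mem_union_left _ (Finset.mem_biUnion.2 ⟨⟨y, hy'⟩, Finset.mem_univ _, hz⟩)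
    | zero => rw [map_zero]; exact zero_mem _
    | add x y _ _ hx hy => rw [map_add]; exact add_mem hx hy
    | smul r x _ hx => rw [extMap_smul]; exact Submodule.smul_mem _ _ hx
  have e2 : ∀ x ∈ Submodule.span R (T2 : Set (ExteriorAlgebra R (X →₀ R))),
      extMap (freeMap ρ t) x - extMap σ (ExteriorAlgebra.map s x) ∈
        koszulBoundaries (Rel.incl R' h') q := by
    intro x hx
    induction hx using Submodule.span_induction with
    | mem y hy' =>
      rw [← show _ = y from hb ⟨y, hy'⟩, ExteriorAlgebra.map_apply_ιMulti]
      have h1 := sub_mem_koszulBoundaries (Rel.incl R' h') (freeMap ρ t) (σ.comp s)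
        (b ⟨y, hy'⟩) (fun i => ⟨Rel.mk (freeMap ρ t (b ⟨y, hy'⟩ i) - σ (s (b ⟨y, hy'⟩ i))) ?_, rfl⟩)
      · convert h1 using 2
        rw [extMap_ιMulti, extMap_ιMulti]
        rfl
      · rw [map_sub, linearCombination_freeMap τ t ht,
          linearCombination_semilinearLift h' τ e _ (fun z hz => he z ?_), sub_eq_zero]
        · exact congrArg τ (congrArg (fun φ => φ (b ⟨y, hy'⟩ i)) hfs).symm
        · exact Finset.mem_union_right _ (Finset.mem_biUnion.2 ⟨⟨y, hy'⟩, Finset.mem_univ _,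
            Finset.mem_biUnion.2 ⟨i, Finset.mem_univ _, hz⟩⟩)
    | zero => simp
    | add x y _ _ hx hy =>
      rw [map_add, map_add, map_add, add_sub_add_comm]; exact add_mem hx hy
    | smul r x _ hx =>
      rw [map_smul (ExteriorAlgebra.map s), extMap_smul, extMap_smul, ← smul_sub]
      exact Submodule.smul_mem _ _ hx
  have := add_mem (e2 x hxT2) (e1 _ hxT1)
  rwa [sub_add_cancel] at this

end Local

/-! ### A criterion for decomposability -/

section Decomposable

open Limits HomologicalComplex

attribute [local instance] Abelian.hasFiniteBiproducts

variable {B : Type*} [Category* B] [Abelian B]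

lemma isIso_of_isZero_of_isZero {X Y : B} (f : X ⟶ Y) (hX : IsZero X) (hY : IsZero Y) :
    IsIso f :=
  ⟨0, hX.eq_of_src _ _, hY.eq_of_src _ _⟩

/-- Complexes `X i` with cohomology in the single degree `i` that map to `M` isomorphically on
the cohomology of degree `i` add up to a quasi-isomorphism. -/
lemma quasiIso_biproduct_desc {M : CochainComplex B ℤ} (I : Finset ℤ)
    (hI : ∀ p ∉ I, IsZero (M.homology p)) (X : I → CochainComplex B ℤ) (φ : ∀ i, X i ⟶ M)
    (hX : ∀ (i : I) (p : ℤ), p ≠ i → IsZero ((X i).homology p))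
    (hφ : ∀ i : I, IsIso (homologyMap (φ i) (i : ℤ))) :
    QuasiIso (biproduct.desc φ) := by
  refine (quasiIso_iff _).mpr fun p => ?_
  rw [quasiIsoAt_iff_isIso_homologyMap]
  have key : 𝟙 ((⨁ X).homology p) =
      ∑ j, homologyMap (biproduct.π X j) p ≫ homologyMap (biproduct.ι X j) p := by
    have h := congrArg (fun f => (homologyFunctor B (ComplexShape.up ℤ) p).map f)
      (biproduct.total (f := X))
    simp only [Functor.map_sum, Functor.map_comp] at h
    exact ((homologyFunctor B (ComplexShape.up ℤ) p).map_id _).symm.trans h.symm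
  by_cases hp : p ∈ I
  · have hi : IsIso (homologyMap (biproduct.ι X ⟨p, hp⟩) p) := by
      refine ⟨homologyMap (biproduct.π X ⟨p, hp⟩) p, ?_, ?_⟩
      · rw [← homologyMap_comp, biproduct.ι_π_self, homologyMap_id]
      · rw [key, Finset.sum_eq_single ⟨p, hp⟩]
        · intro j _ hj
          rw [(hX j p fun h => hj (Subtype.ext h.symm)).eq_of_tgt
            (homologyMap (biproduct.π X j) p) 0, zero_comp]
        · simp
    have h2 : homologyMap (biproduct.ι X ⟨p, hp⟩) p ≫ homologyMap (biproduct.desc φ) p =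
        homologyMap (φ ⟨p, hp⟩) p := by
      rw [← homologyMap_comp, biproduct.ι_desc]
    have := hφ ⟨p, hp⟩
    exact (isIso_comp_left_iff (homologyMap (biproduct.ι X ⟨p, hp⟩) p) _).mp (h2 ▸ this)
  · refine isIso_of_isZero_of_isZero _ ?_ (hI p hp)
    rw [IsZero.iff_id_eq_zero, key]
    refine Finset.sum_eq_zero fun j _ => ?_
    rw [(hX j p fun h => hp (h ▸ j.2)).eq_of_tgt (homologyMap (biproduct.π X j) p) 0, zero_comp]

/-- A complex `Y` that vanishes above degree `i` maps to the complex `⨁ H^n(M)[-n]` by way of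
`Y^i ⟶ H^i(Y) ⟶ H^i(M)`. -/
lemma exists_toCohomologyComplex {Y M : CochainComplex B ℤ} (i : ℤ) (hY : IsZero (Y.X (i + 1)))
    (φ : Y ⟶ M) (hφ : IsIso (homologyMap φ i)) :
    ∃ ψ : Y ⟶ cohomologyComplex M, IsIso (homologyMap ψ i) := by
  have hι : IsIso (Y.homologyι i) :=
    Y.isIso_homologyι i (i + 1) (by simp) (hY.eq_of_tgt _ _)
  let f : Y.X i ⟶ M.homology i := Y.pOpcycles i ≫ inv (Y.homologyι i) ≫ homologyMap φ i
  let a := mkHomToSingle (K := Y) f (by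
    intro j _
    simp [f])
  obtain ⟨g, hg⟩ : ∃ g : M.homology i ⟶ (cohomologyComplex M).X i, IsIso g :=
    ⟨𝟙 (M.homology i), inferInstanceAs (IsIso (𝟙 (M.homology i)))⟩
  let b := mkHomFromSingle (K := cohomologyComplex M) (j := i) g (fun k _ => comp_zero)
  have hab : (a ≫ b).f i = f ≫ g := by
    have hb : b.f i = (singleObjXSelf (ComplexShape.up ℤ) i (M.homology i)).hom ≫ g :=
      mkHomFromSingle_f _ _
    simp [a, hb]
  have hι' : IsIso ((cohomologyComplex M).homologyι i) :=
    (cohomologyComplex M).isIso_homologyι i (i + 1) (by simp) rfl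
  have hp' : IsIso ((cohomologyComplex M).pOpcycles i) :=
    (cohomologyComplex M).isIso_pOpcycles (i - 1) i (by simp) rfl
  have h1 : opcyclesMap (a ≫ b) i =
      inv (Y.homologyι i) ≫ homologyMap φ i ≫ g ≫ (cohomologyComplex M).pOpcycles i := by
    rw [← cancel_epi (Y.pOpcycles i), p_opcyclesMap, hab]
    simp only [f, Category.assoc]
  have h2 : homologyMap (a ≫ b) i ≫ (cohomologyComplex M).homologyι i =
      homologyMap φ i ≫ g ≫ (cohomologyComplex M).pOpcycles i := by
    rw [homologyι_naturality, h1, IsIso.hom_inv_id_assoc]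
  refine ⟨a ≫ b, ?_⟩
  have h3 : IsIso (homologyMap (a ≫ b) i ≫ (cohomologyComplex M).homologyι i) := by
    rw [h2]
    exact IsIso.comp_isIso' hφ (IsIso.comp_isIso' hg hp')
  exact (isIso_comp_right_iff _ _).mp h3

/-- A bounded complex is decomposable as soon as each of its cohomology objects is hit
isomorphically by a complex with no other cohomology. -/
theorem isDecomposable_of_forall_exists [HasDerivedCategory.{w} B] {M : CochainComplex B ℤ}
    (I : Finset ℤ) (hI : ∀ p ∉ I, IsZero (M.homology p))
    (h : ∀ i ∈ I, ∃ (X : CochainComplex B ℤ) (φ : X ⟶ M),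
      (∀ p, p ≠ i → IsZero (X.homology p)) ∧ IsIso (homologyMap φ i)) :
    IsDecomposable M := by
  have h' : ∀ i : I, ∃ (Y : CochainComplex B ℤ) (φ : Y ⟶ M) (ψ : Y ⟶ cohomologyComplex M),
      (∀ p, p ≠ (i : ℤ) → IsZero (Y.homology p)) ∧ IsIso (homologyMap φ (i : ℤ)) ∧
        IsIso (homologyMap ψ (i : ℤ)) := by
    intro i
    obtain ⟨X, φ, hX, hφ⟩ := h i i.2
    have hi : ∀ q : ℤ, q ≤ i → IsIso (homologyMap (X.ιTruncLE i) q) := fun q hq =>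
      (quasiIsoAt_iff_isIso_homologyMap _ _).mp (X.quasiIsoAt_ιTruncLE i q hq)
    have hφ' : IsIso (homologyMap (X.ιTruncLE i ≫ φ) (i : ℤ)) := by
      rw [homologyMap_comp]
      exact IsIso.comp_isIso' (hi i le_rfl) hφ
    have hz : IsZero ((X.truncLE i).X (i + 1)) :=
      CochainComplex.isZero_of_isStrictlyLE _ (i : ℤ) _ (by lia)
    obtain ⟨ψ, hψ⟩ := exists_toCohomologyComplex (i : ℤ) hz _ hφ'
    refine ⟨X.truncLE i, X.ιTruncLE i ≫ φ, ψ, fun p hp => ?_, hφ', hψ⟩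
    by_cases hpi : p ≤ i
    · have := hi p hpi
      exact (hX p hp).of_iso (asIso (homologyMap (X.ιTruncLE i) p))
    · rw [← exactAt_iff_isZero_homology]
      exact CochainComplex.exactAt_of_isLE _ (i : ℤ) _ (by lia)
  choose Y φ ψ hY hφ hψ using h'
  have hC : ∀ p ∉ I, IsZero ((cohomologyComplex M).homology p) := by
    intro p hp
    rw [← exactAt_iff_isZero_homology]
    exact ShortComplex.exact_of_isZero_X₂ _ (hI p hp)
  have q1 := quasiIso_biproduct_desc I hI Y φ hY hφ
  have q2 := quasiIso_biproduct_desc I hC Y ψ hY hψ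
  have i1 := (DerivedCategory.isIso_Q_map_iff_quasiIso _ _).mpr q1
  have i2 := (DerivedCategory.isIso_Q_map_iff_quasiIso _ _).mpr q2
  exact ⟨(asIso (DerivedCategory.Q.map (biproduct.desc φ))).symm ≪≫
    asIso (DerivedCategory.Q.map (biproduct.desc ψ))⟩

end Decomposable

/-! ### Splitting the truncation in degrees at most one -/

section Splitting

open Limits HomologicalComplex

variable {B : Type*} [Category* B] [Abelian B]

lemma isIso_homologyMap_of_d_eq_zero {Y Z : CochainComplex B ℤ} (ψ : Y ⟶ Z) (i : ℤ)
    (hY : Y.d i (i + 1) = 0) (hY' : Y.d (i - 1) i = 0) (hZ : Z.d i (i + 1) = 0)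
    (hZ' : Z.d (i - 1) i = 0) [IsIso (ψ.f i)] : IsIso (homologyMap ψ i) := by
  have h1 : IsIso (Y.homologyι i) := Y.isIso_homologyι i (i + 1) (by simp) hY
  have h2 : IsIso (Z.homologyι i) := Z.isIso_homologyι i (i + 1) (by simp) hZ
  have h3 : IsIso (Y.pOpcycles i) := Y.isIso_pOpcycles (i - 1) i (by simp) hY'
  have h4 : IsIso (Z.pOpcycles i) := Z.isIso_pOpcycles (i - 1) i (by simp) hZ'
  have h5 : IsIso (opcyclesMap ψ i) := by
    have h : Y.pOpcycles i ≫ opcyclesMap ψ i = ψ.f i ≫ Z.pOpcycles i := p_opcyclesMap ψ i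
    have h6 : IsIso (Y.pOpcycles i ≫ opcyclesMap ψ i) := by rw [h]; infer_instance
    exact (isIso_comp_left_iff _ _).mp h6
  have h7 : IsIso (homologyMap ψ i ≫ Z.homologyι i) := by
    rw [homologyι_naturality]; infer_instance
  exact (isIso_comp_right_iff _ _).mp h7

/-- If `τ_{≤ 1} K` is decomposable, then `H^1(K)` is covered by the first cocycles of a complex
without cohomology in degree `0`. -/
lemma exists_hom_of_isDecomposable [HasDerivedCategory.{w} B] {K : CochainComplex B ℤ}
    (h : IsDecomposable (K.truncLE 1)) :
    ∃ (P : CochainComplex B ℤ) (g : P ⟶ K), IsZero (P.homology 0) ∧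
      IsIso (homologyMap g 1) := by
  obtain ⟨e⟩ := h
  let S := (single B (ComplexShape.up ℤ) 1).obj ((K.truncLE 1).homology 1)
  obtain ⟨c, hc⟩ : ∃ c : (K.truncLE 1).homology 1 ⟶ (cohomologyComplex (K.truncLE 1)).X 1,
      IsIso c :=
    ⟨𝟙 ((K.truncLE 1).homology 1), inferInstanceAs (IsIso (𝟙 ((K.truncLE 1).homology 1)))⟩
  let j : S ⟶ cohomologyComplex (K.truncLE 1) := mkHomFromSingle c (fun k _ => comp_zero)
  have hj : IsIso (homologyMap j 1) := by
    have hjf : j.f 1 = (singleObjXSelf (ComplexShape.up ℤ) 1 _).hom ≫ c :=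
      mkHomFromSingle_f _ _
    have : IsIso (j.f 1) := by rw [hjf]; infer_instance
    exact isIso_homologyMap_of_d_eq_zero j 1 (by simp [S]) (by simp [S]) rfl rfl
  obtain ⟨P, s, hs, g, hg⟩ := DerivedCategory.right_fac (DerivedCategory.Q.map j ≫ e.inv)
  have hs' : QuasiIso s := (DerivedCategory.isIso_Q_map_iff_quasiIso _ _).mp hs
  have hg' : DerivedCategory.Q.map g =
      DerivedCategory.Q.map s ≫ DerivedCategory.Q.map j ≫ e.inv := by
    rw [hg, IsIso.hom_inv_id_assoc]
  have hQ : ∀ {Y Z : CochainComplex B ℤ} (f : Y ⟶ Z),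
      IsIso ((DerivedCategory.homologyFunctor B 1).map (DerivedCategory.Q.map f)) ↔
        IsIso (homologyMap f 1) := fun f =>
    NatIso.isIso_map_iff (DerivedCategory.homologyFunctorFactors B 1) f
  have hg1 : IsIso (homologyMap g 1) := by
    rw [← hQ, hg', Functor.map_comp, Functor.map_comp]
    have := (hQ j).mpr hj
    have := (hQ s).mpr inferInstance
    infer_instance
  refine ⟨P, g ≫ K.ιTruncLE 1, ?_, ?_⟩
  · refine IsZero.of_iso ?_ (asIso (homologyMap s 0))
    rw [← exactAt_iff_isZero_homology]
    exact exactAt_single_obj _ _ _ _ (by simp)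
  · have h2 : IsIso (homologyMap (K.ιTruncLE 1) 1) :=
      (quasiIsoAt_iff_isIso_homologyMap _ _).mp (K.quasiIsoAt_ιTruncLE 1 1 le_rfl)
    rw [homologyMap_comp]
    infer_instance

lemma epi_toCycles_of_isZero_homology (P : CochainComplex B ℤ) (i j : ℤ) (hij : i + 1 = j)
    (h : IsZero (P.homology j)) : Epi (P.toCycles i j) := by
  have h1 : (ShortComplex.mk (P.toCycles i j) (P.homologyπ j) (by simp)).Exact :=
    ShortComplex.exact_of_g_is_cokernel _ (P.homologyIsCokernel i j (by simp [← hij]))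
  exact h1.epi_f (h.eq_of_tgt _ _)

/-- If `K` vanishes in degree `-1` and `τ_{≤ 1} K` is decomposable, then there is an epimorphism
`E ⟶ H^1(K)` which lifts to cocycles, in such a way that the cocycles attached to the elements
of its kernel are coboundaries in a specified way. -/
theorem exists_splitting_of_isDecomposable [HasDerivedCategory.{w} B] {K : CochainComplex B ℤ}
    (hK : IsZero (K.X (-1))) (h : IsDecomposable (K.truncLE 1)) :
    ∃ (E : B) (p : E ⟶ K.cycles 1) (l : kernel (p ≫ K.homologyπ 1) ⟶ K.X 0),
      Epi (p ≫ K.homologyπ 1) ∧ kernel.ι (p ≫ K.homologyπ 1) ≫ p ≫ K.iCycles 1 = l ≫ K.d 0 1 := by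
  obtain ⟨P, g, hP, hg⟩ := exists_hom_of_isDecomposable h
  have hπ : cyclesMap g 1 ≫ K.homologyπ 1 = P.homologyπ 1 ≫ homologyMap g 1 :=
    (homologyπ_naturality g 1).symm
  have hz : P.toCycles 0 1 ≫ cyclesMap g 1 ≫ K.homologyπ 1 = 0 := by
    rw [hπ, toCycles_comp_homologyπ_assoc, zero_comp]
  let c : P.X 0 ⟶ kernel (cyclesMap g 1 ≫ K.homologyπ 1) :=
    kernel.lift _ (P.toCycles 0 1) hz
  have hcι : c ≫ kernel.ι _ = P.toCycles 0 1 := kernel.lift_ι _ _ _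
  have hc : Epi c := by
    have h1 : (ShortComplex.mk (P.toCycles 0 1) (P.homologyπ 1) (by simp)).Exact :=
      ShortComplex.exact_of_g_is_cokernel _ (P.homologyIsCokernel 0 1 (by simp))
    have h2 : (ShortComplex.mk (P.toCycles 0 1) (cyclesMap g 1 ≫ K.homologyπ 1)
        hz).Exact := by
      let φ : ShortComplex.mk (P.toCycles 0 1) (P.homologyπ 1) (by simp) ⟶
          ShortComplex.mk (P.toCycles 0 1) (cyclesMap g 1 ≫ K.homologyπ 1) hz :=
        { τ₁ := 𝟙 _, τ₂ := 𝟙 _, τ₃ := homologyMap g 1 }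
      exact (ShortComplex.exact_iff_of_epi_of_isIso_of_mono φ).mp h1
    exact (ShortComplex.exact_iff_epi_kernel_lift _).mp h2
  have hkey : kernel.ι c ≫ g.f 0 = 0 := by
    have h3 : kernel.ι c ≫ P.d 0 1 = 0 := by
      rw [← P.toCycles_i 0 1, ← hcι, Category.assoc, kernel.condition_assoc, zero_comp]
    have h4 : P.liftCycles (kernel.ι c) 1 (by simp) h3 ≫ P.iCycles 0 = kernel.ι c :=
      P.liftCycles_i _ _ _ _
    have h5 : P.iCycles 0 ≫ g.f 0 = 0 := by
      have := epi_toCycles_of_isZero_homology P (-1) 0 (by simp) hP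
      rw [← cancel_epi (P.toCycles (-1) 0), toCycles_i_assoc, ← g.comm, hK.eq_of_tgt (g.f (-1)) 0]
      simp
    rw [← h4, Category.assoc, h5, comp_zero]
  refine ⟨P.cycles 1, cyclesMap g 1, Abelian.epiDesc c (g.f 0) hkey, ?_, ?_⟩
  · rw [hπ]
    infer_instance
  · rw [← cancel_epi c, reassoc_of% hcι, Abelian.comp_epiDesc_assoc]
    simp

end Splitting

/-! ### Local statements about sections of sheaves of modules -/

noncomputable section Local

open Opposite Limits

variable {C : Type u} [SmallCategory C]

/-- The statement `Q` about the objects over `U` holds locally, that is on a covering of `U`. -/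
def Locally (J : GrothendieckTopology C) (U : C) (Q : ∀ ⦃V : C⦄, (V ⟶ U) → Prop) : Prop :=
  ∃ S ∈ J U, ∀ ⦃V : C⦄ (f : V ⟶ U), S.arrows f → Q f

namespace Locally

variable {J : GrothendieckTopology C} {U : C} {Q Q' : ∀ ⦃V : C⦄, (V ⟶ U) → Prop}

lemma of_forall (h : ∀ ⦃V : C⦄ (f : V ⟶ U), Q f) : Locally J U Q :=
  ⟨⊤, J.top_mem U, fun _ f _ => h f⟩

lemma mono (h : Locally J U Q) (hQ : ∀ ⦃V : C⦄ (f : V ⟶ U), Q f → Q' f) : Locally J U Q' := by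
  obtain ⟨S, hS, hQ'⟩ := h
  exact ⟨S, hS, fun V f hf => hQ f (hQ' f hf)⟩

lemma bind (h : Locally J U Q)
    (hQ : ∀ ⦃V : C⦄ (f : V ⟶ U), Q f → Locally J V fun _ g => Q' (g ≫ f)) : Locally J U Q' := by
  obtain ⟨S, hS, hS'⟩ := h
  choose T hT hT' using fun (V : C) (f : V ⟶ U) (hf : S.arrows f) => hQ f (hS' f hf)
  refine ⟨Sieve.bind S.arrows fun V f hf => T V f hf, J.bind_covering hS fun V f hf => hT V f hf, ?_⟩
  rintro V f ⟨W, g, e, he, hg, rfl⟩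
  exact hT' W e he g hg

lemma and (h : Locally J U Q) (h' : Locally J U Q') : Locally J U fun _ f => Q f ∧ Q' f := by
  obtain ⟨S, hS, hQ⟩ := h
  obtain ⟨S', hS', hQ'⟩ := h'
  exact ⟨S ⊓ S', J.intersection_covering hS hS', fun V f hf => ⟨hQ f hf.1, hQ' f hf.2⟩⟩

lemma forall_mem_finset {ι : Type*} (s : Finset ι) {Q : ι → ∀ ⦃V : C⦄, (V ⟶ U) → Prop}
    (h : ∀ i ∈ s, Locally J U (Q i)) : Locally J U fun _ f => ∀ i ∈ s, Q i f := by
  classical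
  induction s using Finset.induction_on with
  | empty => exact of_forall fun V f i hi => by simp at hi
  | insert a s _ ih =>
    refine ((h a (by simp)).and (ih fun i hi => h i (by simp [hi]))).mono ?_
    rintro V f ⟨h1, h2⟩ i hi
    rcases Finset.mem_insert.mp hi with rfl | hi
    exacts [h1, h2 i hi]

lemma forall_fintype {ι : Type*} [Finite ι] {Q : ι → ∀ ⦃V : C⦄, (V ⟶ U) → Prop}
    (h : ∀ i, Locally J U (Q i)) : Locally J U fun _ f => ∀ i, Q i f := by
  have := Fintype.ofFinite ι
  exact (forall_mem_finset Finset.univ fun i _ => h i).mono fun V f hf i => hf i (by simp)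

end Locally

variable {J : GrothendieckTopology C}

/-- Presheaves of modules over the presheaf of rings underlying `A`. -/
abbrev PreMod (A : Sheaf J CommRingCat.{u}) :=
  PresheafOfModules.{u} (A.obj ⋙ forget₂ CommRingCat RingCat)

variable {A : Sheaf J CommRingCat.{u}}

/-- The restriction of rings of sections of `A` along `f : V ⟶ U`. -/
abbrev resRing (A : Sheaf J CommRingCat.{u}) {U V : C} (f : V ⟶ U) :
    A.obj.obj (op U) →+* A.obj.obj (op V) :=
  (A.obj.map f.op).hom

/-- The restriction of sections along `f : V ⟶ U`. -/
def res (P : PreMod A) {U V : C} (f : V ⟶ U) :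
    P.obj (op U) →ₛₗ[resRing A f] P.obj (op V) :=
  P.restrictₛₗ f.op

/-- The linear map on sections over `U` given by a morphism of presheaves of modules. -/
def sec {P Q : PreMod A} (φ : P ⟶ Q) (U : C) :
    P.obj (op U) →ₗ[A.obj.obj (op U)] Q.obj (op U) :=
  (φ.app (op U)).hom

lemma resRing_id (U : C) : resRing A (𝟙 U) = RingHom.id _ := by
  ext x
  simp [resRing]

lemma resRing_comp {U V W : C} (f : V ⟶ U) (g : W ⟶ V) :
    resRing A (g ≫ f) = (resRing A g).comp (resRing A f) := by
  ext x
  simp [resRing]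

lemma resRing_id_apply {U : C} (a : A.obj.obj (op U)) : resRing A (𝟙 U) a = a := by
  rw [resRing_id, RingHom.id_apply]

lemma resRing_comp_apply {U V W : C} (f : V ⟶ U) (g : W ⟶ V) (a : A.obj.obj (op U)) :
    resRing A (g ≫ f) a = resRing A g (resRing A f a) := by
  rw [resRing_comp, RingHom.comp_apply]

lemma res_id (P : PreMod A) {U : C} (x : P.obj (op U)) : res P (𝟙 U) x = x := by
  change P.map (𝟙 (op U)) x = x
  rw [P.map_id]
  rfl

lemma res_comp (P : PreMod A) {U V W : C} (f : V ⟶ U) (g : W ⟶ V) (x : P.obj (op U)) :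
    res P (g ≫ f) x = res P g (res P f x) :=
  P.map_comp_apply f.op g.op x

lemma sec_res {P Q : PreMod A} (φ : P ⟶ Q) {U V : C} (f : V ⟶ U) (x : P.obj (op U)) :
    sec φ V (res P f x) = res Q f (sec φ U x) :=
  PresheafOfModules.naturality_apply φ f.op x

lemma hom_ext_sec {P Q : PreMod A} {φ ψ : P ⟶ Q}
    (h : ∀ (U : C) (x : P.obj (op U)), sec φ U x = sec ψ U x) : φ = ψ := by
  ext U x
  exact h U.unop x

/-- The presheaf of modules given by modules of sections and semilinear restriction maps. -/
def mkPreMod (N : C → Type u) [∀ U, AddCommGroup (N U)] [∀ U, Module (A.obj.obj (op U)) (N U)]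
    (r : ∀ {U V : C} (f : V ⟶ U), N U →ₛₗ[resRing A f] N V)
    (r_id : ∀ {U : C} (x : N U), r (𝟙 U) x = x)
    (r_comp : ∀ {U V W : C} (f : V ⟶ U) (g : W ⟶ V) (x : N U), r (g ≫ f) x = r g (r f x)) :
    PreMod A where
  obj U := ModuleCat.of (A.obj.obj U) (N U.unop)
  map {U V} f := ModuleCat.ofHom
    (Y := (ModuleCat.restrictScalars (A.obj.map f).hom).obj (ModuleCat.of (A.obj.obj V) (N V.unop)))
    { toFun := fun x => r f.unop x
      map_add' := fun x y => map_add _ x y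
      map_smul' := fun a x => (r f.unop).map_smulₛₗ a x }
  map_id U := by
    ext x
    exact r_id x
  map_comp f g := by
    ext x
    exact r_comp f.unop g.unop x

/-- The morphism of presheaves of modules given by compatible linear maps on sections. -/
def mkHom {P Q : PreMod A} (φ : ∀ U : C, P.obj (op U) →ₗ[A.obj.obj (op U)] Q.obj (op U))
    (hφ : ∀ {U V : C} (f : V ⟶ U) (x : P.obj (op U)), φ V (res P f x) = res Q f (φ U x)) :
    P ⟶ Q where
  app U := ModuleCat.ofHom (X := P.obj U) (Y := Q.obj U) (φ U.unop)
  naturality {U V} f := by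
    ext x
    exact hφ f.unop x

/-- A section of a sheaf that vanishes locally is zero. -/
lemma eq_zero_of_locally (M : Mod A) {U : C} {x : M.val.obj (op U)}
    (h : Locally J U fun _ f => res M.val f x = 0) : x = 0 := by
  obtain ⟨S, hS, h⟩ := h
  refine M.isSheaf.isSeparated U S hS x 0 fun V f hf => ?_
  exact (h f hf).trans (map_zero (res M.val f)).symm

lemma eq_of_locally (M : Mod A) {U : C} {x y : M.val.obj (op U)}
    (h : Locally J U fun _ f => res M.val f x = res M.val f y) : x = y := by
  rw [← sub_eq_zero]
  refine eq_zero_of_locally M (h.mono fun V f hf => ?_)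
  rw [map_sub, hf, sub_self]

/-- The canonical map from a presheaf of modules to its associated sheaf. -/
def toSh (P : PreMod A) : P ⟶ ((sheafify A).obj P).val :=
  (PresheafOfModules.sheafificationAdjunction (R := ringSheaf A) (𝟙 (ringSheaf A).obj)).unit.app P

lemma locally_eq_toSh (P : PreMod A) {U : C} (y : ((sheafify A).obj P).val.obj (op U)) :
    Locally J U fun V f => ∃ x : P.obj (op V), sec (toSh P) V x = res _ f y := by
  have h := Presheaf.imageSieve_mem J (CategoryTheory.toSheafify J P.presheaf) (U := op U) y
  exact ⟨_, h, fun V f ⟨x, hx⟩ => ⟨x, hx⟩⟩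

lemma locally_eq_zero_of_toSh (P : PreMod A) {U : C} (x : P.obj (op U))
    (hx : sec (toSh P) U x = 0) : Locally J U fun _ f => res P f x = 0 := by
  have h := Presheaf.equalizerSieve_mem J (CategoryTheory.toSheafify J P.presheaf) (X := op U) x 0
    (hx.trans (map_zero (sec (toSh P) U)).symm)
  exact ⟨_, h, fun V f hf => Eq.trans hf (map_zero (res P f))⟩

lemma sheafify_map_toSh {P Q : PreMod A} (φ : P ⟶ Q) {U : C} (x : P.obj (op U)) :
    sec ((sheafify A).map φ).val U (sec (toSh P) U x) = sec (toSh Q) U (sec φ U x) := by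
  have h := (PresheafOfModules.sheafificationAdjunction (R := ringSheaf A)
    (𝟙 (ringSheaf A).obj)).unit.naturality φ
  exact (congrArg (fun ψ => sec ψ U x) h).symm

/-- The morphism from the associated sheaf given by the universal property. -/
def liftSh {P : PreMod A} {M : Mod A} (φ : P ⟶ M.val) : (sheafify A).obj P ⟶ M :=
  ((PresheafOfModules.sheafificationAdjunction (R := ringSheaf A)
    (𝟙 (ringSheaf A).obj)).homEquiv P M).symm φ

lemma sec_liftSh {P : PreMod A} {M : Mod A} (φ : P ⟶ M.val) {U : C} (x : P.obj (op U)) :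
    sec (liftSh φ).val U (sec (toSh P) U x) = sec φ U x := by
  have h := (PresheafOfModules.sheafificationAdjunction (R := ringSheaf A)
    (𝟙 (ringSheaf A).obj)).homEquiv_unit (X := P) (Y := M) (f := liftSh φ)
  have h' : (PresheafOfModules.sheafificationAdjunction (R := ringSheaf A)
    (𝟙 (ringSheaf A).obj)).homEquiv P M (liftSh φ) = φ := Equiv.apply_symm_apply _ _
  rw [h'] at h
  exact (congrArg (fun ψ => sec ψ U x) h).symm

end Local

/-! ### Exactness in terms of local sections -/

section LocalExactness

open Opposite Limits

variable {C : Type u} [SmallCategory C] {J : GrothendieckTopology C}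
  {A : Sheaf J CommRingCat.{u}}

lemma sec_injective_of_mono {M N : Mod A} (φ : M ⟶ N) [Mono φ] (U : C) :
    Function.Injective (sec φ.val U) := by
  have : PreservesFiniteLimits (SheafOfModules.evaluation.{u} (ringSheaf A) (op U)) :=
    SheafOfModules.Finite.evaluationPreservesFiniteLimits (ringSheaf A) (op U)
  have h : Mono ((SheafOfModules.evaluation.{u} (ringSheaf A) (op U)).map φ) := inferInstance
  exact (ModuleCat.mono_iff_injective _).mp h

lemma exists_sec_eq_of_mono {S : ShortComplex (Mod A)} (hS : S.Exact) [Mono S.f] {U : C}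
    (x : S.X₂.val.obj (op U)) (hx : sec S.g.val U x = 0) : ∃ y, sec S.f.val U y = x := by
  have : (SheafOfModules.evaluation.{u} (ringSheaf A) (op U)).PreservesZeroMorphisms :=
    ⟨fun _ _ => rfl⟩
  have : PreservesFiniteLimits (SheafOfModules.evaluation.{u} (ringSheaf A) (op U)) :=
    SheafOfModules.Finite.evaluationPreservesFiniteLimits (ringSheaf A) (op U)
  have hS' := hS.map_of_mono_of_preservesKernel
    (SheafOfModules.evaluation.{u} (ringSheaf A) (op U)) inferInstance inferInstance
  rw [ShortComplex.moduleCat_exact_iff] at hS'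
  exact hS' x hx

lemma exists_sec_cokernel_eq {P Q : PreMod A} (φ : P ⟶ Q) {U : C} (x : Q.obj (op U))
    (hx : sec (cokernel.π φ) U x = 0) : ∃ y, sec φ U y = x := by
  have hS : (ShortComplex.mk φ (cokernel.π φ) (cokernel.condition φ)).Exact :=
    ShortComplex.exact_cokernel φ
  have : Epi (ShortComplex.mk φ (cokernel.π φ) (cokernel.condition φ)).g :=
    inferInstanceAs (Epi (cokernel.π φ))
  have hS' := hS.map_of_epi_of_preservesCokernel
    (PresheafOfModules.evaluation.{u} (A.obj ⋙ forget₂ CommRingCat RingCat) (op U))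
    inferInstance inferInstance
  rw [ShortComplex.moduleCat_exact_iff] at hS'
  exact hS' x hx

/-- Epimorphisms of sheaves are locally surjective on sections. -/
lemma locally_exists_of_epi {M N : Mod A} (φ : M ⟶ N) [Epi φ] {U : C} (x : N.val.obj (op U)) :
    Locally J U fun V f => ∃ y : M.val.obj (op V), sec φ.val V y = res N.val f x := by
  let ψ : N ⟶ (sheafify A).obj (cokernel φ.val) := ⟨cokernel.π φ.val ≫ toSh _⟩
  have hψ : ψ = 0 := by
    rw [← cancel_epi φ, comp_zero]
    ext1
    change φ.val ≫ cokernel.π φ.val ≫ toSh _ = 0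
    rw [cokernel.condition_assoc, zero_comp]
  have h1 : sec (toSh (cokernel φ.val)) U (sec (cokernel.π φ.val) U x) = 0 :=
    congrArg (fun χ : N ⟶ (sheafify A).obj (cokernel φ.val) => sec χ.val U x) hψ
  refine (locally_eq_zero_of_toSh _ _ h1).mono fun V f hf => ?_
  rw [← sec_res] at hf
  exact exists_sec_cokernel_eq φ.val _ hf

lemma locally_exists_of_exact {S : ShortComplex (Mod A)} (hS : S.Exact) {U : C}
    (x : S.X₂.val.obj (op U)) (hx : sec S.g.val U x = 0) :
    Locally J U fun V f => ∃ y : S.X₁.val.obj (op V), sec S.f.val V y = res _ f x := by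
  have h1 : (ShortComplex.mk S.iCycles S.g S.iCycles_g).Exact :=
    ShortComplex.exact_of_f_is_kernel _ S.cyclesIsKernel
  have : Mono (ShortComplex.mk S.iCycles S.g S.iCycles_g).f := inferInstanceAs (Mono S.iCycles)
  obtain ⟨z, hz⟩ := exists_sec_eq_of_mono h1 x hx
  have := hS.epi_toCycles
  refine (locally_exists_of_epi S.toCycles z).mono ?_
  rintro V f ⟨y, hy⟩
  refine ⟨y, ?_⟩
  have h2 : sec S.iCycles.val V (sec S.toCycles.val V y) = sec S.f.val V y :=
    congrArg (fun χ : S.X₁ ⟶ S.X₂ => sec χ.val V y) S.toCycles_i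
  rw [← h2, hy, sec_res]
  exact congrArg _ hz

lemma hom_eq_zero_of_locally {M N : Mod A} (φ : M ⟶ N)
    (h : ∀ (U : C) (x : M.val.obj (op U)),
      Locally J U fun V f => sec φ.val V (res M.val f x) = 0) : φ = 0 := by
  ext1
  refine hom_ext_sec fun U x => eq_zero_of_locally N ((h U x).mono fun V f hf => ?_)
  rw [← sec_res, hf]

lemma exact_of_locally {S : ShortComplex (Mod A)}
    (h : ∀ (U : C) (x : S.X₂.val.obj (op U)), sec S.g.val U x = 0 →
      Locally J U fun V f => ∃ y : S.X₁.val.obj (op V), sec S.f.val V y = res _ f x) :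
    S.Exact := by
  rw [ShortComplex.exact_iff_epi_toCycles]
  refine Preadditive.epi_of_cancel_zero _ fun {W} ψ hψ => hom_eq_zero_of_locally ψ fun U z => ?_
  have h1 : sec S.g.val U (sec S.iCycles.val U z) = 0 :=
    congrArg (fun χ : S.cycles ⟶ S.X₃ => sec χ.val U z) S.iCycles_g
  refine (h U _ h1).mono ?_
  rintro V f ⟨y, hy⟩
  have h2 : sec S.iCycles.val V (sec S.toCycles.val V y) = sec S.f.val V y :=
    congrArg (fun χ : S.X₁ ⟶ S.X₂ => sec χ.val V y) S.toCycles_i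
  rw [← sec_res, ← h2] at hy
  rw [← sec_injective_of_mono S.iCycles V hy]
  exact congrArg (fun χ : S.X₁ ⟶ W => sec χ.val V y) hψ

section Complexes

variable (K : CochainComplex (Mod A) ℤ)

lemma exists_cycle (n m : ℤ) (h : n + 1 = m) {U : C} (x : (K.X n).val.obj (op U))
    (hx : sec (K.d n m).val U x = 0) :
    ∃ z : (K.cycles n).val.obj (op U), sec (K.iCycles n).val U z = x := by
  have hS : (ShortComplex.mk (K.iCycles n) (K.d n m) (K.iCycles_d n m)).Exact :=
    ShortComplex.exact_of_f_is_kernel _ (K.cyclesIsKernel n m (by simpa using h))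
  have : Mono (ShortComplex.mk (K.iCycles n) (K.d n m) (K.iCycles_d n m)).f :=
    inferInstanceAs (Mono (K.iCycles n))
  exact exists_sec_eq_of_mono hS x hx

lemma d_iCycles (n m : ℤ) {U : C} (z : (K.cycles n).val.obj (op U)) :
    sec (K.d n m).val U (sec (K.iCycles n).val U z) = 0 :=
  congrArg (fun χ : K.cycles n ⟶ K.X m => sec χ.val U z) (K.iCycles_d n m)

lemma homologyπ_eq_zero_of_eq_d (i j : ℤ) {U : C} (z : (K.cycles j).val.obj (op U))
    (y : (K.X i).val.obj (op U)) (h : sec (K.d i j).val U y = sec (K.iCycles j).val U z) :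
    sec (K.homologyπ j).val U z = 0 := by
  have h1 : sec (K.iCycles j).val U (sec (K.toCycles i j).val U y) = sec (K.d i j).val U y :=
    congrArg (fun χ : K.X i ⟶ K.X j => sec χ.val U y) (K.toCycles_i i j)
  rw [h] at h1
  rw [← sec_injective_of_mono (K.iCycles j) U h1]
  exact congrArg (fun χ : K.X i ⟶ K.homology j => sec χ.val U y) (K.toCycles_comp_homologyπ i j)

lemma locally_eq_d_of_homologyπ_eq_zero (i j : ℤ) (hij : i + 1 = j) {U : C}
    (z : (K.cycles j).val.obj (op U)) (hz : sec (K.homologyπ j).val U z = 0) :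
    Locally J U fun V f => ∃ y : (K.X i).val.obj (op V),
      sec (K.d i j).val V y = res _ f (sec (K.iCycles j).val U z) := by
  have h1 : (ShortComplex.mk (K.toCycles i j) (K.homologyπ j) (by simp)).Exact :=
    ShortComplex.exact_of_g_is_cokernel _ (K.homologyIsCokernel i j (by simp [← hij]))
  refine (locally_exists_of_exact h1 z hz).mono ?_
  rintro V f ⟨y, hy⟩
  refine ⟨y, ?_⟩
  rw [← sec_res]
  refine Eq.trans ?_ (congrArg (sec (K.iCycles j).val V) hy)
  exact (congrArg (fun χ : K.X i ⟶ K.X j => sec χ.val V y) (K.toCycles_i i j)).symm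

/-- A complex of sheaves is acyclic in degree `j` if its cocycles of degree `j` are locally
coboundaries. -/
lemma isZero_homology_of_locally (i j k : ℤ) (hij : i + 1 = j) (hjk : j + 1 = k)
    (h : ∀ (U : C) (x : (K.X j).val.obj (op U)), sec (K.d j k).val U x = 0 →
      Locally J U fun V f => ∃ y : (K.X i).val.obj (op V), sec (K.d i j).val V y = res _ f x) :
    IsZero (K.homology j) := by
  rw [← HomologicalComplex.exactAt_iff_isZero_homology,
    K.exactAt_iff' i j k (by simp [← hij]) (by simp [hjk])]
  exact exact_of_locally h

/-- A morphism of complexes of sheaves is an isomorphism on the cohomology in degree `j` if this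
holds locally on sections. -/
lemma isIso_homologyMap_of_locally {K L : CochainComplex (Mod A) ℤ} (φ : K ⟶ L) (i j k : ℤ)
    (hij : i + 1 = j) (hjk : j + 1 = k)
    (hinj : ∀ (U : C) (t : (K.X j).val.obj (op U)) (l : (L.X i).val.obj (op U)),
      sec (K.d j k).val U t = 0 → sec (φ.f j).val U t = sec (L.d i j).val U l →
      Locally J U fun V f => ∃ y : (K.X i).val.obj (op V), sec (K.d i j).val V y = res _ f t)
    (hsurj : ∀ (U : C) (x : (L.X j).val.obj (op U)), sec (L.d j k).val U x = 0 →
      Locally J U fun V f => ∃ (t : (K.X j).val.obj (op V)) (l : (L.X i).val.obj (op V)),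
        sec (K.d j k).val V t = 0 ∧
          res _ f x = sec (φ.f j).val V t + sec (L.d i j).val V l) :
    IsIso (HomologicalComplex.homologyMap φ j) := by
  have nat1 : ∀ {U : C} (z : (K.cycles j).val.obj (op U)),
      sec (HomologicalComplex.homologyMap φ j).val U (sec (K.homologyπ j).val U z) =
        sec (L.homologyπ j).val U (sec (HomologicalComplex.cyclesMap φ j).val U z) := fun z =>
    congrArg (fun χ : K.cycles j ⟶ L.homology j => sec χ.val _ z)
      (HomologicalComplex.homologyπ_naturality φ j)
  have nat2 : ∀ {U : C} (z : (K.cycles j).val.obj (op U)),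
      sec (L.iCycles j).val U (sec (HomologicalComplex.cyclesMap φ j).val U z) =
        sec (φ.f j).val U (sec (K.iCycles j).val U z) := fun z =>
    congrArg (fun χ : K.cycles j ⟶ L.X j => sec χ.val _ z)
      (HomologicalComplex.cyclesMap_i φ j)
  have hmono : Mono (HomologicalComplex.homologyMap φ j) := by
    refine Preadditive.mono_of_cancel_zero _ fun {W} ψ hψ => ?_
    refine hom_eq_zero_of_locally ψ fun U w => ?_
    refine (locally_exists_of_epi (K.homologyπ j) (sec ψ.val U w)).bind ?_
    rintro V f ⟨z, hz⟩
    have h0 : sec (L.homologyπ j).val V (sec (HomologicalComplex.cyclesMap φ j).val V z) = 0 := by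
      rw [← nat1, hz, sec_res]
      have h1 : sec (HomologicalComplex.homologyMap φ j).val U (sec ψ.val U w) = 0 :=
        congrArg (fun χ : W ⟶ L.homology j => sec χ.val U w) hψ
      rw [h1, map_zero]
    refine (locally_eq_d_of_homologyπ_eq_zero L i j hij _ h0).bind ?_
    rintro V' f' ⟨l, hl⟩
    rw [nat2, ← sec_res, ← sec_res] at hl
    refine (hinj V' _ l ?_ hl.symm).mono ?_
    · rw [sec_res, sec_res, d_iCycles, map_zero]
    · rintro V'' f'' ⟨y, hy⟩
      rw [res_comp, res_comp, sec_res, sec_res, sec_res, ← hz, ← sec_res, ← sec_res]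
      refine homologyπ_eq_zero_of_eq_d K i j _ y ?_
      rw [hy, sec_res, sec_res, sec_res]
  have hepi : Epi (HomologicalComplex.homologyMap φ j) := by
    refine Preadditive.epi_of_cancel_zero _ fun {W} ψ hψ => ?_
    refine hom_eq_zero_of_locally ψ fun U w => ?_
    refine (locally_exists_of_epi (L.homologyπ j) w).bind ?_
    rintro V f ⟨z, hz⟩
    refine (hsurj V (sec (L.iCycles j).val V z) (d_iCycles L j k z)).mono ?_
    rintro V' f' ⟨t, l, ht, hl⟩
    obtain ⟨s, rfl⟩ := exists_cycle K j k hjk t ht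
    rw [res_comp, ← hz]
    rw [← nat2, ← sec_res, ← sub_eq_iff_eq_add', ← map_sub] at hl
    have h1 := homologyπ_eq_zero_of_eq_d L i j _ l hl.symm
    rw [map_sub, sub_eq_zero, ← nat1] at h1
    rw [← sec_res, h1]
    exact congrArg (fun χ : K.homology j ⟶ W => sec χ.val V' (sec (K.homologyπ j).val V' s)) hψ
  exact isIso_of_mono_of_epi _

end Complexes

end LocalExactness

/-! ### Relations between sections of a flat sheaf of modules -/

section Relations

open Opposite Limits TensorProduct

/-- A vanishing sum of elementary tensors is a consequence of finitely many relations. -/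
lemma exists_relations_of_sum_tmul_eq_zero {R H N ι : Type*} [CommRing R] [AddCommGroup H]
    [Module R H] [AddCommGroup N] [Module R N] [Fintype ι] (h : ι → H) (n : ι → N)
    (hz : ∑ i, h i ⊗ₜ[R] n i = 0) :
    ∃ (k : ℕ) (y : Fin k → H) (B : Finset N) (g : ι → Fin k → R) (b : N → Fin k → R),
      (∀ c, ∑ i, g i c • n i + ∑ x ∈ B, b x c • x = 0) ∧
        (∀ i, h i = ∑ c, g i c • y c) ∧ ∀ x, ∑ c, b x c • y c = 0 := by
  classical
  let π : (ι ⊕ N →₀ R) →ₗ[R] N := Finsupp.linearCombination R (Sum.elim n id)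
  have hπ : Function.Surjective π := fun x => ⟨Finsupp.single (Sum.inr x) 1, by simp [π]⟩
  let t : H ⊗[R] (ι ⊕ N →₀ R) := ∑ i, h i ⊗ₜ Finsupp.single (Sum.inl i) 1
  have ht : LinearMap.lTensor H π t = 0 := by
    rw [← hz]
    simp [t, π]
  have hex : Function.Exact (LinearMap.ker π).subtype π := π.exact_subtype_ker_map
  obtain ⟨t', ht'⟩ := ((lTensor_exact (M := LinearMap.ker π) (N := ι ⊕ N →₀ R) (P := N) H hex hπ) t).mp ht
  obtain ⟨k, y, ρ, rfl⟩ := TensorProduct.exists_sum_tmul_eq t'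
  have hc : ∀ j, TensorProduct.finsuppScalarRight R R H (ι ⊕ N) t j =
      ∑ c, (ρ c : ι ⊕ N →₀ R) j • y c := by
    intro j
    rw [← ht']
    simp [Finsupp.finsetSum_apply, TensorProduct.finsuppScalarRight_apply_tmul_apply]
  refine ⟨k, y, Finset.univ.biUnion fun c => (ρ c : ι ⊕ N →₀ R).support.toRight,
    fun i c => (ρ c : ι ⊕ N →₀ R) (Sum.inl i), fun x c => (ρ c : ι ⊕ N →₀ R) (Sum.inr x),
    fun c => ?_, fun i => ?_, fun x => ?_⟩
  · have h1 : π (ρ c) = 0 := (ρ c).2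
    rw [Finsupp.linearCombination_apply, Finsupp.sum_of_support_subset (s := Finset.univ.disjSum
      (Finset.univ.biUnion fun c => (ρ c : ι ⊕ N →₀ R).support.toRight)), Finset.sum_disjSum] at h1
    · simpa using h1
    · rintro (i | x) hx
      · simp
      · rw [Finset.inr_mem_disjSum, Finset.mem_biUnion]
        exact ⟨c, by simp, by simpa using hx⟩
    · simp
  · rw [← hc (Sum.inl i)]
    simp [t, Finsupp.finsetSum_apply, TensorProduct.finsuppScalarRight_apply_tmul_apply,
      Finsupp.single_apply]
  · rw [← hc (Sum.inr x)]
    simp [t, Finsupp.finsetSum_apply, TensorProduct.finsuppScalarRight_apply_tmul_apply]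

variable {C : Type u} [SmallCategory C] {J : GrothendieckTopology C}
  {A : Sheaf J CommRingCat.{u}}

section Tensor

noncomputable section

/-- The section `x ⊗ y` of the tensor product of two presheaves of modules. -/
def tmul (P Q : PreMod A) {U : C} (x : P.obj (op U)) (y : Q.obj (op U)) :
    (MonoidalCategory.tensorObj P Q).obj (op U) :=
  TensorProduct.tmul (A.obj.obj (op U)) (M := P.obj (op U)) (N := Q.obj (op U)) x y

end

lemma res_tmul (P Q : PreMod A) {U V : C} (f : V ⟶ U) (x : P.obj (op U)) (y : Q.obj (op U)) :
    res (MonoidalCategory.tensorObj P Q) f (tmul P Q x y) =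
      tmul P Q (res P f x) (res Q f y) := rfl

lemma sec_whiskerLeft_tmul (P : PreMod A) {Q Q' : PreMod A} (φ : Q ⟶ Q') {U : C}
    (x : P.obj (op U)) (y : Q.obj (op U)) :
    sec (MonoidalCategory.whiskerLeft P φ) U (tmul P Q x y) = tmul P Q' x (sec φ U y) := rfl

lemma sum_tmul_smul (P Q : PreMod A) {U : C} {ι : Type*} [Fintype ι] (x : ι → P.obj (op U))
    (r : ι → A.obj.obj (op U)) (y : Q.obj (op U)) :
    ∑ i, tmul P Q (x i) (r i • y) = tmul P Q (∑ i, r i • x i) y := by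
  have h := TensorProduct.sum_tmul (R := A.obj.obj (op U)) (M := P.obj (op U)) (N := Q.obj (op U))
    Finset.univ (fun i => r i • x i) y
  refine Eq.trans (Finset.sum_congr rfl fun i _ => ?_) h.symm
  exact ((TensorProduct.smul_tmul (R := A.obj.obj (op U)) (R' := A.obj.obj (op U))
    (M := P.obj (op U)) (N := Q.obj (op U)) (r i) (x i) y)).symm

lemma exists_relations_of_sum_tmul_presheaf_eq_zero (P Q : PreMod A) {U : C} {ι : Type*}
    [Fintype ι] (h : ι → P.obj (op U)) (n : ι → Q.obj (op U))
    (hz : ∑ i, tmul P Q (h i) (n i) = 0) :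
    ∃ (k : ℕ) (y : Fin k → P.obj (op U)) (B : Finset (Q.obj (op U)))
      (g : ι → Fin k → A.obj.obj (op U)) (b : Q.obj (op U) → Fin k → A.obj.obj (op U)),
      (∀ c, ∑ i, g i c • n i + ∑ x ∈ B, b x c • x = 0) ∧
        (∀ i, h i = ∑ c, g i c • y c) ∧ ∀ x, ∑ c, b x c • y c = 0 :=
  exists_relations_of_sum_tmul_eq_zero (R := A.obj.obj (op U)) h n hz

end Tensor

noncomputable section

variable (A)

/-- The free presheaf of modules with one generator over `U`: its sections over `V` are the
formal linear combinations of morphisms `V ⟶ U`. -/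
def freeOn (U : C) : PreMod A :=
  mkPreMod (fun V => (V ⟶ U) →₀ A.obj.obj (op V))
    (fun {V _} g => freeMap (resRing A g) fun f : V ⟶ U => g ≫ f)
    (fun x => freeMap_id (fun f => 𝟙 _ ≫ f) resRing_id_apply (fun f => Category.id_comp f) x)
    (fun {V _ _} g k x => (freeMap_freeMap _ (fun f : V ⟶ U => g ≫ f) (fun f => k ≫ f)
      (fun f => (k ≫ g) ≫ f) (fun a => (resRing_comp_apply g k a).symm)
      (fun f => (Category.assoc k g f).symm) x).symm)

variable {A}

/-- The formal linear combinations of morphisms `V ⟶ U` whose coefficient at each `f` lies in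
the ideal generated by the restrictions along `f` of given sections `r i` over `U`. -/
def idealSubmodule {U : C} {ι : Type*} (r : ι → A.obj.obj (op U)) (V : C) :
    Submodule (A.obj.obj (op V)) ((V ⟶ U) →₀ A.obj.obj (op V)) where
  carrier := {x | ∀ f, x f ∈ Ideal.span (Set.range fun i => resRing A f (r i))}
  add_mem' hx hy _ := Ideal.add_mem _ (hx _) (hy _)
  zero_mem' _ := Ideal.zero_mem _
  smul_mem' a _ hx _ := Ideal.mul_mem_left _ a (hx _)

lemma single_mem_idealSubmodule {U : C} {ι : Type*} (r : ι → A.obj.obj (op U)) {V : C}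
    (f : V ⟶ U) {a : A.obj.obj (op V)}
    (ha : a ∈ Ideal.span (Set.range fun i => resRing A f (r i))) :
    Finsupp.single f a ∈ idealSubmodule r V := by
  classical
  intro f'
  rw [Finsupp.single_apply]
  split_ifs with h
  · exact h ▸ ha
  · exact Ideal.zero_mem _

lemma freeMap_mem_idealSubmodule {U : C} {ι : Type*} (r : ι → A.obj.obj (op U)) {V W : C}
    (g : W ⟶ V) {x : (V ⟶ U) →₀ A.obj.obj (op V)} (hx : x ∈ idealSubmodule r V) :
    freeMap (resRing A g) (fun f : V ⟶ U => g ≫ f) x ∈ idealSubmodule r W := by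
  rw [← Finsupp.sum_single x, Finsupp.sum, map_sum]
  refine Submodule.sum_mem _ fun f _ => ?_
  rw [freeMap_single]
  refine single_mem_idealSubmodule r _ ?_
  have h := Ideal.mem_map_of_mem (resRing A g) (hx f)
  rw [Ideal.map_span, ← Set.range_comp] at h
  convert h using 4
  simp [resRing_comp]

/-- The subpresheaf of `freeOn A U` generated by the multiples `r i` of the generator. -/
def idealOn {U : C} {ι : Type*} (r : ι → A.obj.obj (op U)) : PreMod A :=
  mkPreMod (fun V => idealSubmodule r V)
    (fun {V _} g =>
      { toFun := fun x => ⟨freeMap (resRing A g) (fun f : V ⟶ U => g ≫ f) x.1,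
          freeMap_mem_idealSubmodule r g x.2⟩
        map_add' := fun x y => Subtype.ext (map_add _ x.1 y.1)
        map_smul' := fun a x => Subtype.ext (LinearMap.map_smulₛₗ _ a x.1) })
    (fun x => Subtype.ext (res_id (freeOn A U) x.1))
    (fun g k x => Subtype.ext (res_comp (freeOn A U) g k x.1))

/-- The inclusion of the subpresheaf generated by the multiples `r i` of the generator. -/
def idealOnι {U : C} {ι : Type*} (r : ι → A.obj.obj (op U)) : idealOn r ⟶ freeOn A U :=
  mkHom (fun V => (idealSubmodule r V).subtype) fun _ _ => rfl

instance {U : C} {ι : Type*} (r : ι → A.obj.obj (op U)) : Mono (idealOnι r) :=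
  PresheafOfModules.mono_of_injective fun V =>
    (Subtype.val_injective : Function.Injective (idealSubmodule r V.unop).subtype)

end

/-- A relation between sections of a flat sheaf is locally a consequence of relations between
sections of the sheaf of rings. Flatness is used for the inclusion of the subsheaf generated by the
coefficients `r i` into the free sheaf with one generator over `U`: the relation says that
`∑ h i ⊗ r i` dies in the tensor product with the free sheaf, so it is already zero in the tensor
product with the subsheaf. -/
theorem locally_exists_of_isFlat_of_relation {H : Mod A} (hH : IsFlat H) {ι : Type*} [Fintype ι]
    {U : C} (h : ι → H.val.obj (op U)) (r : ι → A.obj.obj (op U)) (hr : ∑ i, r i • h i = 0) :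
    Locally J U fun V f => ∃ (k : ℕ) (y : Fin k → H.val.obj (op V))
      (g : ι → Fin k → A.obj.obj (op V)),
      (∀ i, res H.val f (h i) = ∑ c, g i c • y c) ∧
        ∀ c, ∑ i, resRing A f (r i) * g i c = 0 := by
  classical
  let Q := (sheafify A).obj (idealOn r)
  let j : Q ⟶ (sheafify A).obj (freeOn A U) := (sheafify A).map (idealOnι r)
  have hj : Mono ((tensorLeft H).map j) := by
    have : (tensorLeft H).PreservesMonomorphisms := hH
    have : Mono j := inferInstanceAs (Mono ((sheafify A).map (idealOnι r)))
    infer_instance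
  let n : ι → (idealOn r).obj (op U) := fun i =>
    (⟨Finsupp.single (𝟙 U) (r i), single_mem_idealSubmodule r _ (Ideal.subset_span
      ⟨i, resRing_id_apply _⟩)⟩ : idealSubmodule r U)
  let e : (freeOn A U).obj (op U) := (Finsupp.single (𝟙 U) 1 : (U ⟶ U) →₀ A.obj.obj (op U))
  have hn : ∀ i, sec (idealOnι r) U (n i) = r i • e := fun i => by
    change Finsupp.single (𝟙 U) (r i) = r i • Finsupp.single (𝟙 U) (1 : A.obj.obj (op U))
    simp
  let t := ∑ i, tmul H.val Q.val (h i) (sec (toSh (idealOn r)) U (n i))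
  have ht : sec (MonoidalCategory.whiskerLeft (C := PreMod A) H.val j.val) U t = 0 := by
    have h1 : ∀ i, sec (MonoidalCategory.whiskerLeft (C := PreMod A) H.val j.val) U
        (tmul H.val Q.val (h i) (sec (toSh (idealOn r)) U (n i))) =
        tmul H.val _ (h i) (r i • sec (toSh (freeOn A U)) U e) := fun i => by
      rw [sec_whiskerLeft_tmul, sheafify_map_toSh, hn, map_smul]
    rw [map_sum, Finset.sum_congr rfl fun i _ => h1 i, sum_tmul_smul, hr]
    exact TensorProduct.zero_tmul _ _
  have ht' : sec (toSh (MonoidalCategory.tensorObj (C := PreMod A) H.val Q.val)) U t = 0 := by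
    have : Mono ((sheafify A).map
        (MonoidalCategory.whiskerLeft (C := PreMod A) H.val j.val)) := hj
    refine sec_injective_of_mono
      ((sheafify A).map (MonoidalCategory.whiskerLeft (C := PreMod A) H.val j.val)) U ?_
    rw [map_zero, sheafify_map_toSh, ht, map_zero]
  refine (locally_eq_zero_of_toSh _ t ht').bind fun V f hf => ?_
  have hf' : ∑ i, tmul H.val Q.val (res H.val f (h i))
      (sec (toSh (idealOn r)) V (res (idealOn r) f (n i))) = 0 := by
    rw [← hf, map_sum]
    refine Finset.sum_congr rfl fun i _ => ?_
    rw [res_tmul, sec_res]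
  obtain ⟨k, y, B, g, b, h1, h2, h3⟩ :=
    exists_relations_of_sum_tmul_presheaf_eq_zero _ _ _ _ hf'
  refine (Locally.forall_mem_finset B fun x _ => locally_eq_toSh (idealOn r) x).bind
    fun V' f' hν => ?_
  choose! ν hν using hν
  have h4 : ∀ c, sec (toSh (idealOn r)) V' (∑ i, resRing A f' (g i c) • res (idealOn r) f'
      (res (idealOn r) f (n i)) + ∑ x ∈ B, resRing A f' (b x c) • ν x) = 0 := fun c => by
    rw [← map_zero (res Q.val f'), ← h1 c, map_add, map_add, map_sum, map_sum, map_sum, map_sum]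
    congr 1
    · refine Finset.sum_congr rfl fun i _ => ?_
      rw [map_smul, sec_res, LinearMap.map_smulₛₗ]
    · refine Finset.sum_congr rfl fun x hx => ?_
      rw [map_smul, LinearMap.map_smulₛₗ, hν x hx]
  refine (Locally.forall_fintype fun c => locally_eq_zero_of_toSh _ _ (h4 c)).mono
    fun V'' f'' h5 => ?_
  let F := (f'' ≫ f') ≫ f
  let ν' : Q.val.obj (op V) → idealSubmodule r V'' := fun x => res (idealOn r) f'' (ν x)
  have h6 : ∀ x, ∃ s : ι → A.obj.obj (op V''), ∑ i, s i * resRing A F (r i) = (ν' x).1 F :=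
    fun x => Ideal.mem_span_range_iff_exists_fun.mp ((ν' x).2 F)
  choose s hs using h6
  have h7 : ∀ i, res (idealOn r) f'' (res (idealOn r) f' (res (idealOn r) f (n i))) =
      (⟨Finsupp.single F (resRing A F (r i)), single_mem_idealSubmodule r _
        (Ideal.subset_span ⟨i, rfl⟩)⟩ : idealSubmodule r V'') := fun i => by
    rw [← res_comp, ← res_comp]
    refine Subtype.ext ((freeMap_single _ _ _ _).trans ?_)
    simp [F]
  let G : A.obj.obj (op V) → A.obj.obj (op V'') := fun a => resRing A f'' (resRing A f' a)
  have h8 : ∀ c, ∑ i, G (g i c) * resRing A F (r i) + ∑ x ∈ B, G (b x c) * (ν' x).1 F = 0 := by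
    intro c
    have h9 : ∑ i, G (g i c) • (⟨Finsupp.single F (resRing A F (r i)),
        single_mem_idealSubmodule r _ (Ideal.subset_span ⟨i, rfl⟩)⟩ : idealSubmodule r V'') +
        ∑ x ∈ B, G (b x c) • ν' x = 0 := by
      refine Eq.trans ?_ (h5 c)
      rw [map_add, map_sum, map_sum]
      congr 1
      · refine Finset.sum_congr rfl fun i _ => ?_
        rw [LinearMap.map_smulₛₗ, h7]
        rfl
      · refine Finset.sum_congr rfl fun x _ => ?_
        rw [LinearMap.map_smulₛₗ]
        rfl
    have h10 := congrArg (fun z : idealSubmodule r V'' => z.1 F) h9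
    simpa [Finsupp.finsetSum_apply] using h10
  refine ⟨k, fun c => res H.val f'' (res H.val f' (y c)),
    fun i c => G (g i c) + ∑ x ∈ B, s x i * G (b x c), fun i => ?_, fun c => ?_⟩
  · have h11 : ∀ x, ∑ c, G (b x c) • res H.val f'' (res H.val f' (y c)) = 0 := fun x => by
      have := congrArg (fun z => res H.val f'' (res H.val f' z)) (h3 x)
      simpa only [map_sum, LinearMap.map_smulₛₗ, map_zero] using this
    simp only [add_smul, Finset.sum_add_distrib, Finset.sum_smul]
    rw [Finset.sum_comm, Finset.sum_eq_zero (s := B) fun x _ => by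
      simp only [mul_smul]
      rw [← Finset.smul_sum, h11, smul_zero], add_zero, res_comp, res_comp, h2]
    simp only [map_sum, LinearMap.map_smulₛₗ]
    rfl
  · rw [← h8 c]
    simp only [mul_add, Finset.sum_add_distrib, Finset.mul_sum]
    congr 1
    · exact Finset.sum_congr rfl fun i _ => mul_comm _ _
    · rw [Finset.sum_comm]
      refine Finset.sum_congr rfl fun x _ => ?_
      rw [← hs, Finset.mul_sum]
      exact Finset.sum_congr rfl fun i _ => by ring

/-- Finitely many relations between sections of a flat sheaf are locally a consequence of
relations between sections of the sheaf of rings. -/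
theorem locally_exists_of_isFlat {H : Mod A} (hH : IsFlat H) {ι Λ : Type*} [Fintype ι]
    {U : C} (h : ι → H.val.obj (op U)) (S : Finset Λ) (r : Λ → ι → A.obj.obj (op U))
    (hr : ∀ l ∈ S, ∑ i, r l i • h i = 0) :
    Locally J U fun V f => ∃ (k : ℕ) (y : Fin k → H.val.obj (op V))
      (g : ι → Fin k → A.obj.obj (op V)),
      (∀ i, res H.val f (h i) = ∑ c, g i c • y c) ∧
        ∀ l ∈ S, ∀ c, ∑ i, resRing A f (r l i) * g i c = 0 := by
  classical
  induction S using Finset.induction_on with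
  | empty =>
    refine Locally.of_forall fun V f => ⟨Fintype.card ι, fun c =>
      res H.val f (h ((Fintype.equivFin ι).symm c)),
      fun i c => if Fintype.equivFin ι i = c then 1 else 0, fun i => ?_, by simp⟩
    simp [ite_smul]
  | insert l S _ ih =>
    refine (ih fun l' hl' => hr l' (Finset.mem_insert_of_mem hl')).bind ?_
    rintro V f ⟨k, y, g, hy, hg⟩
    have h1 : ∑ c, (∑ i, resRing A f (r l i) * g i c) • y c = 0 := by
      have h2 := congrArg (res H.val f) (hr l (Finset.mem_insert_self l S))
      rw [map_sum, map_zero] at h2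
      rw [← h2]
      simp only [Finset.sum_smul, LinearMap.map_smulₛₗ, hy, Finset.smul_sum, mul_smul]
      exact Finset.sum_comm
    refine (locally_exists_of_isFlat_of_relation hH y _ h1).mono ?_
    rintro V' f' ⟨k', y', g', hy', hg'⟩
    refine ⟨k', y', fun i c' => ∑ c, resRing A f' (g i c) * g' c c', fun i => ?_, ?_⟩
    · rw [res_comp, hy]
      simp only [map_sum, LinearMap.map_smulₛₗ, hy', Finset.smul_sum, Finset.sum_smul, mul_smul]
      exact Finset.sum_comm
    · have key : ∀ l' c', ∑ i, resRing A (f' ≫ f) (r l' i) *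
          ∑ c, resRing A f' (g i c) * g' c c' =
          ∑ c, resRing A f' (∑ i, resRing A f (r l' i) * g i c) * g' c c' := fun l' c' => by
        simp only [resRing_comp_apply, map_sum, map_mul, Finset.mul_sum, Finset.sum_mul]
        rw [Finset.sum_comm]
        exact Finset.sum_congr rfl fun _ _ => Finset.sum_congr rfl fun _ _ => by ring
      intro l' hl' c'
      rw [key]
      rcases Finset.mem_insert.mp hl' with rfl | hl'
      · exact hg' c'
      · exact Finset.sum_eq_zero fun c _ => by rw [hg l' hl' c, map_zero, zero_mul]

end Relations

/-! ### Maps out of the Koszul complex -/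

section MapsOut

variable {R : Type*} [CommRing R] {L : Type*} [AddCommGroup L] [Module R L]

/-- The linear map `Sym(L) ⊗ N → G` extending `b : N → G`, when the elements of `L` act on `G` by
commuting operators. -/
noncomputable def SymTensor.liftEnd {N G : Type*} [AddCommGroup N] [Module R N] [AddCommGroup G]
    [Module R G] (a : L →ₗ[R] Module.End R G) (ha : ∀ l l' x, a l (a l' x) = a l' (a l x))
    (b : N →ₗ[R] G) : SymTensor R L N →ₗ[R] G :=
  have : LeftCommutative fun (l : L) (g : N →ₗ[R] G) => (a l).comp g :=
    ⟨fun l l' g => LinearMap.ext fun n => ha l l' (g n)⟩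
  SymTensor.lift (fun s => s.foldr (fun l g => (a l).comp g) b)
    (fun l l' s n => by simp) (fun r l s n => by simp)

section

variable {N G : Type*} [AddCommGroup N] [Module R N] [AddCommGroup G] [Module R G]
  (a : L →ₗ[R] Module.End R G) (ha : ∀ l l' x, a l (a l' x) = a l' (a l x)) (b : N →ₗ[R] G)

lemma SymTensor.liftEnd_mk_zero (n : N) :
    SymTensor.liftEnd a ha b (SymTensor.mk R 0 n) = b n := by
  simp [SymTensor.liftEnd]

lemma SymTensor.liftEnd_mulL (l : L) (x : SymTensor R L N) :
    SymTensor.liftEnd a ha b (SymTensor.mulL l x) = a l (SymTensor.liftEnd a ha b x) := by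
  induction x using SymTensor.induction_mk with
  | h0 => simp
  | hadd x y hx hy => simp only [map_add, hx, hy]
  | hmk s n => simp [SymTensor.liftEnd]

end

namespace KoszulModule

variable {F : Type*} [AddCommGroup F] [Module R F]

/-- The Koszul complex is generated by `1` under multiplication by elements of `L` and `F`. -/
lemma induction_wedge_mulL {p : KoszulModule R L F → Prop}
    (hadd : ∀ x y, p x → p y → p (x + y))
    (hsmul : ∀ r : R, p (r • SymTensor.mk R 0 1))
    (hwedge : ∀ v x, p x → p (SymTensor.mapN (wedgeEnd (R := R) v) x))
    (hmul : ∀ l x, p x → p (SymTensor.mulL l x)) (x : KoszulModule R L F) : p x := by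
  induction x using SymTensor.induction_mulL with
  | hadd x y hx hy => exact hadd x y hx hy
  | hmul l x hx => exact hmul l x hx
  | hmk w =>
    induction w using CliffordAlgebra.left_induction with
    | algebraMap r =>
      have h := hsmul r
      rwa [← map_smul, ← Algebra.algebraMap_eq_smul_one] at h
    | add x y hx hy => rw [map_add]; exact hadd _ _ hx hy
    | ι_mul x m hx =>
      have h := hwedge m _ hx
      rwa [SymTensor.mapN_mk] at h

variable {G : Type*} [AddCommGroup G] [Module R G] (a : L →ₗ[R] Module.End R G)
  (z : F →ₗ[R] Module.End R G) (ha : ∀ l l' x, a l (a l' x) = a l' (a l x))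
  (hz : ∀ v x, z v (z v x) = 0) (e : G)

/-- The linear map from the Koszul complex to a module `G` which sends `1` to `e`, when `L` acts
on `G` by commuting operators and `F` by operators of square zero. -/
noncomputable def toModule : KoszulModule R L F →ₗ[R] G :=
  SymTensor.liftEnd a ha (((LinearMap.applyₗ e).comp
    (ExteriorAlgebra.lift R ⟨z, fun v => LinearMap.ext fun x => hz v x⟩).toLinearMap))

lemma toModule_mk_one : toModule a z ha hz e (SymTensor.mk R 0 1) = e := by
  rw [toModule, SymTensor.liftEnd_mk_zero]
  simp

lemma toModule_mulL (l : L) (x : KoszulModule R L F) :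
    toModule a z ha hz e (SymTensor.mulL l x) = a l (toModule a z ha hz e x) :=
  SymTensor.liftEnd_mulL _ _ _ _ _

lemma toModule_wedge (haz : ∀ l v x, a l (z v x) = z v (a l x)) (v : F)
    (x : KoszulModule R L F) :
    toModule a z ha hz e (SymTensor.mapN (wedgeEnd (R := R) v) x) =
      z v (toModule a z ha hz e x) := by
  induction x using SymTensor.induction_mulL with
  | hadd x y hx hy => simp only [map_add, hx, hy]
  | hmul l x hx => rw [SymTensor.mapN_mulL, toModule_mulL, hx, toModule_mulL, haz]
  | hmk w =>
    rw [SymTensor.mapN_mk, toModule, SymTensor.liftEnd_mk_zero, SymTensor.liftEnd_mk_zero]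
    simp

end KoszulModule

section RelKoszul

variable {R' : Type*} [CommRing R'] {ρ : R →+* R'} {H : Type*} [AddCommGroup H] [Module R H]
  {H' : Type*} [AddCommGroup H'] [Module R' H'] {X X' : Type*} {h : X → H} {h' : X' → H'}

lemma relD_mk_zero (w : ExteriorAlgebra R (X →₀ R)) : relD R h (SymTensor.mk R 0 w) = 0 :=
  KoszulModule.d_mk_zero _ _

lemma relD_wedge (v : X →₀ R) (x : RelKoszul R h) :
    relD R h (SymTensor.mapN (KoszulModule.wedgeEnd (R := R) v) x) =
      -SymTensor.mapN (KoszulModule.wedgeEnd (R := R) v) (relD R h x) :=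
  KoszulModule.d_wedge _ v x

lemma relD_mulL (l : Rel R h) (x : RelKoszul R h) :
    relD R h (SymTensor.mulL l x) = SymTensor.mulL l (relD R h x) +
      SymTensor.mapN (KoszulModule.wedgeEnd (R := R) (Rel.incl R h l)) x :=
  KoszulModule.d_mulL _ l x

variable (τ : H →ₛₗ[ρ] H') (t : X → X') (ht : ∀ a, h' (t a) = τ (h a))

lemma relKoszulMap_mk_one :
    relKoszulMap τ t ht (SymTensor.mk R 0 1) = SymTensor.mk R' 0 1 := by
  refine (KoszulModule.map_mk _ _ _ _).trans ?_
  simp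

lemma relKoszulMap_wedge (v : X →₀ R) (x : RelKoszul R h) :
    relKoszulMap τ t ht (SymTensor.mapN (KoszulModule.wedgeEnd (R := R) v) x) =
      SymTensor.mapN (KoszulModule.wedgeEnd (R := R') (freeMap ρ t v))
        (relKoszulMap τ t ht x) :=
  KoszulModule.map_wedge ..

lemma relKoszulMap_mulL (l : Rel R h) (x : RelKoszul R h) :
    relKoszulMap τ t ht (SymTensor.mulL l x) =
      SymTensor.mulL (relMap τ t ht l) (relKoszulMap τ t ht x) :=
  KoszulModule.map_mulL ..

end RelKoszul

end MapsOut

/-! ### The Koszul complex maps to the differential graded algebra -/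

lemma exists_linearMap_comp_eq {R L M N : Type*} [CommRing R] [AddCommGroup L] [Module R L]
    [AddCommGroup M] [Module R M] [AddCommGroup N] [Module R N] (j : M →ₗ[R] N)
    (hj : Function.Injective j) (f : L →ₗ[R] N) (h : ∀ x, ∃ y, j y = f x) :
    ∃ g : L →ₗ[R] M, ∀ x, j (g x) = f x := by
  choose g hg using h
  exact ⟨{ toFun := g
           map_add' := fun x y => hj (by simp only [map_add, hg])
           map_smul' := fun a x => hj (by simp only [map_smul, hg, RingHom.id_apply]) }, hg⟩

noncomputable section ToAlgebra

open Opposite Limits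

variable {C : Type u} [SmallCategory C] {J : GrothendieckTopology C}
  {A : Sheaf J CommRingCat.{u}}

/-- A splitting of a differential graded algebra in degree one: an epimorphism from a sheaf of
modules `E` to `H^1(K)`, a lift of it to cocycles, and primitives `prim` for the cocycles attached
to the sections of its kernel. -/
structure Splitting (K : CDGA A) where
  /-- the source of the epimorphism -/
  E : Mod A
  /-- the lift to cocycles -/
  lift : E ⟶ K.K.cycles 1
  /-- the primitives of the cocycles attached to the sections of the kernel -/
  prim : kernel (lift ≫ K.K.homologyπ 1) ⟶ K.K.X 0
  epi : Epi (lift ≫ K.K.homologyπ 1)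
  comm : kernel.ι (lift ≫ K.K.homologyπ 1) ≫ lift ≫ K.K.iCycles 1 = prim ≫ K.K.d 0 1

namespace CDGA

variable (K : CDGA A)

/-- The multiplication of a differential graded algebra as a bilinear map on sections. -/
def mulHom (p q r : ℤ) (h : p + q = r) (U : C) :
    (K.K.X p).val.obj (op U) →ₗ[A.obj.obj (op U)] (K.K.X q).val.obj (op U) →ₗ[A.obj.obj (op U)]
      (K.K.X r).val.obj (op U) :=
  LinearMap.mk₂ _ (K.mul p q r h) (K.add_mul p q r h) (K.smul_mul p q r h) (K.mul_add p q r h)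
    (fun a x y => K.mul_smul p q r h a x y)

/-- The product of the modules of sections over `U` of the components of the algebra. -/
abbrev Total (U : C) : Type u := (p : ℤ) → (K.K.X p).val.obj (op U)

/-- Multiplication by sections of degree `k`, as operators on the product of all components. -/
def opEnd (k : ℤ) (U : C) : (K.K.X k).val.obj (op U) →ₗ[A.obj.obj (op U)]
    Module.End (A.obj.obj (op U)) (K.Total U) where
  toFun x := LinearMap.pi fun p =>
    (K.mulHom k (p - k) p (by lia) U x).comp (LinearMap.proj (p - k))
  map_add' x y := by
    ext g p
    simp
  map_smul' a x := by
    ext g p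
    simp

variable {K}

lemma opEnd_apply {k p q : ℤ} (h : k + q = p) {U : C} (x : (K.K.X k).val.obj (op U))
    (g : K.Total U) : K.opEnd k U x g p = K.mul k q p h x (g q) := by
  obtain rfl : q = p - k := by lia
  rfl

lemma opEnd_opEnd {k l m : ℤ} (h : k + l = m) {U : C} (x : (K.K.X k).val.obj (op U))
    (y : (K.K.X l).val.obj (op U)) (g : K.Total U) :
    K.opEnd k U x (K.opEnd l U y g) = K.opEnd m U (K.mul k l m h x y) g := by
  funext p
  rw [opEnd_apply (q := p - k) (by lia), opEnd_apply (q := p - m) (by lia),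
    opEnd_apply (q := p - m) (by lia), K.mul_assoc]

lemma opEnd_zero_comm {k : ℤ} {U : C} (x : (K.K.X 0).val.obj (op U))
    (y : (K.K.X k).val.obj (op U)) (g : K.Total U) :
    K.opEnd 0 U x (K.opEnd k U y g) = K.opEnd k U y (K.opEnd 0 U x g) := by
  rw [opEnd_opEnd (zero_add k), opEnd_opEnd (add_zero k),
    K.mul_comm 0 k k (zero_add k) (add_zero k)]
  simp

lemma mul_self_eq_zero {U : C} (h2 : IsUnit (2 : A.obj.obj (op U)))
    (x : (K.K.X 1).val.obj (op U)) : K.mul 1 1 2 rfl x x = 0 := by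
  have h := K.mul_comm 1 1 2 rfl rfl x x
  have h' : (2 : A.obj.obj (op U)) • K.mul 1 1 2 rfl x x = 0 := by
    rw [two_smul]
    nth_rewrite 1 [h]
    simp
  exact (h2.smul_eq_zero).mp h'

lemma opEnd_one_self {U : C} (h2 : IsUnit (2 : A.obj.obj (op U)))
    (x : (K.K.X 1).val.obj (op U)) (g : K.Total U) :
    K.opEnd 1 U x (K.opEnd 1 U x g) = 0 := by
  rw [opEnd_opEnd (m := 2) rfl, mul_self_eq_zero h2, map_zero, LinearMap.zero_apply]

lemma d_mul_of_d_eq_zero {p q r q' r' : ℤ} (h : p + q = r) (hq : q + 1 = q') (hr : r + 1 = r')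
    (h' : p + q' = r') {p' : ℤ} (hp : p + 1 = p') {U : Cᵒᵖ} (x : (K.K.X p).val.obj U)
    (hx : (K.K.d p p').val.app U x = 0) (y : (K.K.X q).val.obj U) :
    (K.K.d r r').val.app U (K.mul p q r h x y) =
      p.negOnePow • K.mul p q' r' h' x ((K.K.d q q').val.app U y) := by
  have h3 := K.leibniz p q r p' q' r' h hp hq hr x y
  rw [hx, K.zero_mul, zero_add] at h3
  exact h3

lemma prod_cons {U : C} (n : ℕ) (a : (K.K.X 1).val.obj (op U))
    (x : Fin n → (K.K.X 1).val.obj (op U)) :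
    K.prod (n + 1) (Fin.cons a x : Fin (n + 1) → (K.K.X 1).val.obj (op U)) =
      K.mul 1 n ((n + 1 : ℕ) : ℤ) (by push_cast; ring) a (K.prod n x) := by
  induction n with
  | zero =>
    have h1 : K.prod (0 + 1) (Fin.cons a x : Fin (0 + 1) → (K.K.X 1).val.obj (op U)) =
        K.mul 0 1 1 (zero_add 1) (K.one.eval (op U)) a := rfl
    exact h1.trans ((K.one_mul 1 a).trans (K.mul_one 1 a).symm)
  | succ n ih =>
    have h1 : K.prod (n + 1 + 1) (Fin.cons a x : Fin (n + 1 + 1) → (K.K.X 1).val.obj (op U)) =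
        K.mul (n + 1 : ℕ) 1 ((n + 1 + 1 : ℕ) : ℤ) (by simp)
          (K.prod (n + 1) (Fin.cons a (Fin.init x) : Fin (n + 1) → (K.K.X 1).val.obj (op U)))
          (x (Fin.last n)) := by
      have h2 : Fin.init (Fin.cons a x : Fin (n + 1 + 1) → (K.K.X 1).val.obj (op U)) =
          Fin.cons a (Fin.init x) := by
        funext i
        induction i using Fin.cases <;> rfl
      rw [← h2]
      rfl
    rw [h1, ih, K.mul_assoc 1 n 1 _ ((n + 1 : ℕ) : ℤ) _ _ (by simp)]
    rfl

end CDGA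

namespace Splitting

variable {K : CDGA A} (s : Splitting K)

/-- The class in `H^1(K)` of a section of `E`. -/
def cls (U : C) : s.E.val.obj (op U) →ₗ[A.obj.obj (op U)] (K.K.homology 1).val.obj (op U) :=
  sec (s.lift ≫ K.K.homologyπ 1).val U

lemma res_cls {U V : C} (f : V ⟶ U) (x : s.E.val.obj (op U)) :
    s.cls V (res s.E.val f x) = res (K.K.homology 1).val f (s.cls U x) :=
  sec_res _ f x

/-- The sum of a formal linear combination of sections of `E`. -/
def tot (U : C) : (s.E.val.obj (op U) →₀ A.obj.obj (op U)) →ₗ[A.obj.obj (op U)]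
    s.E.val.obj (op U) :=
  Finsupp.linearCombination _ fun e => e

lemma tot_freeMap {U V : C} (f : V ⟶ U) (v : s.E.val.obj (op U) →₀ A.obj.obj (op U)) :
    s.tot V (freeMap (resRing A f) (res s.E.val f) v) = res s.E.val f (s.tot U v) :=
  linearCombination_freeMap (h := fun e => e) (h' := fun e => e) (res s.E.val f)
    (res s.E.val f) (fun _ => rfl) v

lemma cls_tot {U : C} (v : s.E.val.obj (op U) →₀ A.obj.obj (op U)) :
    s.cls U (s.tot U v) = Finsupp.linearCombination (A.obj.obj (op U)) (s.cls U) v :=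
  Finsupp.apply_linearCombination (A.obj.obj (op U)) (s.cls U) (fun e => e) v

/-- The cocycle attached to a formal linear combination of sections of `E`. -/
def cyc (U : C) : (s.E.val.obj (op U) →₀ A.obj.obj (op U)) →ₗ[A.obj.obj (op U)]
    (K.K.X 1).val.obj (op U) :=
  (sec (s.lift ≫ K.K.iCycles 1).val U).comp (s.tot U)

lemma res_cyc {U V : C} (f : V ⟶ U) (v : s.E.val.obj (op U) →₀ A.obj.obj (op U)) :
    res (K.K.X 1).val f (s.cyc U v) = s.cyc V (freeMap (resRing A f) (res s.E.val f) v) := by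
  rw [cyc, cyc, LinearMap.comp_apply, LinearMap.comp_apply, tot_freeMap, sec_res]

lemma exists_ker (U : C) : ∃ g : Rel (A.obj.obj (op U)) (s.cls U) →ₗ[A.obj.obj (op U)]
    (kernel (s.lift ≫ K.K.homologyπ 1)).val.obj (op U), ∀ x,
      sec (kernel.ι (s.lift ≫ K.K.homologyπ 1)).val U (g x) = s.tot U (Rel.incl _ _ x) := by
  have hS : (ShortComplex.mk (kernel.ι (s.lift ≫ K.K.homologyπ 1)) (s.lift ≫ K.K.homologyπ 1)
      (kernel.condition _)).Exact := ShortComplex.exact_kernel _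
  have : Mono (ShortComplex.mk (kernel.ι (s.lift ≫ K.K.homologyπ 1)) (s.lift ≫ K.K.homologyπ 1)
      (kernel.condition _)).f := inferInstanceAs (Mono (kernel.ι _))
  refine exists_linearMap_comp_eq (sec (kernel.ι (s.lift ≫ K.K.homologyπ 1)).val U)
    (sec_injective_of_mono _ U) ((s.tot U).comp (Rel.incl _ _)) fun x =>
      exists_sec_eq_of_mono hS _ ((s.cls_tot _).trans (Rel.linearCombination_incl (s.cls U) x))

/-- The section of the kernel of `E ⟶ H^1(K)` attached to a relation. -/
def ker (U : C) : Rel (A.obj.obj (op U)) (s.cls U) →ₗ[A.obj.obj (op U)]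
    (kernel (s.lift ≫ K.K.homologyπ 1)).val.obj (op U) :=
  (s.exists_ker U).choose

lemma ι_ker {U : C} (x : Rel (A.obj.obj (op U)) (s.cls U)) :
    sec (kernel.ι (s.lift ≫ K.K.homologyπ 1)).val U (s.ker U x) = s.tot U (Rel.incl _ _ x) :=
  (s.exists_ker U).choose_spec x

/-- The section of `K^0` attached to a relation. -/
def pot (U : C) : Rel (A.obj.obj (op U)) (s.cls U) →ₗ[A.obj.obj (op U)]
    (K.K.X 0).val.obj (op U) :=
  (sec s.prim.val U).comp (s.ker U)

lemma d_pot {U : C} (x : Rel (A.obj.obj (op U)) (s.cls U)) :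
    sec (K.K.d 0 1).val U (s.pot U x) = s.cyc U (Rel.incl _ _ x) := by
  rw [cyc, LinearMap.comp_apply, ← ι_ker]
  exact (congrArg (fun χ : kernel (s.lift ≫ K.K.homologyπ 1) ⟶ K.K.X 1 =>
    sec χ.val U (s.ker U x)) s.comm).symm

lemma res_pot {U V : C} (f : V ⟶ U) (x : Rel (A.obj.obj (op U)) (s.cls U)) :
    res (K.K.X 0).val f (s.pot U x) =
      s.pot V (relMap (res (K.K.homology 1).val f) (res s.E.val f) (s.res_cls f) x) := by
  have h : res _ f (s.ker U x) =
      s.ker V (relMap (res (K.K.homology 1).val f) (res s.E.val f) (s.res_cls f) x) := by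
    apply sec_injective_of_mono (kernel.ι (s.lift ≫ K.K.homologyπ 1)) V
    rw [sec_res, ι_ker, ι_ker, incl_relMap, tot_freeMap]
  rw [pot, pot, LinearMap.comp_apply, LinearMap.comp_apply, ← h, sec_res]

lemma d_cyc {U : C} (v : s.E.val.obj (op U) →₀ A.obj.obj (op U)) :
    sec (K.K.d 1 2).val U (s.cyc U v) = 0 :=
  d_iCycles K.K 1 2 _

section Map

variable (h2 : ∀ U : Cᵒᵖ, IsUnit (2 : A.obj.obj U))

/-- The linear map from the Koszul complex of the relations between the classes of the sections
of `E` to `K` which sends relations to their primitives, formal linear combinations of sections to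
their cocycles, and which is compatible with products. -/
def toTotal (U : C) : RelKoszul (A.obj.obj (op U)) (s.cls U) →ₗ[A.obj.obj (op U)] K.Total U :=
  KoszulModule.toModule ((K.opEnd 0 U).comp (s.pot U)) ((K.opEnd 1 U).comp (s.cyc U))
    (fun _ _ _ => CDGA.opEnd_zero_comm _ _ _) (fun _ _ => CDGA.opEnd_one_self (h2 _) _ _)
    (Pi.single 0 (K.one.eval (op U)))

/-- The component of degree `p` of `toTotal`. -/
def toComp (p : ℤ) (U : C) : RelKoszul (A.obj.obj (op U)) (s.cls U) →ₗ[A.obj.obj (op U)]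
    (K.K.X p).val.obj (op U) :=
  (LinearMap.proj p).comp (s.toTotal h2 U)

lemma toComp_one (U : C) : s.toComp h2 0 U (SymTensor.mk (A.obj.obj (op U)) 0 1) =
    K.one.eval (op U) := by
  have h := KoszulModule.toModule_mk_one ((K.opEnd 0 U).comp (s.pot U))
    ((K.opEnd 1 U).comp (s.cyc U)) (fun _ _ _ => CDGA.opEnd_zero_comm _ _ _)
    (fun _ _ => CDGA.opEnd_one_self (h2 _) _ _)
    (Pi.single 0 (K.one.eval (op U)) : K.Total U)
  exact (congrFun h 0).trans (Pi.single_eq_same (M := fun p : ℤ => (K.K.X p).val.obj (op U)) 0 _)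

lemma toComp_one_of_ne {p : ℤ} (hp : p ≠ 0) (U : C) :
    s.toComp h2 p U (SymTensor.mk (A.obj.obj (op U)) 0 1) = 0 := by
  have h := KoszulModule.toModule_mk_one ((K.opEnd 0 U).comp (s.pot U))
    ((K.opEnd 1 U).comp (s.cyc U)) (fun _ _ _ => CDGA.opEnd_zero_comm _ _ _)
    (fun _ _ => CDGA.opEnd_one_self (h2 _) _ _)
    (Pi.single 0 (K.one.eval (op U)) : K.Total U)
  exact (congrFun h p).trans
    (Pi.single_eq_of_ne (M := fun p : ℤ => (K.K.X p).val.obj (op U)) hp _)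

lemma toComp_mulL (p : ℤ) {U : C} (l : Rel (A.obj.obj (op U)) (s.cls U))
    (x : RelKoszul (A.obj.obj (op U)) (s.cls U)) :
    s.toComp h2 p U (SymTensor.mulL l x) =
      K.mul 0 p p (zero_add p) (s.pot U l) (s.toComp h2 p U x) := by
  have h := KoszulModule.toModule_mulL ((K.opEnd 0 U).comp (s.pot U))
    ((K.opEnd 1 U).comp (s.cyc U)) (fun _ _ _ => CDGA.opEnd_zero_comm _ _ _)
    (fun _ _ => CDGA.opEnd_one_self (h2 _) _ _)
    (Pi.single 0 (K.one.eval (op U)) : K.Total U) l x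
  exact (congrFun h p).trans (CDGA.opEnd_apply (zero_add p) _ _)

lemma toComp_wedge {p q : ℤ} (hpq : 1 + q = p) {U : C}
    (v : s.E.val.obj (op U) →₀ A.obj.obj (op U))
    (x : RelKoszul (A.obj.obj (op U)) (s.cls U)) :
    s.toComp h2 p U
      (SymTensor.mapN (KoszulModule.wedgeEnd (R := A.obj.obj (op U)) v) x) =
      K.mul 1 q p hpq (s.cyc U v) (s.toComp h2 q U x) := by
  have h := KoszulModule.toModule_wedge ((K.opEnd 0 U).comp (s.pot U))
    ((K.opEnd 1 U).comp (s.cyc U)) (fun _ _ _ => CDGA.opEnd_zero_comm _ _ _)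
    (fun _ _ => CDGA.opEnd_one_self (h2 _) _ _)
    (Pi.single 0 (K.one.eval (op U)) : K.Total U)
    (fun _ _ _ => CDGA.opEnd_zero_comm _ _ _) v x
  exact (congrFun h p).trans (CDGA.opEnd_apply hpq _ _)

-- Unification problems about values of `toComp` must not be attacked by unfolding the quotient
-- that defines the Koszul complex.
attribute [irreducible] toComp

lemma d_toComp {U : C} (x : RelKoszul (A.obj.obj (op U)) (s.cls U)) (p q : ℤ) (h : p + 1 = q) :
    sec (K.K.d p q).val U (s.toComp h2 p U x) =
      s.toComp h2 q U (relD (A.obj.obj (op U)) (s.cls U) x) := by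
  induction x using KoszulModule.induction_wedge_mulL generalizing p q with
  | hadd x y hx hy =>
    simp only [map_add, hx p q h, hy p q h]
  | hsmul r =>
    simp only [map_smul, relD_mk_zero, map_zero, smul_zero]
    by_cases hp : p = 0
    · subst hp
      obtain rfl : q = 1 := by lia
      rw [toComp_one]
      exact (congrArg _ (K.d_one (op U))).trans (smul_zero _)
    · rw [toComp_one_of_ne _ _ hp, map_zero, smul_zero]
  | hwedge v x hx =>
    have hp : 1 + (p - 1) = p := by lia
    have hp' : p - 1 + 1 = p := by lia
    have hq : 1 + p = q := by lia
    have e1 := s.toComp_wedge h2 hp v x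
    have e2 := s.toComp_wedge h2 hq v (relD (A.obj.obj (op U)) (s.cls U) x)
    have e3 := congrArg (fun y => (1 : ℤ).negOnePow • K.mul 1 p q hq (s.cyc U v) y)
      (hx (p - 1) p hp')
    have h3 := CDGA.d_mul_of_d_eq_zero hp hp' h hq (p' := 2) rfl (s.cyc U v) (s.d_cyc v)
      (s.toComp h2 (p - 1) U x)
    have h4 : ∀ y : (K.K.X q).val.obj (op U), (1 : ℤ).negOnePow • y = -y := fun y => by
      rw [Int.negOnePow_one, Units.neg_smul, one_smul]
    have h5 := (congrArg (s.toComp h2 q U) (relD_wedge v x)).trans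
      (LinearMap.map_neg (s.toComp h2 q U) _)
    exact (congrArg (sec (K.K.d p q).val U) e1).trans (h3.trans
      (e3.trans ((h4 _).trans ((congrArg Neg.neg e2.symm).trans h5.symm))))
  | hmul l x hx =>
    have hq : 1 + p = q := by lia
    have hp' : 0 + p = p := zero_add p
    have hq' : 0 + q = q := zero_add q
    have e1 := s.toComp_mulL h2 p l x
    have e2 := s.toComp_wedge h2 hq (Rel.incl _ _ l) x
    have e3 := s.toComp_mulL h2 q l (relD (A.obj.obj (op U)) (s.cls U) x)
    have e4 := congrArg (K.mul 0 q q hq' (s.pot U l)) (hx p q h)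
    have h3 := (K.leibniz 0 p p 1 q q hp' rfl h h (s.pot U l) (s.toComp h2 p U x)).trans
      (add_comm _ _)
    have h4 : ∀ y : (K.K.X q).val.obj (op U), (0 : ℤ).negOnePow • y = y := fun y => by
      rw [Int.negOnePow_zero, one_smul]
    have e5 := congrArg (fun z => K.mul 1 p q hq z (s.toComp h2 p U x)) (s.d_pot l)
    have h5 := (congrArg (s.toComp h2 q U) (relD_mulL l x)).trans
      (LinearMap.map_add (s.toComp h2 q U) _ _)
    exact (congrArg (sec (K.K.d p q).val U) e1).trans (h3.trans
      ((congrArg₂ (· + ·) ((h4 _).trans (e4.trans e3.symm)) (e5.trans e2.symm)).trans h5.symm))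

/-- The restriction maps of the Koszul complexes of relations. -/
def koszulRes {U V : C} (f : V ⟶ U) : RelKoszul (A.obj.obj (op U)) (s.cls U) →ₛₗ[resRing A f]
    RelKoszul (A.obj.obj (op V)) (s.cls V) :=
  relKoszulMap (res (K.K.homology 1).val f) (res s.E.val f) (s.res_cls f)

lemma res_toComp {U V : C} (f : V ⟶ U) (x : RelKoszul (A.obj.obj (op U)) (s.cls U)) (p : ℤ) :
    res (K.K.X p).val f (s.toComp h2 p U x) = s.toComp h2 p V (s.koszulRes f x) := by
  induction x using KoszulModule.induction_wedge_mulL generalizing p with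
  | hadd x y hx hy =>
    simp only [map_add, hx, hy]
  | hsmul r =>
    have h1 : s.koszulRes f (SymTensor.mk (A.obj.obj (op U)) 0 1) =
        SymTensor.mk (A.obj.obj (op V)) 0 1 := relKoszulMap_mk_one _ _ _
    have h3 : res (K.K.X p).val f (s.toComp h2 p U (SymTensor.mk (A.obj.obj (op U)) 0 1)) =
        s.toComp h2 p V (SymTensor.mk (A.obj.obj (op V)) 0 1) := by
      by_cases hp : p = 0
      · subst hp
        rw [toComp_one, toComp_one]
        exact PresheafOfModules.sections_property K.one f.op
      · rw [toComp_one_of_ne _ _ hp, toComp_one_of_ne _ _ hp, map_zero]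
    have e1 := (congrArg (res (K.K.X p).val f) (LinearMap.map_smul (s.toComp h2 p U) r
      (SymTensor.mk (A.obj.obj (op U)) 0 1))).trans (LinearMap.map_smulₛₗ (res (K.K.X p).val f) r _)
    have e2 := (congrArg (s.toComp h2 p V) (LinearMap.map_smulₛₗ (s.koszulRes f) r
      (SymTensor.mk (A.obj.obj (op U)) 0 1))).trans (LinearMap.map_smul (s.toComp h2 p V) _ _)
    exact e1.trans ((congrArg (resRing A f r • ·)
      (h3.trans (congrArg (s.toComp h2 p V) h1).symm)).trans e2.symm)
  | hwedge v x hx =>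
    have hp : 1 + (p - 1) = p := by lia
    have h1 := relKoszulMap_wedge (res (K.K.homology 1).val f) (res s.E.val f) (s.res_cls f) v x
    have e1 := s.toComp_wedge h2 hp v x
    have e2 := s.toComp_wedge h2 hp (freeMap (resRing A f) (res s.E.val f) v) (s.koszulRes f x)
    have e3 := K.map_mul 1 (p - 1) p hp f.op (s.cyc U v) (s.toComp h2 (p - 1) U x)
    exact (congrArg (res (K.K.X p).val f) e1).trans (e3.trans
      ((congrArg₂ (K.mul 1 (p - 1) p hp) (s.res_cyc f v) (hx (p - 1))).trans
        (e2.symm.trans (congrArg (s.toComp h2 p V) h1.symm))))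
  | hmul l x hx =>
    have h1 := relKoszulMap_mulL (res (K.K.homology 1).val f) (res s.E.val f) (s.res_cls f) l x
    have e1 := s.toComp_mulL h2 p l x
    have e2 := s.toComp_mulL h2 p (relMap (res (K.K.homology 1).val f) (res s.E.val f)
      (s.res_cls f) l) (s.koszulRes f x)
    have e3 := K.map_mul 0 p p (zero_add p) f.op (s.pot U l) (s.toComp h2 p U x)
    exact (congrArg (res (K.K.X p).val f) e1).trans (e3.trans
      ((congrArg₂ (K.mul 0 p p (zero_add p)) (s.res_pot f l) (hx p)).trans
        (e2.symm.trans (congrArg (s.toComp h2 p V) h1.symm))))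

lemma toComp_ιMulti {U : C} {q : ℕ} (v : Fin q → s.E.val.obj (op U) →₀ A.obj.obj (op U)) :
    s.toComp h2 q U (SymTensor.mk (A.obj.obj (op U)) 0
      (ExteriorAlgebra.ιMulti (A.obj.obj (op U)) q v)) = K.prod q fun i => s.cyc U (v i) := by
  induction q with
  | zero =>
    rw [ExteriorAlgebra.ιMulti_zero_apply]
    exact s.toComp_one h2 U
  | succ q ih =>
    have h1 : SymTensor.mk (A.obj.obj (op U)) (0 : Multiset (Rel (A.obj.obj (op U)) (s.cls U)))
        (ExteriorAlgebra.ιMulti (A.obj.obj (op U)) (q + 1) v) =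
        SymTensor.mapN (KoszulModule.wedgeEnd (R := A.obj.obj (op U)) (v 0))
          (SymTensor.mk (A.obj.obj (op U)) 0
            (ExteriorAlgebra.ιMulti (A.obj.obj (op U)) q fun i => v i.succ)) := by
      rw [SymTensor.mapN_mk, ExteriorAlgebra.ιMulti_succ_apply]
      rfl
    rw [h1, s.toComp_wedge h2 (q := (q : ℤ)) (by push_cast; ring), ih, ← CDGA.prod_cons]
    congr 1
    funext i
    induction i using Fin.cases <;> rfl

end Map

end Splitting

end ToAlgebra

noncomputable section SheafComplex

open Opposite Limits

variable {C : Type u} [SmallCategory C] {J : GrothendieckTopology C}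
  {A : Sheaf J CommRingCat.{u}}

/-! ### Complexes of sheaves associated with complexes of presheaves -/

lemma hom_ext_toSh {P : PreMod A} {M : Mod A} {φ ψ : (sheafify A).obj P ⟶ M}
    (h : ∀ (U : C) (x : P.obj (op U)),
      sec φ.val U (sec (toSh P) U x) = sec ψ.val U (sec (toSh P) U x)) : φ = ψ := by
  ext1
  refine hom_ext_sec fun U y => eq_of_locally M ((locally_eq_toSh P y).mono ?_)
  rintro V f ⟨x, hx⟩
  rw [← sec_res, ← sec_res, ← hx, h]

lemma sheafify_map_zero (P Q : PreMod A) : (sheafify A).map (0 : P ⟶ Q) = 0 :=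
  hom_ext_toSh fun U x => (sheafify_map_toSh _ x).trans (map_zero (sec (toSh Q) U))

/-- The complex of sheaves of modules associated with a complex of presheaves of modules. -/
def shComplex (P : CochainComplex (PreMod A) ℤ) : CochainComplex (Mod A) ℤ where
  X p := (sheafify A).obj (P.X p)
  d p q := (sheafify A).map (P.d p q)
  shape p q h := by rw [P.shape p q h, sheafify_map_zero]
  d_comp_d' p q r _ _ := by rw [← Functor.map_comp, P.d_comp_d, sheafify_map_zero]

variable {P : CochainComplex (PreMod A) ℤ}

/-- The local section of the associated complex given by a local section of `P`. -/
abbrev ιSh (P : CochainComplex (PreMod A) ℤ) (p : ℤ) (U : C) :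
    (P.X p).obj (op U) →ₗ[A.obj.obj (op U)] ((shComplex P).X p).val.obj (op U) :=
  sec (toSh (P.X p)) U

lemma d_ιSh {p q : ℤ} {U : C} (x : (P.X p).obj (op U)) :
    sec ((shComplex P).d p q).val U (ιSh P p U x) = ιSh P q U (sec (P.d p q) U x) :=
  sheafify_map_toSh _ x

lemma res_ιSh {p : ℤ} {U V : C} (f : V ⟶ U) (x : (P.X p).obj (op U)) :
    res _ f (ιSh P p U x) = ιSh P p V (res (P.X p) f x) :=
  (sec_res (toSh (P.X p)) f x).symm

lemma locally_eq_ιSh (P : CochainComplex (PreMod A) ℤ) (p : ℤ) {U : C}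
    (y : ((shComplex P).X p).val.obj (op U)) :
    Locally J U fun V f => ∃ x : (P.X p).obj (op V),
      ιSh P p V x = res ((shComplex P).X p).val f y :=
  locally_eq_toSh (P.X p) y

lemma locally_d_eq_zero_of_d_ιSh {p q : ℤ} {U : C} (x : (P.X p).obj (op U))
    (hx : sec ((shComplex P).d p q).val U (ιSh P p U x) = 0) :
    Locally J U fun V f => sec (P.d p q) V (res (P.X p) f x) = 0 :=
  (locally_eq_zero_of_toSh _ _ ((d_ιSh x).symm.trans hx)).mono fun _ _ hf =>
    (sec_res _ _ _).trans hf

/-- Locally, a cocycle of the associated complex comes from a cocycle of `P`. -/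
lemma locally_exists_d_eq_zero {p q : ℤ} {U : C} (y : ((shComplex P).X p).val.obj (op U))
    (hy : sec ((shComplex P).d p q).val U y = 0) :
    Locally J U fun V f => ∃ x : (P.X p).obj (op V), sec (P.d p q) V x = 0 ∧
      ιSh P p V x = res ((shComplex P).X p).val f y := by
  refine (locally_eq_ιSh P p y).bind ?_
  rintro V f ⟨x, hx⟩
  have h1 : sec ((shComplex P).d p q).val V (ιSh P p V x) = 0 := by
    rw [hx, sec_res, hy, map_zero]
  refine (locally_d_eq_zero_of_d_ιSh x h1).mono fun W g hg => ⟨_, hg, ?_⟩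
  rw [← res_ιSh, hx, ← res_comp]

lemma isZero_homology_shComplex (p q r : ℤ) (hpq : p + 1 = q) (hqr : q + 1 = r)
    (h : ∀ (U : C) (x : (P.X q).obj (op U)), sec (P.d q r) U x = 0 →
      Locally J U fun V f => ∃ y : (P.X p).obj (op V), sec (P.d p q) V y = res _ f x) :
    IsZero ((shComplex P).homology q) := by
  refine isZero_homology_of_locally _ p q r hpq hqr fun U x hx => ?_
  refine (locally_exists_d_eq_zero x hx).bind ?_
  rintro V f ⟨x', hd, hx'⟩
  refine (h V x' hd).mono ?_
  rintro W g ⟨y, hy⟩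
  refine ⟨ιSh P p W y, (d_ιSh y).trans ?_⟩
  rw [hy, ← res_ιSh, hx', ← res_comp]

lemma isIso_homologyMap_shComplex {L : CochainComplex (Mod A) ℤ} (φ : shComplex P ⟶ L)
    (p q r : ℤ) (hpq : p + 1 = q) (hqr : q + 1 = r)
    (hinj : ∀ (U : C) (t : (P.X q).obj (op U)) (l : (L.X p).val.obj (op U)),
      sec (P.d q r) U t = 0 → sec (φ.f q).val U (ιSh P q U t) = sec (L.d p q).val U l →
      Locally J U fun V f => ∃ y : (P.X p).obj (op V), sec (P.d p q) V y = res _ f t)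
    (hsurj : ∀ (U : C) (x : (L.X q).val.obj (op U)), sec (L.d q r).val U x = 0 →
      Locally J U fun V f => ∃ (t : (P.X q).obj (op V)) (l : (L.X p).val.obj (op V)),
        sec (P.d q r) V t = 0 ∧
          res _ f x = sec (φ.f q).val V (ιSh P q V t) + sec (L.d p q).val V l) :
    IsIso (HomologicalComplex.homologyMap φ q) := by
  refine isIso_homologyMap_of_locally φ p q r hpq hqr (fun U x l hx hl => ?_) fun U x hx => ?_
  · refine (locally_exists_d_eq_zero x hx).bind ?_
    rintro V f ⟨x', hd, hx'⟩
    refine (hinj V x' (res _ f l) hd ?_).mono ?_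
    · rw [hx', sec_res, sec_res, hl]
    · rintro W g ⟨y, hy⟩
      refine ⟨ιSh P p W y, (d_ιSh y).trans ?_⟩
      rw [hy, ← res_ιSh, hx', ← res_comp]
  · refine (hsurj U x hx).mono ?_
    rintro V f ⟨t, l, ht, hl⟩
    exact ⟨ιSh P q V t, l, (d_ιSh t).trans ((congrArg _ ht).trans (map_zero _)), hl⟩

namespace Splitting

/-! ### The sheaf of Koszul complexes -/

variable {K : CDGA A} (s : Splitting K)

/-- The part `Sym^{i-p}(R) ⊗ Λ^p(F)` of the Koszul complex over `U`, with `F` the free module on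
the sections of `E` and `R` the module of relations between their classes. -/
abbrev koszulGr (i p : ℤ) (U : C) : Submodule (A.obj.obj (op U))
    (RelKoszul (A.obj.obj (op U)) (s.cls U)) :=
  KoszulModule.gr (A.obj.obj (op U)) (Rel (A.obj.obj (op U)) (s.cls U))
    (s.E.val.obj (op U) →₀ A.obj.obj (op U)) (i - p) p

lemma koszulRes_mem {i p : ℤ} {U V : C} (f : V ⟶ U)
    {x : RelKoszul (A.obj.obj (op U)) (s.cls U)} (hx : x ∈ s.koszulGr i p U) :
    s.koszulRes f x ∈ s.koszulGr i p V :=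
  KoszulModule.map_mem _ _ hx

lemma koszulRes_id {U : C} (x : RelKoszul (A.obj.obj (op U)) (s.cls U)) :
    s.koszulRes (𝟙 U) x = x := by
  refine KoszulModule.map_id _ _ resRing_id_apply (fun l => ?_)
    (freeMap_id _ resRing_id_apply (res_id _)) x
  apply Rel.incl_injective
  exact (incl_relMap _ _ _ l).trans (freeMap_id _ resRing_id_apply (res_id _) _)

lemma koszulRes_comp {U V W : C} (f : V ⟶ U) (g : W ⟶ V)
    (x : RelKoszul (A.obj.obj (op U)) (s.cls U)) :
    s.koszulRes (g ≫ f) x = s.koszulRes g (s.koszulRes f x) := by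
  have hF := freeMap_freeMap (ρ := resRing A f) (ρ' := resRing A g) (ρ'' := resRing A (g ≫ f))
    (res s.E.val f) (res s.E.val g) (res s.E.val (g ≫ f))
    (fun r => (resRing_comp_apply f g r).symm) (fun a => (res_comp _ f g a).symm)
  refine (KoszulModule.map_map _ _ _ _ _ _ (fun r => (resRing_comp_apply f g r).symm)
    (fun l => ?_) hF x).symm
  apply Rel.incl_injective
  refine (incl_relMap _ _ _ _).trans (Eq.trans ?_ (incl_relMap _ _ _ _).symm)
  rw [incl_relMap]
  exact hF _

lemma koszulRes_relD {U V : C} (f : V ⟶ U) (x : RelKoszul (A.obj.obj (op U)) (s.cls U)) :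
    s.koszulRes f (relD (A.obj.obj (op U)) (s.cls U) x) =
      relD (A.obj.obj (op V)) (s.cls V) (s.koszulRes f x) :=
  relKoszulMap_relD _ _ _ x

lemma relD_mem {i p q : ℤ} (h : p + 1 = q) {U : C}
    {x : RelKoszul (A.obj.obj (op U)) (s.cls U)} (hx : x ∈ s.koszulGr i p U) :
    relD (A.obj.obj (op U)) (s.cls U) x ∈ s.koszulGr i q U := by
  subst h
  have h1 := KoszulModule.d_mem (Rel.incl (A.obj.obj (op U)) (s.cls U)) hx
  rwa [show i - p - 1 = i - (p + 1) by lia] at h1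

/-- The presheaf `U ↦ Sym^{i-p}(R(U)) ⊗ Λ^p(F(U))`. -/
def koszulPre (i p : ℤ) : PreMod A :=
  mkPreMod (fun U => s.koszulGr i p U)
    (fun f =>
      { toFun := fun x => ⟨s.koszulRes f x, s.koszulRes_mem f x.2⟩
        map_add' := fun x y => Subtype.ext (LinearMap.map_add (s.koszulRes f) x.1 y.1)
        map_smul' := fun a x => Subtype.ext (LinearMap.map_smulₛₗ (s.koszulRes f) a x.1) })
    (fun x => Subtype.ext (s.koszulRes_id x.1))
    (fun f g x => Subtype.ext (s.koszulRes_comp f g x.1))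

/-- A section of `koszulPre` is an element of the Koszul complex. -/
def koszulVal (i p : ℤ) (U : C) : (s.koszulPre i p).obj (op U) →ₗ[A.obj.obj (op U)]
    RelKoszul (A.obj.obj (op U)) (s.cls U) :=
  (s.koszulGr i p U).subtype

/-- The section of `koszulPre` given by an element of the Koszul complex. -/
def koszulMk {i p : ℤ} {U : C} (x : RelKoszul (A.obj.obj (op U)) (s.cls U))
    (hx : x ∈ s.koszulGr i p U) : (s.koszulPre i p).obj (op U) :=
  (⟨x, hx⟩ : s.koszulGr i p U)

lemma koszulVal_mem {i p : ℤ} {U : C} (x : (s.koszulPre i p).obj (op U)) :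
    s.koszulVal i p U x ∈ s.koszulGr i p U :=
  Subtype.property (p := (· ∈ s.koszulGr i p U)) x

lemma koszulVal_injective {i p : ℤ} {U : C} : Function.Injective (s.koszulVal i p U) :=
  Subtype.val_injective

/-- The differential `Sym^{i-p}(R) ⊗ Λ^p(F) ⟶ Sym^{i-p-1}(R) ⊗ Λ^{p+1}(F)`. -/
def koszulD (i p q : ℤ) (h : p + 1 = q) : s.koszulPre i p ⟶ s.koszulPre i q :=
  mkHom (fun U => ((relD (A.obj.obj (op U)) (s.cls U)).comp (s.koszulVal i p U)).codRestrict
      (s.koszulGr i q U) fun x => s.relD_mem h (s.koszulVal_mem x))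
    (fun f _ => s.koszulVal_injective (s.koszulRes_relD f _).symm)

lemma koszulVal_koszulD {i p q : ℤ} (h : p + 1 = q) {U : C} (x : (s.koszulPre i p).obj (op U)) :
    s.koszulVal i q U (sec (s.koszulD i p q h) U x) =
      relD (A.obj.obj (op U)) (s.cls U) (s.koszulVal i p U x) := rfl

lemma relD_relD {U : C} (x : RelKoszul (A.obj.obj (op U)) (s.cls U)) :
    relD (A.obj.obj (op U)) (s.cls U) (relD (A.obj.obj (op U)) (s.cls U) x) = 0 :=
  KoszulModule.d_d _ x

/-- The complex of presheaves `Sym^{i-p}(R) ⊗ Λ^p(F)`, for `p ∈ ℤ`. -/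
def koszulComplex (i : ℤ) : CochainComplex (PreMod A) ℤ where
  X p := s.koszulPre i p
  d p q := if h : p + 1 = q then s.koszulD i p q h else 0
  shape p q h := dif_neg h
  d_comp_d' p q r hpq hqr := by
    rw [dif_pos (show p + 1 = q from hpq), dif_pos (show q + 1 = r from hqr)]
    refine hom_ext_sec fun U x => s.koszulVal_injective ?_
    exact s.relD_relD _

lemma koszulVal_d {i p q : ℤ} (h : p + 1 = q) {U : C}
    (x : ((s.koszulComplex i).X p).obj (op U)) :
    s.koszulVal i q U (sec ((s.koszulComplex i).d p q) U x) =
      relD (A.obj.obj (op U)) (s.cls U) (s.koszulVal i p U x) := by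
  have h1 : (s.koszulComplex i).d p q = s.koszulD i p q h := dif_pos h
  rw [h1]
  exact s.koszulVal_koszulD h x

section

variable (h2 : ∀ U : Cᵒᵖ, IsUnit (2 : A.obj.obj U))

/-- The map from the presheaf `Sym^{i-p}(R) ⊗ Λ^p(F)` to `K^p`. -/
def koszulToComp (i p : ℤ) : s.koszulPre i p ⟶ (K.K.X p).val :=
  mkHom (fun U => (s.toComp h2 p U).comp (s.koszulVal i p U)) (fun f x =>
    (s.res_toComp h2 f (s.koszulVal i p _ x) p).symm)

/-- The morphism from the sheafified Koszul complex to `K`. -/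
def koszulHom (i : ℤ) : shComplex (s.koszulComplex i) ⟶ K.K where
  f p := liftSh (s.koszulToComp h2 i p)
  comm' p q hpq := by
    refine hom_ext_toSh fun U x => ?_
    have h1 := sec_liftSh (s.koszulToComp h2 i p) x
    have h3 := d_ιSh (P := s.koszulComplex i) (q := q) x
    have h4 := sec_liftSh (s.koszulToComp h2 i q) (sec ((s.koszulComplex i).d p q) U x)
    have h5 := s.d_toComp h2 (s.koszulVal i p U x) p q hpq
    have h6 := congrArg (s.toComp h2 q U) (s.koszulVal_d hpq x)
    exact (congrArg (sec (K.K.d p q).val U) h1).trans (h5.trans (h6.symm.trans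
      (h4.symm.trans (congrArg (sec (liftSh (s.koszulToComp h2 i q)).val U) h3.symm))))

lemma koszulHom_ιSh (i p : ℤ) {U : C} (x : (s.koszulPre i p).obj (op U)) :
    sec ((s.koszulHom h2 i).f p).val U (ιSh (s.koszulComplex i) p U x) =
      s.toComp h2 p U (s.koszulVal i p U x) :=
  sec_liftSh (s.koszulToComp h2 i p) x

end

end Splitting

end SheafComplex

/-! ### Exactness of the sheaf of Koszul complexes -/

lemma natCast_mul_inverse_factorial {R : Type*} [CommRing R] {N : ℕ}
    (hN : IsUnit ((N.factorial : ℕ) : R)) {a : ℕ} (ha : a + 1 ≤ N) :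
    ((a + 1 : ℕ) : R) * Ring.inverse (((a + 1).factorial : ℕ) : R) =
      Ring.inverse ((a.factorial : ℕ) : R) := by
  have h1 : IsUnit (((a + 1).factorial : ℕ) : R) :=
    isUnit_of_dvd_unit (Nat.cast_dvd_cast (Nat.factorial_dvd_factorial ha)) hN
  have h2 : IsUnit ((a.factorial : ℕ) : R) :=
    isUnit_of_dvd_unit (Nat.cast_dvd_cast (Nat.factorial_dvd_factorial (Nat.le_succ a))) h1
  refine h2.mul_left_cancel ?_
  rw [Ring.mul_inverse_cancel _ h2, ← mul_assoc, mul_comm ((a.factorial : ℕ) : R), ← Nat.cast_mul,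
    ← Nat.factorial_succ, Ring.mul_inverse_cancel _ h1]

noncomputable section Exactness

open Opposite Limits

variable {C : Type u} [SmallCategory C] {J : GrothendieckTopology C}
  {A : Sheaf J CommRingCat.{u}} {K : CDGA A} (s : Splitting K)

namespace Splitting

lemma mem_koszulGr_iff {i p j : ℤ} (h : i - p = j) {U : C}
    {x : RelKoszul (A.obj.obj (op U)) (s.cls U)} :
    x ∈ s.koszulGr i p U ↔ x ∈ KoszulModule.gr (A.obj.obj (op U))
      (Rel (A.obj.obj (op U)) (s.cls U)) (s.E.val.obj (op U) →₀ A.obj.obj (op U)) j p := by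
  subst h
  rfl

lemma isZero_homology_koszulComplex_of_lt (i p : ℤ) (hp : p < 0 ∨ i < p) :
    IsZero ((shComplex (s.koszulComplex i)).homology p) := by
  refine isZero_homology_shComplex (p - 1) p (p + 1) (by lia) rfl fun U x _ => ?_
  have h1 : s.koszulVal i p U x = 0 := by
    rcases hp with hp | hp
    · exact KoszulModule.gr_neg_right hp (s.koszulVal_mem x)
    · exact KoszulModule.gr_neg_left (by lia) (s.koszulVal_mem x)
  have h2 : x = 0 := s.koszulVal_injective (h1.trans (map_zero (s.koszulVal i p U)).symm)
  refine Locally.of_forall fun V f => ⟨0, ?_⟩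
  rw [h2, map_zero, map_zero]

lemma linearCombination_rel {U : C} (l : Rel (A.obj.obj (op U)) (s.cls U))
    (D : Finset (s.E.val.obj (op U))) (hD : (Rel.incl _ _ l).support ⊆ D) :
    ∑ a : D, Rel.incl (A.obj.obj (op U)) (s.cls U) l a • s.cls U a = 0 := by
  rw [Finset.sum_coe_sort D fun a => Rel.incl (A.obj.obj (op U)) (s.cls U) l a • s.cls U a]
  refine Eq.trans ?_ (Rel.linearCombination_incl (s.cls U) l)
  rw [Finsupp.linearCombination_apply, Finsupp.sum_of_support_subset _ hD]
  simp

/-- A finite set of sections of a flat `H^1(K)` can locally be expressed in terms of classes of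
sections of `E` in such a way that given relations between them become trivial. -/
lemma locally_exists_trivialization (hflat : IsFlat (K.K.homology 1)) {U : C}
    (S : Finset (Rel (A.obj.obj (op U)) (s.cls U))) (D : Finset (s.E.val.obj (op U)))
    (hD : ∀ l ∈ S, (Rel.incl _ _ l).support ⊆ D) :
    Locally J U fun V f => ∃ (k : ℕ) (e : Fin k → s.E.val.obj (op V))
      (G : s.E.val.obj (op U) → Fin k → A.obj.obj (op V)),
      (∀ a ∈ D, res (K.K.homology 1).val f (s.cls U a) = ∑ c, G a c • s.cls V (e c)) ∧
        ∀ l ∈ S, ∀ c, ∑ a ∈ D, resRing A f (Rel.incl _ _ l a) * G a c = 0 := by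
  classical
  refine (locally_exists_of_isFlat hflat (fun a : D => s.cls U a) S
    (fun l a => Rel.incl (A.obj.obj (op U)) (s.cls U) l a)
    fun l hl => s.linearCombination_rel l D (hD l hl)).bind ?_
  rintro V f ⟨k, y, g, hy, hg⟩
  have := s.epi
  refine (Locally.forall_fintype fun c =>
    locally_exists_of_epi (s.lift ≫ K.K.homologyπ 1) (y c)).mono ?_
  intro W g' h1
  choose e he using h1
  refine ⟨k, e, fun a c => if h : a ∈ D then resRing A g' (g ⟨a, h⟩ c) else 0, ?_, ?_⟩
  · intro a ha
    simp only [ha, dite_true]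
    rw [res_comp, hy ⟨a, ha⟩, map_sum]
    refine Finset.sum_congr rfl fun c _ => ?_
    rw [LinearMap.map_smulₛₗ, ← he c]
    rfl
  · intro l hl c
    rw [← Finset.sum_coe_sort D]
    simp only [Finset.coe_mem, dite_true, resRing_comp_apply]
    simp only [← map_mul, ← map_sum]
    rw [hg l hl c, map_zero]

/-- The Koszul complex of weight `i` is exact in degree `p < i` when `i - p` and, if `p ≠ 0`,
`i - p + 1`, together with all smaller positive integers, are invertible. -/
lemma isZero_homology_koszulComplex (hflat : IsFlat (K.K.homology 1)) (i p : ℤ) (n : ℕ)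
    (hn : (n : ℤ) + 1 = i - p) (N : ℕ) (hN : ∀ U : Cᵒᵖ, IsUnit ((N.factorial : ℕ) : A.obj.obj U))
    (h1 : n + 1 ≤ N) (h2 : p = 0 ∨ n + 2 ≤ N) :
    IsZero ((shComplex (s.koszulComplex i)).homology p) := by
  classical
  have hp : p - 1 + 1 = p := by lia
  have hn2 : i - (p - 1) = (n : ℤ) + 2 := by lia
  refine isZero_homology_shComplex (p - 1) p (p + 1) hp rfl fun U x hx => ?_
  have hx1 : s.koszulVal i p U x ∈ KoszulModule.gr (A.obj.obj (op U))
      (Rel (A.obj.obj (op U)) (s.cls U)) (s.E.val.obj (op U) →₀ A.obj.obj (op U)) (n + 1) p := by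
    exact (s.mem_koszulGr_iff hn.symm).1 (s.koszulVal_mem x)
  obtain ⟨y, hy, hxy⟩ := KoszulModule.exists_eq_sum_mulL (by lia) hx1
  have hd : relD (A.obj.obj (op U)) (s.cls U) (y.sum fun l z => SymTensor.mulL l z) = 0 := by
    rw [← hxy]
    refine (s.koszulVal_d rfl x).symm.trans ?_
    rw [hx]
    exact map_zero (s.koszulVal i (p + 1) U)
  let D : Finset (s.E.val.obj (op U)) := y.support.biUnion fun l => (Rel.incl _ _ l).support
  have hD : ∀ l ∈ y.support, (Rel.incl _ _ l).support ⊆ D := fun l hl =>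
    Finset.subset_biUnion_of_mem (fun l => (Rel.incl (A.obj.obj (op U)) (s.cls U) l).support) hl
  refine (s.locally_exists_trivialization hflat y.support D hD).mono ?_
  rintro V f ⟨k, e, G, hG, hl⟩
  obtain ⟨w, hw, hdw⟩ := exists_d_eq_map (res (K.K.homology 1).val f) (res s.E.val f)
    (s.res_cls f) (fun a => Ring.inverse ((a.factorial : ℕ) : A.obj.obj (op V)))
    (by simp) n (k := p) (fun a ha => natCast_mul_inverse_factorial (hN (op V)) (by lia))
    (h2.imp id fun h2 a ha => natCast_mul_inverse_factorial (hN (op V)) (by lia)) y hy hd D e G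
    hG hD hl
  have hw' : w ∈ s.koszulGr i (p - 1) V := (s.mem_koszulGr_iff hn2).2 hw
  refine ⟨s.koszulMk w hw', s.koszulVal_injective ?_⟩
  exact (s.koszulVal_d hp (s.koszulMk w hw')).trans
    (hdw.trans (congrArg (s.koszulRes f) hxy.symm))

end Splitting

end Exactness

/-! ### Exterior powers of `H^1(K)` -/

section ExteriorPower

variable {R : Type*} [CommRing R] {M : Type*} [AddCommGroup M] [Module R M]

lemma exteriorPower_induction {n : ℕ} {p : ⋀[R]^n M → Prop}
    (hι : ∀ v, p (_root_.exteriorPower.ιMulti R n v)) (hadd : ∀ x y, p x → p y → p (x + y))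
    (hsmul : ∀ (r : R) x, p x → p (r • x)) (x : ⋀[R]^n M) : p x := by
  have hx : x ∈ Submodule.span R (Set.range (_root_.exteriorPower.ιMulti R n (M := M))) := by
    rw [_root_.exteriorPower.ιMulti_span]
    trivial
  induction hx using Submodule.span_induction with
  | mem x hx => obtain ⟨v, rfl⟩ := hx; exact hι v
  | zero => simpa using hsmul 0 _ (hι 0)
  | add x y _ _ hx hy => exact hadd x y hx hy
  | smul r x _ hx => exact hsmul r x hx

lemma exists_of_forall_ιMulti {n : ℕ} {N N₁ N₂ : Type*} [AddCommGroup N] [Module R N]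
    [AddCommGroup N₁] [Module R N₁] [AddCommGroup N₂] [Module R N₂] (f₁ : N →ₗ[R] N₁)
    (f₂ : N →ₗ[R] N₂) (g₁ : ⋀[R]^n M →ₗ[R] N₁) (g₂ : ⋀[R]^n M →ₗ[R] N₂)
    (h : ∀ v, ∃ z, f₁ z = g₁ (_root_.exteriorPower.ιMulti R n v) ∧
      f₂ z = g₂ (_root_.exteriorPower.ιMulti R n v)) (w : ⋀[R]^n M) :
    ∃ z, f₁ z = g₁ w ∧ f₂ z = g₂ w := by
  induction w using exteriorPower_induction with
  | hι v => exact h v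
  | hadd x y hx hy =>
    obtain ⟨a, ha, ha'⟩ := hx
    obtain ⟨b, hb, hb'⟩ := hy
    exact ⟨a + b, by rw [map_add, ha, hb, map_add], by rw [map_add, ha', hb', map_add]⟩
  | hsmul r x hx =>
    obtain ⟨a, ha, ha'⟩ := hx
    exact ⟨r • a, by rw [map_smul, ha, map_smul], by rw [map_smul, ha', map_smul]⟩

variable {L : Type*} [AddCommGroup L] [Module R L]

lemma KoszulModule.exists_mk_eq {n : ℕ} {x : KoszulModule R L M} (hx : x ∈ gr R L M 0 n) :
    ∃ w : ⋀[R]^n M, SymTensor.mk R 0 (w : ExteriorAlgebra R M) = x := by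
  have h := map_mem_of_mk LinearMap.id ((⋀[R]^n M).map (SymTensor.mk (N := ExteriorAlgebra R M) R (0 : Multiset L))) ?_ hx
  · obtain ⟨w, hw, h⟩ := h
    exact ⟨⟨w, hw⟩, h⟩
  · intro s k v hs hk
    obtain rfl : k = n := by exact_mod_cast hk
    obtain rfl : s = 0 := by simpa using hs
    exact ⟨_, (_root_.exteriorPower.ιMulti R k v).2, rfl⟩

lemma KoszulModule.mk_mem {n : ℕ} (w : ⋀[R]^n M) :
    SymTensor.mk R 0 (w : ExteriorAlgebra R M) ∈ gr R L M 0 n := by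
  induction w using exteriorPower_induction with
  | hι v => exact mk_mem_gr 0 v
  | hadd x y hx hy => rw [Submodule.coe_add, map_add]; exact add_mem hx hy
  | hsmul r x hx => rw [Submodule.coe_smul, map_smul]; exact Submodule.smul_mem _ _ hx

end ExteriorPower

noncomputable section Top

open Opposite Limits

variable {C : Type u} [SmallCategory C] {J : GrothendieckTopology C}
  {A : Sheaf J CommRingCat.{u}} {K : CDGA A} (s : Splitting K)

/-- The element `h₁ ∧ ⋯ ∧ h_q` of the presheaf of exterior powers. -/
abbrev preWedge (H : PreMod A) {q : ℕ} {U : C} (h : Fin q → H.obj (op U)) :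
    (presheafExteriorPower H q).obj (op U) :=
  _root_.exteriorPower.ιMulti (A.obj.obj (op U)) q (M := H.obj (op U)) h

lemma res_preWedge (H : PreMod A) {q : ℕ} {U V : C} (f : V ⟶ U) (h : Fin q → H.obj (op U)) :
    res (presheafExteriorPower H q) f (preWedge H h) = preWedge H fun i => res H f (h i) :=
  ModuleCat.exteriorPower.desc_mk (R := A.obj.obj (op U)) (exteriorPowerAlt H q f.op) h

namespace Splitting

/-- The map induced by the classes of the sections of `E` on exterior powers. -/
def extCls (q : ℕ) (U : C) :
    (⋀[A.obj.obj (op U)]^q (s.E.val.obj (op U) →₀ A.obj.obj (op U))) →ₗ[A.obj.obj (op U)]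
      (presheafExteriorPower (K.K.homology 1).val q).obj (op U) :=
  _root_.exteriorPower.map q (Finsupp.linearCombination (A.obj.obj (op U)) (s.cls U))

lemma extCls_ιMulti {q : ℕ} {U : C}
    (v : Fin q → s.E.val.obj (op U) →₀ A.obj.obj (op U)) :
    s.extCls q U (_root_.exteriorPower.ιMulti _ q v) =
      preWedge (K.K.homology 1).val fun i => s.cls U (s.tot U (v i)) := by
  have h1 := _root_.exteriorPower.map_apply_ιMulti (n := q)
    (Finsupp.linearCombination (A.obj.obj (op U)) (s.cls U)) v
  refine h1.trans (congrArg (preWedge (K.K.homology 1).val) ?_)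
  funext i
  exact (s.cls_tot (v i)).symm

/-- The exterior algebra element underlying a section of the presheaf of exterior powers. -/
def powVal (H : PreMod A) (q : ℕ) (U : C) :
    (presheafExteriorPower H q).obj (op U) →ₗ[A.obj.obj (op U)]
      ExteriorAlgebra (A.obj.obj (op U)) (H.obj (op U)) :=
  (⋀[A.obj.obj (op U)]^q (H.obj (op U))).subtype

lemma powVal_res_extCls {q : ℕ} {U V : C} (f : V ⟶ U)
    (w : ⋀[A.obj.obj (op U)]^q (s.E.val.obj (op U) →₀ A.obj.obj (op U))) :
    powVal _ q V (res (presheafExteriorPower (K.K.homology 1).val q) f (s.extCls q U w)) =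
      ExteriorAlgebra.map (Finsupp.linearCombination (A.obj.obj (op V)) (s.cls V))
        (extMap (freeMap (resRing A f) (res s.E.val f)) w.1) := by
  induction w using exteriorPower_induction with
  | hι v =>
    have h1 := s.extCls_ιMulti v
    have h3 := res_preWedge (K.K.homology 1).val f fun i => s.cls U (s.tot U (v i))
    have h4 : extMap (freeMap (resRing A f) (res s.E.val f))
        (_root_.exteriorPower.ιMulti (A.obj.obj (op U)) q v).1 = _ :=
      extMap_ιMulti (freeMap (resRing A f) (res s.E.val f)) v
    have h5 := ExteriorAlgebra.map_apply_ιMulti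
      (Finsupp.linearCombination (A.obj.obj (op V)) (s.cls V))
      fun i => freeMap (resRing A f) (res s.E.val f) (v i)
    have h6 : (fun i => res (K.K.homology 1).val f (s.cls U (s.tot U (v i)))) =
        Finsupp.linearCombination (A.obj.obj (op V)) (s.cls V) ∘
          fun i => freeMap (resRing A f) (res s.E.val f) (v i) := by
      funext i
      rw [← res_cls, ← tot_freeMap, cls_tot]
      rfl
    have h7 := (congrArg (res (presheafExteriorPower (K.K.homology 1).val q) f) h1).trans
      (h3.trans (congrArg (preWedge (K.K.homology 1).val) h6))
    exact (congrArg (powVal (K.K.homology 1).val q V) h7).trans (h5.symm.trans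
      (congrArg (ExteriorAlgebra.map (Finsupp.linearCombination (A.obj.obj (op V)) (s.cls V)))
        h4.symm))
  | hadd x y hx hy =>
    simp only [map_add, Submodule.coe_add, hx, hy]
  | hsmul r x hx =>
    have h1 := (congrArg (res (presheafExteriorPower (K.K.homology 1).val q) f)
      (LinearMap.map_smul (s.extCls q U) r x)).trans (LinearMap.map_smulₛₗ _ _ _)
    have h3 := (congrArg (powVal (K.K.homology 1).val q V) h1).trans
      (LinearMap.map_smul _ _ _)
    refine h3.trans ?_
    rw [hx, Submodule.coe_smul, extMap_smul, map_smul]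

/-- Locally, sections of the presheaf of exterior powers of `H^1(K)` come from formal linear
combinations of sections of `E`. -/
lemma locally_exists_extCls_eq {q : ℕ} {U : C}
    (y : (presheafExteriorPower (K.K.homology 1).val q).obj (op U)) :
    Locally J U fun V f => ∃ w, s.extCls q V w = res _ f y := by
  induction y using exteriorPower_induction with
  | hι h =>
    have := s.epi
    refine (Locally.forall_fintype fun i =>
      locally_exists_of_epi (s.lift ≫ K.K.homologyπ 1) (h i)).mono fun V f hf => ?_
    choose e he using hf
    refine ⟨_root_.exteriorPower.ιMulti _ q fun i => Finsupp.single (e i) 1, ?_⟩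
    refine (s.extCls_ιMulti _).trans (Eq.trans ?_ (res_preWedge _ f h).symm)
    congr 1
    funext i
    rw [cls_tot, Finsupp.linearCombination_single, one_smul]
    exact he i
  | hadd x y hx hy =>
    refine (hx.and hy).mono ?_
    rintro V f ⟨⟨a, ha⟩, b, hb⟩
    refine ⟨a + b, ?_⟩
    rw [map_add, ha, hb]
    exact (map_add (res (presheafExteriorPower (K.K.homology 1).val q) f) _ _).symm
  | hsmul r x hx =>
    refine hx.mono ?_
    rintro V f ⟨a, ha⟩
    refine ⟨resRing A f r • a, ?_⟩
    rw [map_smul, ha]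
    exact (LinearMap.map_smulₛₗ (res (presheafExteriorPower (K.K.homology 1).val q) f) r _).symm

variable (h2 : ∀ U : Cᵒᵖ, IsUnit (2 : A.obj.obj U))

/-- The images in `K` of the elements of `Λ^q(F)` are cocycles, whose classes correspond to the
elements of `Λ^q H^1(K)` under the given isomorphism. -/
lemma exists_cycle_toComp {q : ℕ} (μ : exteriorPower (K.K.homology 1) q ⟶ K.K.homology q)
    (hμ : ∀ (U : Cᵒᵖ) (z : Fin q → (K.K.cycles 1).val.obj U),
      μ.val.app U (wedge (K.K.homology 1) fun i => K.cohomologyClass (z i)) =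
        K.cohomologyClass (K.cycleProd z)) {U : C}
    (w : ⋀[A.obj.obj (op U)]^q (s.E.val.obj (op U) →₀ A.obj.obj (op U))) :
    ∃ z : (K.K.cycles q).val.obj (op U),
      sec (K.K.iCycles q).val U z = s.toComp h2 q U (SymTensor.mk (A.obj.obj (op U)) 0 w.1) ∧
      sec (K.K.homologyπ q).val U z = sec μ.val U (sec (toSh _) U (s.extCls q U w)) := by
  refine exists_of_forall_ιMulti (sec (K.K.iCycles q).val U) (sec (K.K.homologyπ q).val U)
    ((s.toComp h2 q U).comp ((SymTensor.mk (A.obj.obj (op U)) 0).comp (Submodule.subtype _)))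
    ((sec μ.val U).comp ((sec (toSh _) U).comp (s.extCls q U))) (fun v =>
      ⟨K.cycleProd fun i => sec s.lift.val U (s.tot U (v i)), ?_, ?_⟩) w
  · exact (K.ofCycle_cycleProd _).trans (s.toComp_ιMulti h2 v).symm
  · refine (hμ (op U) fun i => sec s.lift.val U (s.tot U (v i))).symm.trans ?_
    exact congrArg (fun y => sec μ.val U (sec (toSh _) U y)) (s.extCls_ιMulti v).symm

end Splitting

end Top

/-! ### The Koszul complex computes the cohomology in its weight -/

lemma extMap_mem {R R' : Type*} [CommRing R] [CommRing R'] {ρ : R →+* R'} {F F' : Type*}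
    [AddCommGroup F] [Module R F] [AddCommGroup F'] [Module R' F'] (g : F →ₛₗ[ρ] F') {n : ℕ}
    (w : ⋀[R]^n F) : extMap g (w : ExteriorAlgebra R F) ∈ ⋀[R']^n F' := by
  induction w using exteriorPower_induction with
  | hι v =>
    have h : extMap g (_root_.exteriorPower.ιMulti R n v : ExteriorAlgebra R F) = _ :=
      extMap_ιMulti g v
    rw [h]
    exact (_root_.exteriorPower.ιMulti R' n _).2
  | hadd x y hx hy => rw [Submodule.coe_add, map_add]; exact add_mem hx hy
  | hsmul r x hx => rw [Submodule.coe_smul, extMap_smul]; exact Submodule.smul_mem _ _ hx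

noncomputable section TopIso

open Opposite Limits

variable {C : Type u} [SmallCategory C] {J : GrothendieckTopology C}
  {A : Sheaf J CommRingCat.{u}} {K : CDGA A} (s : Splitting K)

namespace Splitting

lemma koszulRes_mk_zero {U V : C} (f : V ⟶ U)
    (w : ExteriorAlgebra (A.obj.obj (op U)) (s.E.val.obj (op U) →₀ A.obj.obj (op U))) :
    s.koszulRes f (SymTensor.mk (A.obj.obj (op U)) 0 w) =
      SymTensor.mk (A.obj.obj (op V)) 0 (extMap (freeMap (resRing A f) (res s.E.val f)) w) :=
  KoszulModule.map_mk (relMap (res (K.K.homology 1).val f) (res s.E.val f) (s.res_cls f))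
    (freeMap (resRing A f) (res s.E.val f)) 0 w

/-- Elements of `Λ^q(F)` which die in `Λ^q H^1(K)` are locally Koszul coboundaries. -/
lemma locally_exists_relD_eq {q : ℕ} {U : C}
    (w : ⋀[A.obj.obj (op U)]^q (s.E.val.obj (op U) →₀ A.obj.obj (op U)))
    (hw : ExteriorAlgebra.map (Finsupp.linearCombination (A.obj.obj (op U)) (s.cls U)) w.1 = 0) :
    Locally J U fun V f => ∃ b ∈ s.koszulGr q (q - 1) V,
      relD (A.obj.obj (op V)) (s.cls V) b =
        s.koszulRes f (SymTensor.mk (A.obj.obj (op U)) 0 w.1) := by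
  classical
  have h1 : (q : ℤ) - (q - 1) = 1 := by lia
  obtain ⟨D, hD⟩ := exists_finset_koszulBoundaries (s.cls U) w.1 w.2 hw
  have := s.epi
  refine (Locally.forall_mem_finset D fun y _ =>
    locally_exists_of_epi (s.lift ≫ K.K.homologyπ 1) y).mono fun V f hf => ?_
  choose! e he using hf
  obtain ⟨b, hb, hdb⟩ := hD (s.cls V) (res (K.K.homology 1).val f) (res s.E.val f) (s.res_cls f)
    e he
  exact ⟨b, (s.mem_koszulGr_iff h1).2 hb, hdb.trans (s.koszulRes_mk_zero f w.1).symm⟩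

lemma exists_mk_eq_koszulVal {q : ℕ} {U : C} (t : (s.koszulPre q q).obj (op U)) :
    ∃ w : ⋀[A.obj.obj (op U)]^q (s.E.val.obj (op U) →₀ A.obj.obj (op U)),
      SymTensor.mk (A.obj.obj (op U)) 0 w.1 = s.koszulVal q q U t :=
  KoszulModule.exists_mk_eq ((s.mem_koszulGr_iff (sub_self (q : ℤ))).1 (s.koszulVal_mem t))

variable (h2 : ∀ U : Cᵒᵖ, IsUnit (2 : A.obj.obj U))

lemma sec_eq_zero_of_iso {M N : Mod A} (μ : M ≅ N) {U : C} {x : M.val.obj (op U)}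
    (h : sec μ.hom.val U x = 0) : x = 0 := by
  have h1 : sec μ.inv.val U (sec μ.hom.val U x) = x :=
    congrArg (fun χ : M ⟶ M => sec χ.val U x) μ.hom_inv_id
  rw [← h1, h, map_zero]

lemma sec_inv_hom {M N : Mod A} (μ : M ≅ N) {U : C} (x : N.val.obj (op U)) :
    sec μ.hom.val U (sec μ.inv.val U x) = x :=
  congrArg (fun χ : N ⟶ N => sec χ.val U x) μ.inv_hom_id

variable {q : ℕ} (μ : exteriorPower (K.K.homology 1) q ≅ K.K.homology q)

/-- Locally, every cocycle of degree `q` is cohomologous to the image of an element of `Λ^q(F)`. -/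
lemma locally_exists_cocycle (hμ : ∀ (U : Cᵒᵖ) (z : Fin q → (K.K.cycles 1).val.obj U),
      μ.hom.val.app U (wedge (K.K.homology 1) fun i => K.cohomologyClass (z i)) =
        K.cohomologyClass (K.cycleProd z)) {U : C} (z : (K.K.cycles q).val.obj (op U)) :
    Locally J U fun V f => ∃ (w : ⋀[A.obj.obj (op V)]^q
        (s.E.val.obj (op V) →₀ A.obj.obj (op V))) (l : (K.K.X (q - 1)).val.obj (op V)),
      res _ f (sec (K.K.iCycles q).val U z) =
        s.toComp h2 q V (SymTensor.mk (A.obj.obj (op V)) 0 w.1) +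
          sec (K.K.d (q - 1) q).val V l := by
  have hq : (q : ℤ) - 1 + 1 = q := by lia
  refine (locally_eq_toSh _ (sec μ.inv.val U (sec (K.K.homologyπ q).val U z))).bind ?_
  rintro V f ⟨y, hy⟩
  refine (s.locally_exists_extCls_eq y).bind ?_
  rintro W g ⟨w, hw⟩
  obtain ⟨z', hz1, hz2⟩ := s.exists_cycle_toComp h2 μ.hom hμ w
  have h1 : sec (K.K.homologyπ q).val W z' =
      sec (K.K.homologyπ q).val W (res _ g (res _ f z)) := by
    refine hz2.trans ?_
    have h3 : sec (toSh (presheafExteriorPower (K.K.homology 1).val q)) W (s.extCls q W w) =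
        res _ g (res _ f (sec μ.inv.val U (sec (K.K.homologyπ q).val U z))) := by
      rw [hw, sec_res]
      exact congrArg (res _ g) hy
    refine (congrArg (sec μ.hom.val W) h3).trans ?_
    rw [sec_res, sec_res, sec_inv_hom, sec_res, sec_res]
  have h4 : sec (K.K.homologyπ q).val W (res _ g (res _ f z) - z') = 0 := by
    rw [map_sub, h1, sub_self]
  refine (locally_eq_d_of_homologyπ_eq_zero K.K (q - 1) q hq _ h4).mono ?_
  rintro W' g' ⟨l, hl⟩
  refine ⟨⟨_, extMap_mem (freeMap (resRing A g') (res s.E.val g')) w⟩, l, ?_⟩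
  have h5 := congrArg (s.toComp h2 q W') (s.koszulRes_mk_zero g' w.1)
  have h6 := (s.res_toComp h2 g' (SymTensor.mk (A.obj.obj (op W)) 0 w.1) q).trans h5
  refine Eq.trans ?_ (congrArg₂ (· + ·) ((congrArg (res _ g') hz1).trans h6) hl.symm)
  rw [map_sub, map_sub, add_sub_cancel, sec_res, sec_res, res_comp, res_comp]

/-- The Koszul complex of weight `q` has the same cohomology as `K` in degree `q`. -/
lemma isIso_homologyMap_koszulHom (hμ : ∀ (U : Cᵒᵖ) (z : Fin q → (K.K.cycles 1).val.obj U),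
      μ.hom.val.app U (wedge (K.K.homology 1) fun i => K.cohomologyClass (z i)) =
        K.cohomologyClass (K.cycleProd z)) :
    IsIso (HomologicalComplex.homologyMap (s.koszulHom h2 q) (q : ℤ)) := by
  have hq : (q : ℤ) - 1 + 1 = q := by lia
  refine isIso_homologyMap_shComplex (s.koszulHom h2 q) (q - 1) q (q + 1) hq rfl ?_ ?_
  · intro U t l _ hl
    obtain ⟨w, hw⟩ := s.exists_mk_eq_koszulVal t
    obtain ⟨z, hz1, hz2⟩ := s.exists_cycle_toComp h2 μ.hom hμ w
    have h1 : sec (K.K.d (q - 1) q).val U l = sec (K.K.iCycles q).val U z :=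
      hl.symm.trans ((s.koszulHom_ιSh h2 q q t).trans
        ((congrArg (s.toComp h2 q U) hw.symm).trans hz1.symm))
    have h3 : sec (toSh _) U (s.extCls q U w) = 0 :=
      sec_eq_zero_of_iso μ (hz2.symm.trans (homologyπ_eq_zero_of_eq_d K.K (q - 1) q z l h1))
    refine (locally_eq_zero_of_toSh _ _ h3).bind fun V f hf => ?_
    have h4 := (s.powVal_res_extCls f w).symm.trans
      ((congrArg (powVal (K.K.homology 1).val q V) hf).trans (map_zero _))
    refine (s.locally_exists_relD_eq ⟨_, extMap_mem _ w⟩ h4).mono ?_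
    rintro W g ⟨b, hb, hdb⟩
    refine ⟨s.koszulMk b hb, s.koszulVal_injective ?_⟩
    refine (s.koszulVal_d hq (s.koszulMk b hb)).trans (hdb.trans ?_)
    refine (congrArg (s.koszulRes g) (s.koszulRes_mk_zero f w.1).symm).trans ?_
    refine (s.koszulRes_comp f g _).symm.trans ?_
    exact congrArg (s.koszulRes (g ≫ f)) hw
  · intro U x hx
    obtain ⟨z, hz⟩ := exists_cycle K.K q (q + 1) rfl x hx
    refine (s.locally_exists_cocycle h2 μ hμ z).mono ?_
    rintro V f ⟨w, l, h⟩
    have hm : SymTensor.mk (A.obj.obj (op V)) 0 w.1 ∈ s.koszulGr q q V :=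
      (s.mem_koszulGr_iff (sub_self (q : ℤ))).2 (KoszulModule.mk_mem w)
    refine ⟨s.koszulMk _ hm, l, s.koszulVal_injective ?_, ?_⟩
    · refine (s.koszulVal_d rfl (s.koszulMk _ hm)).trans ((relD_mk_zero w.1).trans ?_)
      exact (map_zero (s.koszulVal q (q + 1) V)).symm
    · refine (congrArg (res _ f) hz.symm).trans (h.trans ?_)
      exact congrArg (· + _) (s.koszulHom_ιSh h2 q q (s.koszulMk _ hm)).symm

end Splitting

end TopIso

/-! ### Cohomology of truncations -/

section Truncation

open Limits CochainComplex HomologicalComplex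

variable {B : Type*} [Category* B] [Abelian B]

lemma isZero_homology_truncLE (T : CochainComplex B ℤ) (b p : ℤ)
    (h : p ≤ b → IsZero (T.homology p)) : IsZero ((T.truncLE b).homology p) := by
  by_cases hp : p ≤ b
  · have := T.quasiIsoAt_ιTruncLE b p hp
    exact (h hp).of_iso (isoOfQuasiIsoAt (T.ιTruncLE b) p)
  · exact ((T.truncLE b).exactAt_of_isLE b p (by lia)).isZero_homology

lemma isZero_homology_truncGE (T : CochainComplex B ℤ) (a p : ℤ)
    (h : a ≤ p → IsZero (T.homology p)) : IsZero ((T.truncGE a).homology p) := by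
  by_cases hp : a ≤ p
  · have := T.quasiIsoAt_πTruncGE a p hp
    exact (h hp).of_iso (isoOfQuasiIsoAt (T.πTruncGE a) p).symm
  · exact ((T.truncGE a).exactAt_of_isGE a p (by lia)).isZero_homology

variable {T K : CochainComplex B ℤ} (φ : T ⟶ K)

lemma isIso_homologyMap_truncLEMap (b i : ℤ) (hi : i ≤ b) (h : IsIso (homologyMap φ i)) :
    IsIso (homologyMap (truncLEMap φ b) i) := by
  have h1 := T.quasiIsoAt_ιTruncLE b i hi
  have h3 := K.quasiIsoAt_ιTruncLE b i hi
  rw [quasiIsoAt_iff_isIso_homologyMap] at h1 h3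
  have h4 : homologyMap (truncLEMap φ b) i ≫ homologyMap (K.ιTruncLE b) i =
      homologyMap (T.ιTruncLE b) i ≫ homologyMap φ i := by
    rw [← homologyMap_comp, ← homologyMap_comp, CochainComplex.ιTruncLE_naturality]
  have : IsIso (homologyMap (truncLEMap φ b) i ≫ homologyMap (K.ιTruncLE b) i) := by
    rw [h4]; infer_instance
  exact IsIso.of_isIso_comp_right _ (homologyMap (K.ιTruncLE b) i)

lemma isIso_homologyMap_truncGEMap (a i : ℤ) (hi : a ≤ i) (h : IsIso (homologyMap φ i)) :
    IsIso (homologyMap (truncGEMap φ a) i) := by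
  have h1 := T.quasiIsoAt_πTruncGE a i hi
  have h3 := K.quasiIsoAt_πTruncGE a i hi
  rw [quasiIsoAt_iff_isIso_homologyMap] at h1 h3
  have h4 : homologyMap (T.πTruncGE a) i ≫ homologyMap (truncGEMap φ a) i =
      homologyMap φ i ≫ homologyMap (K.πTruncGE a) i := by
    rw [← homologyMap_comp, ← homologyMap_comp, CochainComplex.πTruncGE_naturality]
  have : IsIso (homologyMap (T.πTruncGE a) i ≫ homologyMap (truncGEMap φ a) i) := by
    rw [h4]; infer_instance
  exact IsIso.of_isIso_comp_left (homologyMap (T.πTruncGE a) i) _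

lemma isZero_homology_truncInterval (T : CochainComplex B ℤ) (a b p : ℤ)
    (h : a ≤ p → p ≤ b → IsZero (T.homology p)) : IsZero ((truncInterval T a b).homology p) :=
  isZero_homology_truncGE _ _ _ fun ha => isZero_homology_truncLE _ _ _ (h ha)

variable [HasDerivedCategory.{w} B]

/-- A complex with at most one nonzero cohomology object is decomposable. -/
lemma isDecomposable_of_isZero_homology (M : CochainComplex B ℤ) (i : ℤ)
    (h : ∀ p, p ≠ i → IsZero (M.homology p)) : IsDecomposable M := by
  refine isDecomposable_of_forall_exists {i} (fun p hp => h p (by simpa using hp)) fun j hj => ?_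
  obtain rfl : j = i := by simpa using hj
  exact ⟨M, 𝟙 M, h, by rw [homologyMap_id]; infer_instance⟩

end Truncation

/-! ### Complexes with cohomology in one degree mapping to `K` -/

section Weights

open Opposite Limits

variable {C : Type u} [SmallCategory C] {J : GrothendieckTopology C}
  {A : Sheaf J CommRingCat.{u}} {K : CDGA A}

lemma CDGA.IsAbstractKoszul.isZero_homology (hK : K.IsAbstractKoszul) (p : ℤ) (hp : p < 0) :
    IsZero (K.K.homology p) :=
  ((K.K.exactAt_iff p).2 (ShortComplex.exact_of_isZero_X₂ _
    (hK.coconnective p hp))).isZero_homology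

lemma CDGA.exists_splitting (hK : K.IsAbstractKoszul)
    [HasDerivedCategory.{w} (Mod A)] (h1 : IsDecomposable (K.K.truncLE 1)) :
    Nonempty (Splitting K) := by
  obtain ⟨E, p, l, he, hc⟩ :=
    exists_splitting_of_isDecomposable (hK.coconnective (-1) (by lia)) h1
  exact ⟨⟨E, p, l, he, hc⟩⟩

lemma isUnit_two_of_factorial {m : ℕ} (hm2 : 2 ≤ m)
    (hm : ∀ U : Cᵒᵖ, IsUnit ((m.factorial : ℕ) : A.obj.obj U)) (U : Cᵒᵖ) :
    IsUnit (2 : A.obj.obj U) := by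
  refine isUnit_of_dvd_unit ?_ (hm U)
  have h : ((2 : ℕ) : A.obj.obj U) ∣ ((m.factorial : ℕ) : A.obj.obj U) :=
    Nat.cast_dvd_cast (Nat.factorial_dvd_factorial hm2)
  simpa using h

/-- A complex mapping to `K` which is an isomorphism on `H^i` and has no other cohomology in a
degree `p` with `i - p < m`, nor, if `i ≤ m`, in a degree `p ≤ 0`. -/
lemma CDGA.exists_weight (hK : K.IsAbstractKoszul) (hflat : K.IsFlatInLowDegrees) {m : ℕ}
    (hm2 : 2 ≤ m) (hm : ∀ U : Cᵒᵖ, IsUnit ((m.factorial : ℕ) : A.obj.obj U))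
    [HasDerivedCategory.{w} (Mod A)] (h1 : IsDecomposable (K.K.truncLE 1)) (i : ℤ) (hi : 0 ≤ i) :
    ∃ (T : CochainComplex (Mod A) ℤ) (φ : T ⟶ K.K),
      IsIso (HomologicalComplex.homologyMap φ i) ∧
        ∀ p, p ≠ i → (i < p + m ∨ p ≤ 0 ∧ i ≤ m) → IsZero (T.homology p) := by
  obtain ⟨s⟩ := CDGA.exists_splitting hK h1
  lift i to ℕ using hi
  obtain ⟨μ, hμ⟩ := hK.exists_iso i
  refine ⟨shComplex (s.koszulComplex i), s.koszulHom (isUnit_two_of_factorial hm2 hm) i,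
    s.isIso_homologyMap_koszulHom _ μ hμ, fun p hp hpm => ?_⟩
  by_cases hlt : p < 0 ∨ (i : ℤ) < p
  · exact s.isZero_homology_koszulComplex_of_lt i p hlt
  · push Not at hlt
    refine s.isZero_homology_koszulComplex hflat.flat_homology i p ((i - p - 1).toNat) ?_ m hm ?_ ?_
    all_goals lia

end Weights

end AbstractKoszul

theorem corollary2p9 {C : Type u} [SmallCategory C] {J : GrothendieckTopology C}
    (A : Sheaf J CommRingCat.{u}) [HasDerivedCategory.{w} (AbstractKoszul.Mod A)]
    (K : AbstractKoszul.CDGA A) (hK : K.IsAbstractKoszul) (hflat : K.IsFlatInLowDegrees)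
    (m : ℕ) (hm : ∀ U : Cᵒᵖ, IsUnit ((m.factorial : ℕ) : A.obj.obj U))
    (h1 : AbstractKoszul.IsDecomposable (K.K.truncLE 1)) :
    (∀ a b : ℤ, a ≤ b → b < a + m →
      AbstractKoszul.IsDecomposable (AbstractKoszul.truncInterval K.K a b)) ∧
    AbstractKoszul.IsDecomposable (K.K.truncLE m) := by
  open AbstractKoszul CochainComplex in
  rcases lt_or_ge m 2 with hm2 | hm2
  · -- the interval `[a, b]` has at most one element
    refine ⟨fun a b hab hb => isDecomposable_of_isZero_homology _ a fun p hp =>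
      isZero_homology_truncInterval _ _ _ _ fun _ _ => by lia, ?_⟩
    obtain rfl | rfl : m = 0 ∨ m = 1 := by lia
    · refine isDecomposable_of_isZero_homology _ 0 fun p hp =>
        isZero_homology_truncLE _ _ _ fun hp' => hK.isZero_homology p (by lia)
    · exact h1
  · refine ⟨fun a b _ hb => ?_, ?_⟩
    · refine isDecomposable_of_forall_exists ((Finset.Icc a b).filter (0 ≤ ·)) (fun p hp => ?_)
        fun i hi => ?_
      · rw [Finset.mem_filter, Finset.mem_Icc] at hp
        exact isZero_homology_truncInterval _ _ _ _ fun ha hb =>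
          hK.isZero_homology p (by by_contra h; exact hp ⟨⟨ha, hb⟩, by lia⟩)
      · rw [Finset.mem_filter, Finset.mem_Icc] at hi
        obtain ⟨T, φ, hφ, hT⟩ := CDGA.exists_weight hK hflat hm2 hm h1 i hi.2
        refine ⟨truncInterval T a b, truncGEMap (truncLEMap φ b) a, fun p hp =>
          isZero_homology_truncInterval _ _ _ _ fun ha hb => hT p hp (by lia), ?_⟩
        exact isIso_homologyMap_truncGEMap _ a i hi.1.1
          (isIso_homologyMap_truncLEMap φ b i hi.1.2 hφ)
    · refine isDecomposable_of_forall_exists (Finset.Icc 0 (m : ℤ)) (fun p hp => ?_)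
        fun i hi => ?_
      · rw [Finset.mem_Icc] at hp
        exact isZero_homology_truncLE _ _ _ fun hb => hK.isZero_homology p (by lia)
      · rw [Finset.mem_Icc] at hi
        obtain ⟨T, φ, hφ, hT⟩ := CDGA.exists_weight hK hflat hm2 hm h1 i hi.1
        exact ⟨T.truncLE m, truncLEMap φ m, fun p hp => isZero_homology_truncLE _ _ _ fun hb =>
          hT p hp (by lia), isIso_homologyMap_truncLEMap φ m i hi.2 hφ⟩
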